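/- **Setting.** Let $G$ be a bidirected tree with $n$ nodes, i.e. a tree in which every undirected edge $\{u,v\}$ is replaced by the two directed edges $(u,v)$ and $(v,u)$, each directed edge having an influence probability $p_{uv}$ and a boosted influence probability $p'_{uv}$ with $0\le p_{uv}\le p'_{uv}\le 1$. Let $S$ be a set of seeds. When a set $B$ of nodes is boosted, the influence spreads from $S$ as in the independent cascade model: each newly activated node $u$ makes one independent attempt to activate each inactive neighbour $v$, which succeeds with probability $p^B_{uv}$, where $p^B_{uv}=p'_{uv}$ if $v\in B$ and $p^B_{uv}=p_{uv}$ otherwise. Let $\sigma_S(B)$ be the expected number of finally active nodes, $\Delta_S(B)=\sigma_S(B)-\sigma_S(\emptyset)$, and let $ap_\emptyset(v)$ be the probability that $v$ becomes active when nothing is boosted. A $k$-boosting solution is a set $B$ of at most $k$ nodes; $B^*$ denotes one that maximizes $\Delta_S$. Let $p^{(k)}(x\rightsquigarrow v)$ be the maximum, over all sets $B$ of at most $k$ nodes, of the product of $p^B_e$ over the edges $e$ of the path from $x$ to $v$ (equal to $1$ if $x=v$). **Algorithm.** Root $G$ at a node $r$ so that every node has at most two children. Given $k\ge1$, $\varepsilon>0$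 and a number $LB$, `DP-Boost` puts $$\delta=\frac{\varepsilon\cdot\max(LB,1)}{\sum_{v}\sum_{x}p^{(k)}(x\rightsquigarrow v)} .$$ A number is *rounded* if it is $1$ or a multiple of $\delta$ in $[0,1]$, and $\lfloor x\rfloor_\delta$ is the largest rounded number that is at most $x$. For $0\le\kappa\le k$ and rounded $c,f$ it computes tables $g'(v,\kappa,c,f)$ from the leaves to the root, where $u$ is the parent of $v$ and $p^b_{xy}$ means $p'_{xy}$ if $b=1$ and $p_{xy}$ if $b=0$, with $p^b_{uv}=0$ if $v$ is the root: * $v$ a leaf: $g'(v,\kappa,c,f)=\max\{1-(1-c)(1-f\,p^{b}_{uv})-ap_\emptyset(v),0\}$ with $b=1$ iff $\kappa>0$, if $c$ is the indicator of $v\in S$, and $-\infty$ otherwise. * $v\in S$ with children $v_i$: $g'(v,\kappa,1,f)=\max_{\kappa=\sum_i\kappa_i}\sum_i\max_{c_i}g'(v_i,\kappa_i,c_i,1)$, and $-\infty$ for $c\ne1$. * $v\notin S$ with children $v_i$: $g'(v,\kappa,c,f)$ is the maximum of $\sum_i g'(v_i,\kappa_i,c_i,f_i)+\max\{1-(1-c)(1-f\,p^b_{uv})-ap_\emptyset(v),0\}$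 over all $b\in\{0,1\}$, $\kappa_i$ and rounded $c_i,f_i$ with $\kappa=b+\sum_i\kappa_i$, $c=\lfloor 1-\prod_i(1-c_i\,p^b_{v_iv})\rfloor_\delta$ and $f_i=\lfloor 1-(1-f\,p^b_{uv})\prod_{j\ne i}(1-c_j\,p^b_{v_jv})\rfloor_\delta$ (and $-\infty$ if there are none). It returns the node set that belongs to $\max_c g'(r,k,c,0)$. By default $LB=\Delta_S(B_{greedy})$, where $B_{greedy}$ is found greedily by adding $k$ times a node that makes $\sigma_S$ largest; this computation is then part of the algorithm. **Theorem.** Let every node of the rooted tree have at most two children, $k\ge 1$ and $\varepsilon>0$. `DP-Boost`, both with its default $LB$ and with any prescribed $LB$, returns a set $\tilde B$ of at most $k$ nodes. If $\Delta_S(B^*)\ge1$ then, with the default $LB$ and with any $LB\le\Delta_S(B^*)$, $$\Delta_S(\tilde B)\ \ge\ (1-\varepsilon)\,\Delta_S(B^*).$$ There is an absolute constant $C$ such that, on a unit-cost random access machine with real arithmetic and rounding to integers, `DP-Boost` takes at most $C\,k^2n^7\max(1,1/\varepsilon)^3$ steps, which is $O(k^2n^7/\varepsilon^3)$ for $\varepsilon\le1$.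 Hence it is a fully polynomial-time approximation scheme. -/

import Mathlib

open scoped BigOperators

noncomputable section

namespace Boosting

/-! ## Influence boosting on bidirected trees -/

/-- A `k`-boosting instance on a rooted bidirected tree with node set `Fin n`: every undirected
edge `{u, v}` of the tree stands for the two directed edges `(u, v)` and `(v, u)`.
`prob u v` is the influence probability and `probBoost u v` the boosted influence probability of
the directed edge `(u, v)`; their values off the edges are irrelevant.  The tree is presented to
algorithms by its adjacency lists `nbrs` and its root. -/
structure TreeInstance (n : ℕ) where
  graph : SimpleGraph (Fin n)
  isTree : graph.IsTree
  root : Fin n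
  nbrs : Fin n → List (Fin n)
  nbrs_nodup : ∀ v, (nbrs v).Nodup
  mem_nbrs : ∀ v w, w ∈ nbrs v ↔ graph.Adj v w
  prob : Fin n → Fin n → ℝ
  probBoost : Fin n → Fin n → ℝ
  prob_nonneg : ∀ u v, graph.Adj u v → 0 ≤ prob u v
  prob_le_probBoost : ∀ u v, graph.Adj u v → prob u v ≤ probBoost u v
  probBoost_le_one : ∀ u v, graph.Adj u v → probBoost u v ≤ 1
  seeds : Finset (Fin n)

namespace TreeInstance

variable {n : ℕ}

open Classical in
/-- The children of `v` in the tree rooted at `root`: the neighbours one step further away from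
the root. -/
def children (I : TreeInstance n) (v : Fin n) : Finset (Fin n) :=
  Finset.univ.filter fun w =>
    I.graph.Adj v w ∧ I.graph.dist I.root w = I.graph.dist I.root v + 1

open Classical in
/-- The probability `p^B_{uv}` that a newly activated `u` activates `v` when `B` is boosted
(zero if `(u, v)` is not an edge). -/
def edgeProb (I : TreeInstance n) (B : Finset (Fin n)) (u v : Fin n) : ℝ :=
  if I.graph.Adj u v then (if v ∈ B then I.probBoost u v else I.prob u v) else 0

/-- The diffusion process.  `coin (u, v)` is the outcome of the single attempt of `u` to activate
`v`, made in the round after `u` has become active.  The value after `t` rounds is the pair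
(active nodes, nodes activated in the last round). -/
def diffusion (I : TreeInstance n) (coin : Fin n × Fin n → Bool) :
    ℕ → Finset (Fin n) × Finset (Fin n)
  | 0 => (I.seeds, I.seeds)
  | t + 1 =>
    let A := (diffusion I coin t).1
    let N := (diffusion I coin t).2
    let N' := Finset.univ.filter fun v => v ∉ A ∧ ∃ u ∈ N, coin (u, v) = true
    (A ∪ N', N')

/-- The probability of an outcome of all attempts: they are independent, and the attempt along
`(u, v)` succeeds with probability `p^B_{uv}`. -/
def coinWeight (I : TreeInstance n) (B : Finset (Fin n)) (coin : Fin n × Fin n → Bool) : ℝ :=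
  ∏ e : Fin n × Fin n, if coin e then I.edgeProb B e.1 e.2 else 1 - I.edgeProb B e.1 e.2

/-- `σ_S(B)`: the expected number of nodes active at the end of the diffusion (after `n` rounds
no further node can become active). -/
def spread (I : TreeInstance n) (B : Finset (Fin n)) : ℝ :=
  ∑ coin : Fin n × Fin n → Bool, I.coinWeight B coin * ((I.diffusion coin n).1.card : ℝ)

/-- `Δ_S(B) = σ_S(B) - σ_S(∅)`. -/
def boost (I : TreeInstance n) (B : Finset (Fin n)) : ℝ :=
  I.spread B - I.spread ∅

/-- `Bopt` is an optimal solution of the `k`-boosting problem. -/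
def IsOptimal (I : TreeInstance n) (k : ℕ) (Bopt : Finset (Fin n)) : Prop :=
  Bopt.card ≤ k ∧ ∀ B : Finset (Fin n), B.card ≤ k → I.boost B ≤ I.boost Bopt

/-- The path from `x` to `v` in the tree. -/
def path (I : TreeInstance n) (x v : Fin n) : I.graph.Walk x v :=
  (I.isTree.existsUnique_path x v).choose

/-- The probability that `x` influences `v` when `B` is boosted: the product of the probabilities
of the edges of the path from `x` to `v` (it is `1` if `x = v`). -/
def pathProb (I : TreeInstance n) (B : Finset (Fin n)) (x v : Fin n) : ℝ :=
  ((I.path x v).darts.map fun e => I.edgeProb B e.fst e.snd).prod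

/-- `p^{(k)}(x ⇝ v)`: the largest probability that `x` influences `v` when at most `k` nodes are
boosted. -/
def maxPathProb (I : TreeInstance n) (k : ℕ) (x v : Fin n) : ℝ :=
  (Finset.univ.filter fun B : Finset (Fin n) => B.card ≤ k).sup' ⟨∅, by simp⟩
    fun B => I.pathProb B x v

end TreeInstance

/-! ## Programs with a step count

A program on a unit-cost real random access machine: every arithmetic operation, rounding,
comparison, read or write of one memory cell, loop iteration and procedure call is one step, and
allocating an array takes one step per cell.  Arrays are functions on their index set. -/

/-- A computation together with the number of steps that it takes. -/
structure Prog (α : Type) where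
  val : α
  time : ℕ

namespace Prog

variable {α β : Type}

instance : Monad Prog where
  pure a := ⟨a, 0⟩
  bind x f := ⟨(f x.val).val, x.time + (f x.val).time⟩

/-- One elementary step with result `a`. -/
def step (a : α) : Prog α := ⟨a, 1⟩

/-- A value that is already in a register. -/
def reg (x : ℝ) : Prog ℝ := ⟨x, 0⟩

/-- Each arithmetic operation on reals is one step after the evaluation of its arguments. -/
instance : One (Prog ℝ) := ⟨reg 1⟩
instance : Zero (Prog ℝ) := ⟨reg 0⟩
instance : Add (Prog ℝ) := ⟨fun x y => ⟨x.val + y.val, x.time + y.time + 1⟩⟩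
instance : Sub (Prog ℝ) := ⟨fun x y => ⟨x.val - y.val, x.time + y.time + 1⟩⟩
instance : Mul (Prog ℝ) := ⟨fun x y => ⟨x.val * y.val, x.time + y.time + 1⟩⟩
instance : Div (Prog ℝ) := ⟨fun x y => ⟨x.val / y.val, x.time + y.time + 1⟩⟩
instance : Max (Prog ℝ) := ⟨fun x y => ⟨max x.val y.val, x.time + y.time + 1⟩⟩

open Classical in
/-- Comparison of two reals. -/
def less (x y : ℝ) : Prog Bool := step (decide (x < y))

/-- A procedure call. -/
def call (x : Prog α) : Prog α := ⟨x.val, x.time + 1⟩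

/-- `for a in l do state := body state a`. -/
def loop (l : List α) (state : β) (body : β → α → Prog β) : Prog β :=
  match l with
  | [] => pure state
  | a :: l => do
    let state' ← call (body state a)
    loop l state' body

/-- `for i = 0, …, m - 1 do state := body state i`. -/
def loopN (m : ℕ) (state : β) (body : β → ℕ → Prog β) : Prog β :=
  loop (List.range m) state body

/-- Allocation of an array with `cells` cells, each holding `a`. -/
def alloc {ι : Type} (cells : ℕ) (a : α) : Prog (ι → α) := ⟨fun _ => a, cells⟩

/-- Read a cell. -/
def read {ι : Type} (T : ι → α) (i : ι) : Prog α := step (T i)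

/-- Write a cell. -/
def write {ι : Type} [DecidableEq ι] (T : ι → α) (i : ι) (a : α) : Prog (ι → α) :=
  step (Function.update T i a)

end Prog

open Prog

/-- A node set, as a pointer structure: the union of two stored sets takes one step. -/
inductive NodeSet (n : ℕ) where
  | empty : NodeSet n
  | single : Fin n → NodeSet n
  | union : NodeSet n → NodeSet n → NodeSet n

/-- Write out the elements of a stored node set in front of `acc`. -/
def NodeSet.flatten {n : ℕ} : NodeSet n → List (Fin n) → Prog (List (Fin n))
  | .empty, acc => step acc
  | .single v, acc => step (v :: acc)
  | .union s t, acc => do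
    let acc' ← call (t.flatten acc)
    call (s.flatten acc')

/-- A table entry: `none` stands for `-∞`; otherwise a value and the node set that it comes
from. -/
abbrev Entry (n : ℕ) := Option (ℝ × NodeSet n)

/-- The better of two entries. -/
def Entry.best {n : ℕ} (e₁ e₂ : Entry n) : Prog (Entry n) :=
  match e₁, e₂ with
  | none, _ => step e₂
  | some _, none => step e₁
  | some (x, _), some (y, _) => do
    let b ← less x y
    if b then step e₂ else step e₁

/-- The sum of the values and the union of the node sets of two entries. -/
def Entry.add {n : ℕ} (e₁ e₂ : Entry n) : Prog (Entry n) :=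
  match e₁, e₂ with
  | none, _ => step none
  | some _, none => step none
  | some (x, s), some (y, t) => do
    let z ← reg x + reg y
    step (some (z, NodeSet.union s t))

/-- The table of the values `g'(v, κ, c, f)` of one node, indexed by `κ` and by the indices of the
rounded values `c` and `f`. -/
abbrev Table (n : ℕ) := ℕ × ℕ × ℕ → Entry n

/-- `T[i] := max (T[i], e)`. -/
def Table.improve {n : ℕ} (T : Table n) (i : ℕ × ℕ × ℕ) (e : Entry n) : Prog (Table n) := do
  let old ← read T i
  let new ← Entry.best old e
  write T i new

/-- The rounded values are the multiples of `δ` in `[0, 1)`, with indices `0, …, M - 1`, and `1`,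
with index `M`, where `M = ⌈1/δ⌉`.  This is the rounded value with index `j`. -/
def roundedValue (δ : ℝ) (M j : ℕ) : Prog ℝ := do
  let b ← step (decide (j < M))
  if b then reg j * reg δ else 1

/-- The index of the largest rounded value that is at most `x`, for `x ∈ [0, 1]`. -/
def roundDown (δ : ℝ) (M : ℕ) (x : ℝ) : Prog ℕ := do
  let b ← less x 1
  if b then
    let q ← reg x / reg δ
    step ⌊q⌋₊
  else step M

namespace TreeInstance

variable {n : ℕ}

/-- Read `p^b_{uv}` from the input. -/
def readProb (I : TreeInstance n) (b : Bool) (u v : Fin n) : Prog ℝ :=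
  if b then step (I.probBoost u v) else step (I.prob u v)

/-- Read `p^b_{uv}` for the parent `u` of `v`; the root has no parent, and the value is `0`. -/
def readParentProb (I : TreeInstance n) (b : Bool) (parent : Option (Fin n)) (v : Fin n) :
    Prog ℝ :=
  match parent with
  | none => step 0
  | some u => I.readProb b u v

/-- Is `v` a seed? -/
def readSeed (I : TreeInstance n) (v : Fin n) : Prog Bool := step (decide (v ∈ I.seeds))

/-! ### Exact influence computation and the greedy lower bound -/

/-- The probability that `u` is activated in the part of the tree that remains after removing the
neighbour `away` of `u`, when the nodes marked in `B` are boosted: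
`ap_B(u∖away) = 1 - ∏_{w ∈ N(u)∖{away}} (1 - ap_B(w∖u) · p^B_{wu})`, and `1` for seeds.
The first argument bounds the depth of the recursion; a path has fewer than `n` edges, so `n`
suffices. -/
def activation (I : TreeInstance n) (B : Fin n → Bool) :
    ℕ → Option (Fin n) → Fin n → Prog ℝ
  | 0, _, _ => 0
  | fuel + 1, away, u => do
    let s ← I.readSeed u
    if s then 1 else
      let b ← read B u
      let q ← loop (I.nbrs u) 1 fun q w => do
        let skip ← step (decide (away = some w))
        if skip then pure q else
          let a ← call (activation I B fuel (some u) w)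
          let p ← I.readProb b w u
          reg q * (1 - reg a * reg p)
      1 - reg q

/-- The expected number of active nodes when the nodes marked in `B` are boosted. -/
def computeSpread (I : TreeInstance n) (B : Fin n → Bool) : Prog ℝ :=
  loop (List.finRange n) 0 fun s v => do
    let a ← call (I.activation B n none v)
    reg s + reg a

/-- `Greedy-Boost`: `k` times, boost in addition a node that makes the spread largest. -/
def greedyBoost (I : TreeInstance n) (k : ℕ) : Prog (Fin n → Bool) := do
  let start ← alloc n false
  loopN k start fun B _ => do
    let best ← loop (List.finRange n) (none : Option (ℝ × Fin n)) fun best u => do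
      let old ← read B u
      if old then pure best else
        let B' ← write B u true
        let s ← call (I.computeSpread B')
        let _ ← write B' u false
        match best with
        | none => step (some (s, u))
        | some (s₀, _) =>
          let b ← less s₀ s
          if b then step (some (s, u)) else pure best
    match best with
    | none => pure B
    | some (_, u) => write B u true

/-- The boost of the greedy solution. -/
def greedyLowerBound (I : TreeInstance n) (k : ℕ) : Prog ℝ := do
  let B ← call (I.greedyBoost k)
  let B₀ ← alloc n false
  let s ← call (I.computeSpread B)
  let s₀ ← call (I.computeSpread B₀)
  reg s - reg s₀

/-! ### The rounding parameter -/

/-- Depth-first search away from a source `x`: the sum of `p^{(k)}(x ⇝ y)` over all `y` in the part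
of the tree hanging from `v`, where `P j = p^{(j)}(x ⇝ v)` for `j ≤ k`. -/
def sumFrom (I : TreeInstance n) (k : ℕ) :
    ℕ → Option (Fin n) → Fin n → (ℕ → ℝ) → Prog ℝ
  | 0, _, _, _ => 0
  | fuel + 1, away, v, P => do
    let s₀ ← read P k
    loop (I.nbrs v) s₀ fun s w => do
      let skip ← step (decide (away = some w))
      if skip then pure s else
        let p ← I.readProb false v w
        let p' ← I.readProb true v w
        let Q₀ ← alloc (k + 1) (0 : ℝ)
        let Q ← loopN (k + 1) Q₀ fun Q j => do
          let a ← read P j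
          let isZero ← step (decide (j = 0))
          if isZero then
            let q ← reg a * reg p
            write Q j q
          else
            let a' ← read P (j - 1)
            let q ← max (reg a * reg p) (reg a' * reg p')
            write Q j q
        let t ← call (sumFrom I k fuel (some v) w Q)
        reg s + reg t

/-- `δ = ε · max (LB, 1) / ∑_v ∑_x p^{(k)}(x ⇝ v)`. -/
def roundingParameter (I : TreeInstance n) (k : ℕ) (ε LB : ℝ) : Prog ℝ := do
  let total ← loop (List.finRange n) 0 fun s x => do
    let P ← alloc (k + 1) (1 : ℝ)
    let t ← call (I.sumFrom k n none x P)
    reg s + reg t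
  reg ε * max (reg LB) 1 / reg total

/-! ### The rounded dynamic program

In the procedures below, `parent` is the parent of `v`, `ap₀` is the array of the activation
probabilities without boosting, and `δ`, `M` are as in `roundedValue`. -/

/-- `max {1 - (1 - c)(1 - f · p) - ap_∅(v), 0}`. -/
def gain (c f p a₀ : ℝ) : Prog ℝ :=
  max (1 - (1 - reg c) * (1 - reg f * reg p) - reg a₀) 0

/-- A new table, filled with `-∞`. -/
def newTable (n k M : ℕ) : Prog (Table n) := alloc ((k + 1) * (M + 1) * (M + 1)) none

/-- The node set `{v}` if `b`, and `∅` otherwise. -/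
def boostNode (b : Bool) (v : Fin n) : NodeSet n := if b then .single v else .empty

/-- The table of a leaf: `c` has to be the indicator of `v ∈ S`. -/
def leafTable (I : TreeInstance n) (ap₀ : Fin n → ℝ) (k : ℕ) (δ : ℝ) (M : ℕ)
    (parent : Option (Fin n)) (v : Fin n) : Prog (Table n) := do
  let T₀ ← newTable n k M
  let s ← I.readSeed v
  let a₀ ← read ap₀ v
  let ci ← step (if s then M else 0)
  let c ← roundedValue δ M ci
  loopN (k + 1) T₀ fun T κ => do
    let b ← step (decide (0 < κ))
    let p ← I.readParentProb b parent v
    loopN (M + 1) T fun T fi => do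
      let f ← roundedValue δ M fi
      let g ← gain c f p a₀
      T.improve (κ, ci, fi) (some (g, boostNode b v))

/-- The array `κ ↦ max_c g'(w, κ, c, 1)` of a node `w` with table `T`. -/
def bestBelowSeed (k M : ℕ) (T : Table n) : Prog (ℕ → Entry n) := do
  let h₀ ← alloc (k + 1) (none : Entry n)
  loopN (k + 1) h₀ fun h κ =>
    loopN (M + 1) h fun h ci => do
      let e ← read T (κ, ci, M)
      let old ← read h κ
      let new ← Entry.best old e
      write h κ new

/-- The table of a seed, from `h κ`, the largest value reachable with `κ` boosted nodes in the
subtrees of its children: `c` has to be `1`, and `f` is irrelevant. -/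
def seedTable (k M : ℕ) (h : ℕ → Entry n) : Prog (Table n) := do
  let T₀ ← newTable n k M
  loopN (k + 1) T₀ fun T κ =>
    loopN (M + 1) T fun T fi => do
      let e ← read h κ
      T.improve (κ, M, fi) e

/-- The table of a seed with one child. -/
def seedTableOne (k M : ℕ) (T₁ : Table n) : Prog (Table n) := do
  let h ← call (bestBelowSeed k M T₁)
  seedTable k M h

/-- The table of a seed with two children: maximize over `κ = κ₁ + κ₂`. -/
def seedTableTwo (k M : ℕ) (T₁ T₂ : Table n) : Prog (Table n) := do
  let h₁ ← call (bestBelowSeed k M T₁)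
  let h₂ ← call (bestBelowSeed k M T₂)
  let h₀ ← alloc (k + 1) (none : Entry n)
  let h ← loopN (k + 1) h₀ fun h κ₁ =>
    loopN (k + 1) h fun h κ₂ => do
      let fits ← step (decide (κ₁ + κ₂ ≤ k))
      if fits then
        let e₁ ← read h₁ κ₁
        let e₂ ← read h₂ κ₂
        let e ← Entry.add e₁ e₂
        let old ← read h (κ₁ + κ₂)
        let new ← Entry.best old e
        write h (κ₁ + κ₂) new
      else pure h
  seedTable k M h

/-- The table of a non-seed node with one child `w`.  For `b ∈ {0, 1}` (is `v` boosted?) and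
rounded `c_w` and `f`, the consistent subproblem has `c = ⌊c_w · p^b_{wv}⌋_δ`,
`f_w = ⌊f · p^b_{uv}⌋_δ` and `κ = κ_w + b`. -/
def nonseedTableOne (I : TreeInstance n) (ap₀ : Fin n → ℝ) (k : ℕ) (δ : ℝ) (M : ℕ)
    (parent : Option (Fin n)) (v w : Fin n) (T₁ : Table n) : Prog (Table n) := do
  let T₀ ← newTable n k M
  let a₀ ← read ap₀ v
  loop [false, true] T₀ fun T b => do
    let p ← I.readParentProb b parent v
    let p₁ ← I.readProb b w v
    loopN (M + 1) T fun T ci₁ =>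
      loopN (M + 1) T fun T fi => do
        let c₁ ← roundedValue δ M ci₁
        let f ← roundedValue δ M fi
        let x ← reg c₁ * reg p₁
        let ci ← roundDown δ M x
        let c ← roundedValue δ M ci
        let y₁ ← reg f * reg p
        let fi₁ ← roundDown δ M y₁
        let g ← gain c f p a₀
        loopN (k + 1) T fun T κ₁ => do
          let κ ← step (κ₁ + b.toNat)
          let fits ← step (decide (κ ≤ k))
          if fits then
            let e₁ ← read T₁ (κ₁, ci₁, fi₁)
            let e ← Entry.add (some (g, boostNode b v)) e₁
            T.improve (κ, ci, fi) e
          else pure T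

/-- The table of a non-seed node with children `w₁` and `w₂`.  For `b ∈ {0, 1}` and rounded `c₁`,
`c₂` and `f`, the consistent subproblem has
`c = ⌊1 - (1 - c₁ · p^b_{w₁v})(1 - c₂ · p^b_{w₂v})⌋_δ`,
`f₁ = ⌊1 - (1 - f · p^b_{uv})(1 - c₂ · p^b_{w₂v})⌋_δ`,
`f₂ = ⌊1 - (1 - f · p^b_{uv})(1 - c₁ · p^b_{w₁v})⌋_δ` and `κ = κ₁ + κ₂ + b`. -/
def nonseedTableTwo (I : TreeInstance n) (ap₀ : Fin n → ℝ) (k : ℕ) (δ : ℝ) (M : ℕ)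
    (parent : Option (Fin n)) (v w₁ w₂ : Fin n) (T₁ T₂ : Table n) : Prog (Table n) := do
  let T₀ ← newTable n k M
  let a₀ ← read ap₀ v
  loop [false, true] T₀ fun T b => do
    let p ← I.readParentProb b parent v
    let p₁ ← I.readProb b w₁ v
    let p₂ ← I.readProb b w₂ v
    loopN (M + 1) T fun T ci₁ =>
      loopN (M + 1) T fun T ci₂ =>
        loopN (M + 1) T fun T fi => do
          let c₁ ← roundedValue δ M ci₁
          let c₂ ← roundedValue δ M ci₂
          let f ← roundedValue δ M fi
          let x ← 1 - (1 - reg c₁ * reg p₁) * (1 - reg c₂ * reg p₂)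
          let ci ← roundDown δ M x
          let c ← roundedValue δ M ci
          let y₁ ← 1 - (1 - reg f * reg p) * (1 - reg c₂ * reg p₂)
          let fi₁ ← roundDown δ M y₁
          let y₂ ← 1 - (1 - reg f * reg p) * (1 - reg c₁ * reg p₁)
          let fi₂ ← roundDown δ M y₂
          let g ← gain c f p a₀
          loopN (k + 1) T fun T κ₁ =>
            loopN (k + 1) T fun T κ₂ => do
              let κ ← step (κ₁ + κ₂ + b.toNat)
              let fits ← step (decide (κ ≤ k))
              if fits then
                let e₁ ← read T₁ (κ₁, ci₁, fi₁)
                let e₂ ← read T₂ (κ₂, ci₂, fi₂)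
                let e' ← Entry.add e₁ e₂
                let e ← Entry.add (some (g, boostNode b v)) e'
                T.improve (κ, ci, fi) e
              else pure T

/-- The tables of all nodes, from the leaves to the root: compute the tables of the children of
`v`, then the table of `v`.  The first argument bounds the depth of the recursion; `n` suffices.
Trees with a node with more than two children are not treated (last case). -/
def dpTable (I : TreeInstance n) (ap₀ : Fin n → ℝ) (k : ℕ) (δ : ℝ) (M : ℕ) :
    ℕ → Option (Fin n) → Fin n → Prog (Table n)
  | 0, _, _ => newTable n k M
  | fuel + 1, parent, v => do
    let below ← loop (I.nbrs v) ([] : List (Fin n × Table n)) fun l w => do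
      let skip ← step (decide (parent = some w))
      if skip then pure l else
        let T ← call (dpTable I ap₀ k δ M fuel (some v) w)
        step (l ++ [(w, T)])
    let s ← I.readSeed v
    match below with
    | [] => call (I.leafTable ap₀ k δ M parent v)
    | [(w, T₁)] =>
      if s then call (seedTableOne k M T₁)
      else call (I.nonseedTableOne ap₀ k δ M parent v w T₁)
    | [(w₁, T₁), (w₂, T₂)] =>
      if s then call (seedTableTwo k M T₁ T₂)
      else call (I.nonseedTableTwo ap₀ k δ M parent v w₁ w₂ T₁ T₂)
    | _ => newTable n k M

/-- The rounded dynamic program with rounding parameter `δ`: the node set that belongs to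
`max_c g'(root, k, c, 0)`. -/
def roundedDP (I : TreeInstance n) (k : ℕ) (δ : ℝ) : Prog (List (Fin n)) := do
  let B₀ ← alloc n false
  let ap ← alloc n (0 : ℝ)
  let ap₀ ← loop (List.finRange n) ap fun ap v => do
    let a ← call (I.activation B₀ n none v)
    write ap v a
  let r ← 1 / reg δ
  let M ← step ⌈r⌉₊
  let T ← call (I.dpTable ap₀ k δ M n none I.root)
  let best ← loopN (M + 1) (none : Entry n) fun best ci => do
    let e ← read T (k, ci, 0)
    Entry.best best e
  match best with
  | none => step []
  | some (_, s) => call (s.flatten [])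

/-- `DP-Boost` with a given lower bound `LB` of the optimal boost. -/
def dpBoostWith (I : TreeInstance n) (k : ℕ) (ε LB : ℝ) : Prog (List (Fin n)) := do
  let δ ← call (I.roundingParameter k ε LB)
  call (I.roundedDP k δ)

/-- `DP-Boost`: the lower bound is the boost of the solution of `Greedy-Boost`. -/
def dpBoost (I : TreeInstance n) (k : ℕ) (ε : ℝ) : Prog (List (Fin n)) := do
  let LB ← call (I.greedyLowerBound k)
  I.dpBoostWith k ε LB

end TreeInstance

end Boosting

end

namespace Boosting

open Prog

namespace TreeInstance

variable {n : ℕ}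

/-! ### Paths and the parts of the tree behind a node -/

/-! On a tree every influence question decomposes at a node. Removing a neighbour `away` of `u`
leaves a part `side away u` that contains `u`, and this part is the disjoint union of `u` and the
parts hanging from the other neighbours `kids away u`. All recursive programs follow this
decomposition, and all claims about them are proved by `side_induction`: the part shrinks strictly,
so a recursion depth of at least its size suffices.

Exactness of the spread. If an attempt is tossed in advance for every directed edge, the nodes
active at the end are those reached from a seed along successful attempts (`mem_diffusion_iff`). The
branches at a node use disjoint sets of coins, so the probability of being reached satisfies the
product recursion of `activation` (`coinMean_reachedInd`), and the spread is the sum of these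
probabilities `ap` (`spread_eq_sum_ap`). The boost is therefore a sum of node contributions
`nodeBoost`.

Soundness of the tables. The maps that compute `c` and the `f_i` are monotone and all rounding is
downwards. Hence a table entry that carries a node set never overestimates: its `c` is at most the
true activation probability from below, and if its `f` is at most the true probability from above,
then its value is at most the boost that the set achieves in the subtree (`SoundEntry`,
`dpTable_sound`). At the root `f` is irrelevant, so the value found is attained by the set that is
returned.

Completeness. Fix a set `B` and feed its true probabilities through the rounded recursion. One
rounding at `x` loses at most `δ`. The map `1 - (1 - x)(1 - y)` is 1-Lipschitz in each argument on
the unit square, so a loss is only multiplied by the edge probabilities on its way from `x` to `v`.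
The total loss at `v` is thus at most `δ ∑_x p^B(x ⇝ v)`, which is `δ * pathSum B none v`, because
`pathSum` obeys the recursion of the accumulated losses (`pathSum_eq`). Summed over `v`, some entry
at the root has a value of at least `boost B - δ * totalPathProb k` (`roundedDP_complete`). The
entry has to use the budget exactly; a leaf accepts any surplus, which is why budgets are described
by `Allocation`.

Approximation. The parameter `δ` is chosen so that `δ * totalPathProb k = ε * max LB 1`, and this is
at most `ε` times the optimal boost when that boost is at least `1` and at least `LB`. The greedy
bound is admissible simply because it is the boost of some set of at most `k` nodes.

Running time. With `M = ⌈1/δ⌉` a table costs `O(k² M³)` steps: two budgets and three rounded values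
are enumerated. As every path probability is at most `1`, `1/δ ≤ n²/ε`; with `n` tables this gives
`k² n⁷ max(1, 1/ε)³`. The greedy phase and the computation of `δ` are of lower order. -/

lemma path_isPath (I : TreeInstance n) (x v : Fin n) : (I.path x v).IsPath :=
  (I.isTree.existsUnique_path x v).choose_spec.1

lemma eq_path (I : TreeInstance n) {x v : Fin n} {p : I.graph.Walk x v} (hp : p.IsPath) :
    p = I.path x v :=
  (I.isTree.existsUnique_path x v).choose_spec.2 p hp

lemma path_self (I : TreeInstance n) (x : Fin n) : I.path x x = SimpleGraph.Walk.nil :=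
  (I.eq_path SimpleGraph.Walk.IsPath.nil).symm

lemma path_concat (I : TreeInstance n) {x w u : Fin n} (h : I.graph.Adj w u)
    (hu : u ∉ (I.path x w).support) : I.path x u = (I.path x w).concat h :=
  (I.eq_path ((I.path_isPath x w).concat hu h)).symm

/-- In an acyclic graph the paths from `x` to the two ends of an edge differ by exactly that edge.
This translates between "`x` is separated from `u` by `w`" and "`u` is not met on the way to `w`".
-/
lemma not_mem_path_iff (I : TreeInstance n) {x w u : Fin n} (h : I.graph.Adj w u) :
    u ∉ (I.path x w).support ↔ w ∈ (I.path x u).support := by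
  constructor
  · intro hu
    exact I.isTree.isAcyclic.mem_support_of_ne_mem_support_of_adj_of_isPath
      (I.path_isPath x u) (I.path_isPath x w) h.symm hu
  · intro hw
    exact I.isTree.isAcyclic.ne_mem_support_of_support_of_adj_of_isPath
      (I.path_isPath x u) (I.path_isPath x w) h.symm hw

/-- A path in a tree contains only one neighbour of its end, namely its penultimate node. This is
why different branches at `u` are disjoint. -/
lemma eq_of_mem_path (I : TreeInstance n) {x u v w : Fin n} (hv : I.graph.Adj v u)
    (hw : I.graph.Adj w u) (hv' : v ∈ (I.path x u).support) (hw' : w ∈ (I.path x u).support) :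
    v = w := by
  rw [I.isTree.isAcyclic.eq_penultimate_of_adj_end (I.path_isPath x u) hv.symm hv',
    I.isTree.isAcyclic.eq_penultimate_of_adj_end (I.path_isPath x u) hw.symm hw']

lemma exists_adj_mem_path (I : TreeInstance n) {x u : Fin n} (hx : x ≠ u) :
    ∃ w, I.graph.Adj w u ∧ w ∈ (I.path x u).support := by
  have hn : ¬ (I.path x u).Nil := fun h => hx h.eq
  exact ⟨_, (I.path x u).adj_penultimate hn, by simp⟩

/-- The part of the tree that contains `u` after removing the neighbour `away` of `u`. -/
noncomputable def side (I : TreeInstance n) : Option (Fin n) → Fin n → Finset (Fin n)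
  | none, _ => Finset.univ
  | some a, u => Finset.univ.filter fun x => a ∉ (I.path x u).support

@[simp] lemma side_none (I : TreeInstance n) (u : Fin n) : I.side none u = Finset.univ := rfl

lemma mem_side_some (I : TreeInstance n) {a u x : Fin n} :
    x ∈ I.side (some a) u ↔ a ∉ (I.path x u).support := by
  simp [side]

/-- The neighbours of `u` other than `away`, in the order of the adjacency list. -/
def kids (I : TreeInstance n) (away : Option (Fin n)) (u : Fin n) : List (Fin n) :=
  (I.nbrs u).filter fun w => !decide (away = some w)

lemma kids_none (I : TreeInstance n) (u : Fin n) : I.kids none u = I.nbrs u := by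
  simp [kids]

lemma mem_kids (I : TreeInstance n) {away : Option (Fin n)} {u w : Fin n} :
    w ∈ I.kids away u ↔ I.graph.Adj u w ∧ away ≠ some w := by
  simp [kids, I.mem_nbrs]

lemma kids_nodup (I : TreeInstance n) (away : Option (Fin n)) (u : Fin n) :
    (I.kids away u).Nodup :=
  (I.nbrs_nodup u).filter _

lemma nbrs_perm_cons (I : TreeInstance n) {a u : Fin n} (h : I.graph.Adj a u) :
    (I.nbrs u).Perm (a :: I.kids (some a) u) := by
  have h1 := List.perm_cons_erase ((I.mem_nbrs u a).2 h.symm)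
  rw [(I.nbrs_nodup u).erase_eq_filter] at h1
  refine h1.trans (List.Perm.of_eq ?_)
  rw [kids]
  congr 1
  apply List.filter_congr
  intro w _
  by_cases h : w = a
  · simp [h]
  · simp [h, Ne.symm h]

lemma kids_perm (I : TreeInstance n) {a u : Fin n} {l : List (Fin n)} (h : (I.nbrs u).Perm l) :
    (I.kids (some a) u).Perm (l.filter fun w => decide (w ≠ a)) := by
  refine (h.filter _).trans (List.Perm.of_eq ?_)
  apply List.filter_congr
  intro w _
  by_cases h : w = a
  · simp [h]
  · simp [h, Ne.symm h]

/-- The excluded neighbour is a neighbour. -/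
def Borders (I : TreeInstance n) (away : Option (Fin n)) (u : Fin n) : Prop :=
  ∀ a, away = some a → I.graph.Adj a u

lemma borders_none (I : TreeInstance n) (u : Fin n) : I.Borders none u := by
  simp [Borders]

lemma borders_some (I : TreeInstance n) {a u : Fin n} :
    I.Borders (some a) u ↔ I.graph.Adj a u := by
  simp [Borders]

lemma borders_kid (I : TreeInstance n) {away : Option (Fin n)} {u w : Fin n}
    (hw : w ∈ I.kids away u) : I.Borders (some u) w :=
  I.borders_some.2 (I.mem_kids.1 hw).1

lemma self_mem_side (I : TreeInstance n) {away : Option (Fin n)} {u : Fin n}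
    (h : I.Borders away u) : u ∈ I.side away u := by
  cases away with
  | none => simp
  | some a =>
    rw [mem_side_some, path_self]
    simpa using (I.borders_some.1 h).ne

/-- The last step of the path from `x` to `u` tells in which branch `x` lies; it comes from `away`
exactly for the nodes that were cut off. -/
lemma mem_side_iff (I : TreeInstance n) {away : Option (Fin n)} {u x : Fin n}
    (h : I.Borders away u) :
    x ∈ I.side away u ↔ x = u ∨ ∃ w ∈ I.kids away u, x ∈ I.side (some u) w := by
  constructor
  · intro hx
    by_cases hxu : x = u
    · exact Or.inl hxu
    · obtain ⟨w, hw, hw'⟩ := I.exists_adj_mem_path hxu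
      refine Or.inr ⟨w, I.mem_kids.2 ⟨hw.symm, ?_⟩, ?_⟩
      · rintro rfl
        exact I.mem_side_some.1 hx hw'
      · rw [mem_side_some, I.not_mem_path_iff hw]
        exact hw'
  · rintro (rfl | ⟨w, hw, hx⟩)
    · exact I.self_mem_side h
    · cases away with
      | none => simp
      | some a =>
        rw [mem_side_some] at hx ⊢
        obtain ⟨hw1, hw2⟩ := I.mem_kids.1 hw
        rw [I.not_mem_path_iff hw1.symm] at hx
        intro ha
        exact hw2 (by rw [I.eq_of_mem_path (I.borders_some.1 h) hw1.symm ha hx])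

lemma side_disjoint (I : TreeInstance n) {u v w : Fin n} (hv : I.graph.Adj u v)
    (hw : I.graph.Adj u w) (hvw : v ≠ w) : Disjoint (I.side (some u) v) (I.side (some u) w) := by
  rw [Finset.disjoint_left]
  intro x h1 h2
  rw [mem_side_some, I.not_mem_path_iff hv.symm] at h1
  rw [mem_side_some, I.not_mem_path_iff hw.symm] at h2
  exact hvw (I.eq_of_mem_path hv.symm hw.symm h1 h2)

lemma not_mem_side_some (I : TreeInstance n) (u w : Fin n) : u ∉ I.side (some u) w := by
  simp [mem_side_some]

lemma side_eq (I : TreeInstance n) {away : Option (Fin n)} {u : Fin n} (h : I.Borders away u) :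
    I.side away u = insert u ((I.kids away u).toFinset.biUnion (I.side (some u))) := by
  ext x
  simp [I.mem_side_iff h]

lemma sum_side (I : TreeInstance n) {M : Type*} [AddCommMonoid M] {away : Option (Fin n)}
    {u : Fin n} (h : I.Borders away u) (F : Fin n → M) :
    ∑ x ∈ I.side away u, F x
      = F u + ((I.kids away u).map fun w => ∑ x ∈ I.side (some u) w, F x).sum := by
  rw [I.side_eq h, Finset.sum_insert, Finset.sum_biUnion, List.sum_toFinset _ (I.kids_nodup _ _)]
  · intro v hv w hw hvw
    simp only [List.coe_toFinset, Set.mem_ofPred_eq] at hv hw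
    exact I.side_disjoint (I.mem_kids.1 hv).1 (I.mem_kids.1 hw).1 hvw
  · simp [not_mem_side_some]

lemma card_side (I : TreeInstance n) {away : Option (Fin n)} {u : Fin n} (h : I.Borders away u) :
    (I.side away u).card = 1 + ((I.kids away u).map fun w => (I.side (some u) w).card).sum := by
  simpa using I.sum_side (M := ℕ) h (fun _ => 1)

lemma side_subset (I : TreeInstance n) {away : Option (Fin n)} {u w : Fin n}
    (h : I.Borders away u) (hw : w ∈ I.kids away u) : I.side (some u) w ⊆ I.side away u :=
  fun _ hx => (I.mem_side_iff h).2 (Or.inr ⟨w, hw, hx⟩)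

lemma card_side_kid (I : TreeInstance n) {away : Option (Fin n)} {u w : Fin n}
    (h : I.Borders away u) (hw : w ∈ I.kids away u) :
    (I.side (some u) w).card < (I.side away u).card :=
  Finset.card_lt_card ⟨I.side_subset h hw, fun hs =>
    I.not_mem_side_some u w (hs (I.self_mem_side h))⟩

lemma card_side_pos (I : TreeInstance n) {away : Option (Fin n)} {u : Fin n}
    (h : I.Borders away u) : 0 < (I.side away u).card :=
  Finset.card_pos.2 ⟨u, I.self_mem_side h⟩

lemma card_side_le (I : TreeInstance n) (away : Option (Fin n)) (u : Fin n) :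
    (I.side away u).card ≤ n := by
  simpa using Finset.card_le_univ (I.side away u)

/-- Induction over the parts of the tree, for recursions with a bound on their depth. -/
lemma side_induction (I : TreeInstance n) {P : ℕ → Option (Fin n) → Fin n → Prop}
    (H : ∀ fuel away u, I.Borders away u → (I.side away u).card ≤ fuel + 1 →
      (∀ w ∈ I.kids away u, P fuel (some u) w) → P (fuel + 1) away u) :
    ∀ fuel away u, I.Borders away u → (I.side away u).card ≤ fuel → P fuel away u := by
  intro fuel
  induction fuel with
  | zero =>
    intro away u h hc
    have := I.card_side_pos h
    omega
  | succ fuel ih =>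
    intro away u h hc
    refine H fuel away u h hc fun w hw => ih (some u) w (I.borders_kid hw) ?_
    have := I.card_side_kid h hw
    omega

/-! ### Orientation of the edges away from a node -/

/-- The neighbour `away` of `v` lies on the path from `x` to `v`; there is none if `v = x`. -/
def Toward (I : TreeInstance n) (x : Fin n) : Option (Fin n) → Fin n → Prop
  | none, v => v = x
  | some a, v => I.graph.Adj a v ∧ v ∉ (I.path x a).support

lemma Toward.borders {I : TreeInstance n} {x : Fin n} {away : Option (Fin n)} {v : Fin n}
    (h : I.Toward x away v) : I.Borders away v := by
  cases away with
  | none => exact I.borders_none v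
  | some a => exact I.borders_some.2 h.1

/-- The only neighbour of `v` on the path from `x` to `v` is `away`, so `w` cannot be on that path
and the path to `w` leaves through `v`. -/
lemma Toward.kid {I : TreeInstance n} {x : Fin n} {away : Option (Fin n)} {v w : Fin n}
    (h : I.Toward x away v) (hw : w ∈ I.kids away v) : I.Toward x (some v) w := by
  obtain ⟨h1, h2⟩ := I.mem_kids.1 hw
  refine ⟨h1, fun hm => ?_⟩
  cases away with
  | none =>
    obtain rfl : v = x := h
    rw [path_self] at hm
    exact h1.ne' (by simpa using hm)
  | some a =>
    have ha := (I.not_mem_path_iff h.1).1 h.2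
    exact h2 (by rw [I.eq_of_mem_path h.1 h1.symm ha hm])

lemma exists_toward (I : TreeInstance n) (x v : Fin n) : ∃ away, I.Toward x away v := by
  by_cases h : v = x
  · exact ⟨none, h⟩
  · obtain ⟨w, hw, hw'⟩ := I.exists_adj_mem_path (Ne.symm h)
    exact ⟨some w, hw, (I.not_mem_path_iff hw).2 hw'⟩

lemma dist_eq_length (I : TreeInstance n) (x v : Fin n) :
    I.graph.dist x v = (I.path x v).length := by
  obtain ⟨p, hp, hp'⟩ := (I.isTree.connected x v).exists_path_of_dist
  rw [← hp', I.eq_path hp]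

/-- Links the recursion, which only remembers where it came from, with `children`, which is defined
by distances from the root. -/
lemma Toward.mem_children {I : TreeInstance n} {away : Option (Fin n)} {v w : Fin n}
    (h : I.Toward I.root away v) (hw : w ∈ I.kids away v) : w ∈ I.children v := by
  have h' := h.kid hw
  simp only [children, Finset.mem_filter, Finset.mem_univ, true_and]
  refine ⟨h'.1, ?_⟩
  rw [dist_eq_length, dist_eq_length, I.path_concat h'.1 h'.2, SimpleGraph.Walk.length_concat]

lemma Toward.length_kids_le {I : TreeInstance n} (hI : ∀ v, (I.children v).card ≤ 2)
    {away : Option (Fin n)} {v : Fin n} (h : I.Toward I.root away v) :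
    (I.kids away v).length ≤ 2 := by
  rw [← List.toFinset_card_of_nodup (I.kids_nodup away v)]
  refine le_trans (Finset.card_le_card fun w hw => ?_) (hI v)
  exact h.mem_children (List.mem_toFinset.1 hw)

/-- Two children and at most one parent. Unlike `Toward.length_kids_le` this also serves the
recursions that do not start at the root. -/
lemma length_nbrs_le (I : TreeInstance n) (hI : ∀ v, (I.children v).card ≤ 2) (v : Fin n) :
    (I.nbrs v).length ≤ 3 := by
  obtain ⟨away, h⟩ := I.exists_toward I.root v
  have h2 := h.length_kids_le hI
  cases away with
  | none => rw [kids_none] at h2; omega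
  | some a =>
    rw [(I.nbrs_perm_cons h.1).length_eq, List.length_cons]
    omega

/-! ### Probabilities of paths -/

lemma edgeProb_of_adj (I : TreeInstance n) (B : Finset (Fin n)) {u v : Fin n}
    (h : I.graph.Adj u v) :
    I.edgeProb B u v = if v ∈ B then I.probBoost u v else I.prob u v := by
  simp [edgeProb, h]

lemma edgeProb_nonneg (I : TreeInstance n) (B : Finset (Fin n)) (u v : Fin n) :
    0 ≤ I.edgeProb B u v := by
  unfold edgeProb
  split_ifs with h
  · exact (I.prob_nonneg u v h).trans (I.prob_le_probBoost u v h)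
  · exact I.prob_nonneg u v h
  · exact le_rfl

lemma edgeProb_le_one (I : TreeInstance n) (B : Finset (Fin n)) (u v : Fin n) :
    I.edgeProb B u v ≤ 1 := by
  unfold edgeProb
  split_ifs with h
  · exact I.probBoost_le_one u v h
  · exact (I.prob_le_probBoost u v h).trans (I.probBoost_le_one u v h)
  · exact zero_le_one

lemma edgeProb_mono (I : TreeInstance n) {B B' : Finset (Fin n)} (h : B ⊆ B') (u v : Fin n) :
    I.edgeProb B u v ≤ I.edgeProb B' u v := by
  by_cases ha : I.graph.Adj u v
  · rw [I.edgeProb_of_adj B ha, I.edgeProb_of_adj B' ha]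
    have := I.prob_le_probBoost u v ha
    by_cases h1 : v ∈ B
    · simp [h1, h h1]
    · split_ifs
      · exact this
      · exact le_rfl
  · simp [edgeProb, ha]

lemma pathProb_self (I : TreeInstance n) (B : Finset (Fin n)) (x : Fin n) :
    I.pathProb B x x = 1 := by
  simp [pathProb, path_self]

lemma pathProb_concat (I : TreeInstance n) (B : Finset (Fin n)) {x w u : Fin n}
    (h : I.graph.Adj w u) (hu : u ∉ (I.path x w).support) :
    I.pathProb B x u = I.pathProb B x w * I.edgeProb B w u := by
  simp [pathProb, I.path_concat h hu]

lemma pathProb_nonneg (I : TreeInstance n) (B : Finset (Fin n)) (x v : Fin n) :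
    0 ≤ I.pathProb B x v := by
  apply List.prod_nonneg
  simp only [List.mem_map, forall_exists_index, and_imp, forall_apply_eq_imp_iff₂]
  intro e _
  exact I.edgeProb_nonneg _ _ _

lemma pathProb_le_one (I : TreeInstance n) (B : Finset (Fin n)) (x v : Fin n) :
    I.pathProb B x v ≤ 1 := by
  unfold pathProb
  induction (I.path x v).darts with
  | nil => simp
  | cons e l ih =>
    simp only [List.map_cons, List.prod_cons]
    refine mul_le_one₀ (I.edgeProb_le_one _ _ _) (List.prod_nonneg ?_) ih
    simp only [List.mem_map, forall_exists_index, and_imp, forall_apply_eq_imp_iff₂]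
    intro e _
    exact I.edgeProb_nonneg _ _ _

/-- The sum of the probabilities of all paths to `u` that avoid `away`. -/
noncomputable def pathSum (I : TreeInstance n) (B : Finset (Fin n)) (away : Option (Fin n)) (u : Fin n) : ℝ :=
  ∑ x ∈ I.side away u, I.pathProb B x u

/-- Paths are sorted by their last edge. The recursion has the shape of an error recursion: the
summand `1` stands for the rounding at `u`, and the losses of the branches arrive scaled by the edge
probability. -/
lemma pathSum_eq (I : TreeInstance n) (B : Finset (Fin n)) {away : Option (Fin n)} {u : Fin n}
    (h : I.Borders away u) :
    I.pathSum B away u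
      = 1 + ((I.kids away u).map fun w => I.pathSum B (some u) w * I.edgeProb B w u).sum := by
  rw [pathSum, I.sum_side h, pathProb_self]
  congr 2
  apply List.map_congr_left
  intro w hw
  rw [pathSum, Finset.sum_mul]
  refine Finset.sum_congr rfl fun x hx => ?_
  exact I.pathProb_concat B (I.mem_kids.1 hw).1.symm (I.mem_side_some.1 hx)

lemma pathSum_nonneg (I : TreeInstance n) (B : Finset (Fin n)) (away : Option (Fin n))
    (u : Fin n) : 0 ≤ I.pathSum B away u :=
  Finset.sum_nonneg fun _ _ => I.pathProb_nonneg _ _ _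

end TreeInstance

end Boosting

namespace Boosting

open Prog

/-! ### Values and running times of programs -/

namespace Prog

variable {α β γ : Type}

@[simp] lemma val_pure (a : α) : (pure a : Prog α).val = a := rfl
@[simp] lemma time_pure (a : α) : (pure a : Prog α).time = 0 := rfl
@[simp] lemma val_bind (x : Prog α) (f : α → Prog β) : (x >>= f).val = (f x.val).val := rfl
@[simp] lemma time_bind (x : Prog α) (f : α → Prog β) :
    (x >>= f).time = x.time + (f x.val).time := rfl
@[simp] lemma val_step (a : α) : (step a).val = a := rfl
@[simp] lemma time_step (a : α) : (step a).time = 1 := rfl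
@[simp] lemma val_reg (a : ℝ) : (reg a).val = a := rfl
@[simp] lemma time_reg (a : ℝ) : (reg a).time = 0 := rfl
@[simp] lemma val_one : (1 : Prog ℝ).val = 1 := rfl
@[simp] lemma time_one : (1 : Prog ℝ).time = 0 := rfl
@[simp] lemma val_zero : (0 : Prog ℝ).val = 0 := rfl
@[simp] lemma time_zero : (0 : Prog ℝ).time = 0 := rfl
@[simp] lemma val_add (x y : Prog ℝ) : (x + y).val = x.val + y.val := rfl
@[simp] lemma time_add (x y : Prog ℝ) : (x + y).time = x.time + y.time + 1 := rfl
@[simp] lemma val_sub (x y : Prog ℝ) : (x - y).val = x.val - y.val := rfl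
@[simp] lemma time_sub (x y : Prog ℝ) : (x - y).time = x.time + y.time + 1 := rfl
@[simp] lemma val_mul (x y : Prog ℝ) : (x * y).val = x.val * y.val := rfl
@[simp] lemma time_mul (x y : Prog ℝ) : (x * y).time = x.time + y.time + 1 := rfl
@[simp] lemma val_div (x y : Prog ℝ) : (x / y).val = x.val / y.val := rfl
@[simp] lemma time_div (x y : Prog ℝ) : (x / y).time = x.time + y.time + 1 := rfl
@[simp] lemma val_max (x y : Prog ℝ) : (max x y).val = max x.val y.val := rfl
@[simp] lemma time_max (x y : Prog ℝ) : (max x y).time = x.time + y.time + 1 := rfl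
@[simp] lemma val_call (x : Prog α) : (call x).val = x.val := rfl
@[simp] lemma time_call (x : Prog α) : (call x).time = x.time + 1 := rfl
open Classical in
@[simp] lemma val_less (x y : ℝ) : (less x y).val = decide (x < y) := by
  simp [less]
@[simp] lemma time_less (x y : ℝ) : (less x y).time = 1 := rfl
@[simp] lemma val_alloc {ι : Type} (m : ℕ) (a : α) :
    (alloc m a : Prog (ι → α)).val = fun _ => a := rfl
@[simp] lemma time_alloc {ι : Type} (m : ℕ) (a : α) :
    (alloc m a : Prog (ι → α)).time = m := rfl
@[simp] lemma val_read {ι : Type} (T : ι → α) (i : ι) : (read T i).val = T i := rfl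
@[simp] lemma time_read {ι : Type} (T : ι → α) (i : ι) : (read T i).time = 1 := rfl
@[simp] lemma val_write {ι : Type} [DecidableEq ι] (T : ι → α) (i : ι) (a : α) :
    (write T i a).val = Function.update T i a := rfl
@[simp] lemma time_write {ι : Type} [DecidableEq ι] (T : ι → α) (i : ι) (a : α) :
    (write T i a).time = 1 := rfl
@[simp] lemma val_ite (c : Prop) [Decidable c] (x y : Prog α) :
    (if c then x else y).val = if c then x.val else y.val := by split_ifs <;> rfl
@[simp] lemma time_ite (c : Prop) [Decidable c] (x y : Prog α) :
    (if c then x else y).time = if c then x.time else y.time := by split_ifs <;> rfl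

lemma loop_time_cons (a : α) (l : List α) (s : β) (body : β → α → Prog β) :
    (loop (a :: l) s body).time
      = (body s a).time + 1 + (loop l (body s a).val body).time := rfl

lemma loop_time_le_sum (l : List α) (s : β) (body : β → α → Prog β) (c : α → ℕ)
    (h : ∀ s, ∀ a ∈ l, (body s a).time ≤ c a) :
    (loop l s body).time ≤ (l.map fun a => c a + 1).sum := by
  induction l generalizing s with
  | nil => simp [loop]
  | cons a l ih =>
    rw [loop_time_cons, List.map_cons, List.sum_cons]
    have h1 := h s a (by simp)
    have h2 := ih (body s a).val fun s b hb => h s b (by simp [hb])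
    omega

lemma loop_time_le (l : List α) (s : β) (body : β → α → Prog β) (c : ℕ)
    (h : ∀ s, ∀ a ∈ l, (body s a).time ≤ c) :
    (loop l s body).time ≤ l.length * (c + 1) := by
  simpa using loop_time_le_sum l s body (fun _ => c) h

lemma loopN_time_le (m : ℕ) (s : β) (body : β → ℕ → Prog β) (c : ℕ)
    (h : ∀ s, ∀ i < m, (body s i).time ≤ c) :
    (loopN m s body).time ≤ m * (c + 1) := by
  have := loop_time_le (List.range m) s body c (by simpa using h)
  rwa [List.length_range] at this

/-- Separates the constant overhead `c`, paid for every neighbour, from the recursive cost `f`, paid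
only for those not skipped. For the loops over `nbrs` the filtered list is `kids` by definition. -/
lemma loop_time_le_skip (l : List α) (s : β) (body : β → α → Prog β) (skip : α → Bool)
    (c : ℕ) (f : α → ℕ) (h : ∀ s, ∀ a ∈ l, (body s a).time ≤ if skip a then c else c + f a) :
    (loop l s body).time
      ≤ l.length * (c + 1) + ((l.filter fun a => !skip a).map f).sum := by
  refine (loop_time_le_sum l s body _ h).trans ?_
  clear h
  induction l with
  | nil => simp
  | cons a l ih =>
    cases ha : skip a <;> simp [ha, add_mul] at ih ⊢ <;> omega

lemma loop_induction {P : β → Prop} (l : List α) (s : β) (body : β → α → Prog β) (h0 : P s)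
    (h : ∀ s, P s → ∀ a ∈ l, P (body s a).val) : P (loop l s body).val := by
  induction l generalizing s with
  | nil => exact h0
  | cons a l ih =>
    simp only [loop, val_bind, val_call]
    exact ih _ (h s h0 a (by simp)) fun s hs b hb => h s hs b (by simp [hb])

lemma loopN_induction {P : β → Prop} (m : ℕ) (s : β) (body : β → ℕ → Prog β) (h0 : P s)
    (h : ∀ s, P s → ∀ i < m, P (body s i).val) : P (loopN m s body).val :=
  loop_induction _ _ _ h0 (by simpa using h)

/-- If no iteration decreases the state and iteration `a` establishes an upward closed property,
then the property holds at the end. -/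
lemma loop_reach {P : β → Prop} (l : List α) (s : β) (body : β → α → Prog β) {a : α}
    (ha : a ∈ l) (h : ∀ s, P s → ∀ b ∈ l, P (body s b).val) (hP : ∀ s, P (body s a).val) :
    P (loop l s body).val := by
  induction l generalizing s with
  | nil => simp at ha
  | cons b l ih =>
    simp only [loop, val_bind, val_call]
    have h' : ∀ s, P s → ∀ b ∈ l, P (body s b).val := fun s hs c hc => h s hs c (by simp [hc])
    rcases List.mem_cons.1 ha with rfl | ha
    · exact loop_induction _ _ _ (hP s) h'
    · exact ih _ ha h'

lemma loopN_reach {P : β → Prop} (m : ℕ) (s : β) (body : β → ℕ → Prog β) {i : ℕ}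
    (hi : i < m) (h : ∀ s, P s → ∀ j < m, P (body s j).val) (hP : ∀ s, P (body s i).val) :
    P (loopN m s body).val :=
  loop_reach _ _ _ (List.mem_range.2 hi) (by simpa using h) hP

end Prog

lemma loop_skip_mul {α : Type} (l : List α) (q : ℝ) (body : ℝ → α → Prog ℝ)
    (skip : α → Bool) (g : α → ℝ)
    (h : ∀ q w, (body q w).val = if skip w = true then q else q * g w) :
    (loop l q body).val = q * ((l.filter fun w => !skip w).map g).prod := by
  induction l generalizing q with
  | nil => simp [loop]
  | cons a l ih => cases ha : skip a <;> simp [loop, ha, ih, h, mul_assoc]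

lemma loop_skip_add {α : Type} (l : List α) (q : ℝ) (body : ℝ → α → Prog ℝ)
    (skip : α → Bool) (g : α → ℝ)
    (h : ∀ q w, (body q w).val = if skip w = true then q else q + g w) :
    (loop l q body).val = q + ((l.filter fun w => !skip w).map g).sum := by
  induction l generalizing q with
  | nil => simp [loop]
  | cons a l ih => cases ha : skip a <;> simp [loop, ha, ih, h, add_assoc]

namespace TreeInstance

variable {n : ℕ}

@[simp] lemma val_readProb (I : TreeInstance n) (b : Bool) (u v : Fin n) :
    (I.readProb b u v).val = if b then I.probBoost u v else I.prob u v := by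
  cases b <;> rfl

@[simp] lemma time_readProb (I : TreeInstance n) (b : Bool) (u v : Fin n) :
    (I.readProb b u v).time = 1 := by
  cases b <;> rfl

@[simp] lemma time_readParentProb (I : TreeInstance n) (b : Bool) (p : Option (Fin n))
    (v : Fin n) : (I.readParentProb b p v).time = 1 := by
  cases p <;> simp [readParentProb]

@[simp] lemma val_readSeed (I : TreeInstance n) (v : Fin n) :
    (I.readSeed v).val = decide (v ∈ I.seeds) := rfl

@[simp] lemma time_readSeed (I : TreeInstance n) (v : Fin n) : (I.readSeed v).time = 1 := rfl

lemma readProb_eq_edgeProb (I : TreeInstance n) (B : Finset (Fin n)) {u v : Fin n}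
    (h : I.graph.Adj u v) : (I.readProb (decide (v ∈ B)) u v).val = I.edgeProb B u v := by
  simp [I.edgeProb_of_adj B h]

/-! ### The activation probabilities -/

lemma activation_succ_val (I : TreeInstance n) (B : Fin n → Bool) (fuel : ℕ)
    (away : Option (Fin n)) (u : Fin n) :
    (I.activation B (fuel + 1) away u).val = if u ∈ I.seeds then 1 else
      1 - ((I.kids away u).map fun w =>
        1 - (I.activation B fuel (some u) w).val * (I.readProb (B u) w u).val).prod := by
  rw [activation]
  by_cases h : u ∈ I.seeds
  · simp [h]
  · simp only [val_bind, val_readSeed, h, decide_false, Bool.false_eq_true, if_false, val_read,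
      val_sub, val_one, val_reg]
    rw [loop_skip_mul (skip := fun w => decide (away = some w)) (g := fun w =>
      1 - (I.activation B fuel (some u) w).val * (I.readProb (B u) w u).val), one_mul]
    · rfl
    · intro q w
      by_cases hs : away = some w <;> simp [hs]

/-- `ap_B(u∖away)`. -/
noncomputable def ap (I : TreeInstance n) (B : Finset (Fin n)) (away : Option (Fin n))
    (u : Fin n) : ℝ :=
  (I.activation (fun v => decide (v ∈ B)) n away u).val

/-- The recursion ends before it exhausts a depth bound that is at least the size of the part, so
the bound does not influence the value. -/
lemma activation_val_congr (I : TreeInstance n) (B : Fin n → Bool) {fuel fuel' : ℕ}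
    {away : Option (Fin n)} {u : Fin n} (h : I.Borders away u)
    (h1 : (I.side away u).card ≤ fuel) (h2 : (I.side away u).card ≤ fuel') :
    (I.activation B fuel away u).val = (I.activation B fuel' away u).val := by
  refine I.side_induction (P := fun fuel away u => ∀ fuel', I.Borders away u →
    (I.side away u).card ≤ fuel' →
    (I.activation B fuel away u).val = (I.activation B fuel' away u).val)
    ?_ fuel away u h h1 fuel' h h2
  intro fuel away u h _ ih fuel' _ h2
  obtain ⟨m, rfl⟩ : ∃ m, fuel' = m + 1 := ⟨fuel' - 1, by have := I.card_side_pos h; omega⟩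
  rw [activation_succ_val, activation_succ_val]
  congr 2
  congr 1
  apply List.map_congr_left
  intro w hw
  rw [ih w hw m (I.borders_kid hw) (by have := I.card_side_kid h hw; omega)]

lemma ap_eq (I : TreeInstance n) (B : Finset (Fin n)) {away : Option (Fin n)} {u : Fin n}
    (h : I.Borders away u) :
    I.ap B away u = if u ∈ I.seeds then 1 else
      1 - ((I.kids away u).map fun w => 1 - I.ap B (some u) w * I.edgeProb B w u).prod := by
  -- Depth `n` is raised to `n + 1` here, so that one unfolding returns to the depth `n` that `ap`
  -- uses.
  rw [ap, I.activation_val_congr _ h (I.card_side_le away u)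
    ((I.card_side_le away u).trans (Nat.le_succ n)), activation_succ_val]
  congr 2
  congr 1
  apply List.map_congr_left
  intro w hw
  rw [I.readProb_eq_edgeProb B (I.mem_kids.1 hw).1.symm]
  rfl

lemma ap_seed (I : TreeInstance n) (B : Finset (Fin n)) {away : Option (Fin n)} {u : Fin n}
    (h : I.Borders away u) (hu : u ∈ I.seeds) : I.ap B away u = 1 := by
  rw [I.ap_eq B h, if_pos hu]

lemma prod_one_sub_mem_Icc {α : Type} (l : List α) (f : α → ℝ)
    (h : ∀ a ∈ l, 0 ≤ f a ∧ f a ≤ 1) :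
    0 ≤ (l.map fun a => 1 - f a).prod ∧ (l.map fun a => 1 - f a).prod ≤ 1 := by
  induction l with
  | nil => simp
  | cons a l ih =>
    obtain ⟨h1, h2⟩ := ih fun b hb => h b (by simp [hb])
    obtain ⟨h3, h4⟩ := h a (by simp)
    simp only [List.map_cons, List.prod_cons]
    exact ⟨mul_nonneg (by linarith) h1, mul_le_one₀ (by linarith) h1 h2⟩

lemma prod_one_sub_le {α : Type} (l : List α) (f g : α → ℝ)
    (h : ∀ a ∈ l, f a ≤ g a ∧ g a ≤ 1) :
    (l.map fun a => 1 - g a).prod ≤ (l.map fun a => 1 - f a).prod := by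
  induction l with
  | nil => simp
  | cons a l ih =>
    have ih := ih fun b hb => h b (by simp [hb])
    obtain ⟨h3, h4⟩ := h a (by simp)
    have h0 : 0 ≤ (l.map fun a => 1 - g a).prod := by
      apply List.prod_nonneg
      simp only [List.mem_map, forall_exists_index, and_imp, forall_apply_eq_imp_iff₂]
      intro b hb
      linarith [(h b (by simp [hb])).2]
    simp only [List.map_cons, List.prod_cons]
    exact mul_le_mul (by linarith) ih h0 (by linarith)

lemma ap_mem_Icc (I : TreeInstance n) (B : Finset (Fin n)) {away : Option (Fin n)} {u : Fin n}
    (h : I.Borders away u) : 0 ≤ I.ap B away u ∧ I.ap B away u ≤ 1 := by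
  refine I.side_induction (P := fun _ away u => 0 ≤ I.ap B away u ∧ I.ap B away u ≤ 1)
    ?_ n away u h (I.card_side_le away u)
  intro fuel away u h _ ih
  rw [I.ap_eq B h]
  split_ifs
  · simp
  · have := prod_one_sub_mem_Icc (I.kids away u)
      (fun w => I.ap B (some u) w * I.edgeProb B w u) fun w hw =>
        ⟨mul_nonneg (ih w hw).1 (I.edgeProb_nonneg _ _ _),
          mul_le_one₀ (ih w hw).2 (I.edgeProb_nonneg _ _ _) (I.edgeProb_le_one _ _ _)⟩
    constructor <;> linarith

lemma ap_mono (I : TreeInstance n) {B B' : Finset (Fin n)} (hB : B ⊆ B')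
    {away : Option (Fin n)} {u : Fin n} (h : I.Borders away u) :
    I.ap B away u ≤ I.ap B' away u := by
  refine I.side_induction (P := fun _ away u => I.ap B away u ≤ I.ap B' away u)
    ?_ n away u h (I.card_side_le away u)
  intro fuel away u h _ ih
  rw [I.ap_eq B h, I.ap_eq B' h]
  split_ifs
  · simp
  · have := prod_one_sub_le (I.kids away u) (fun w => I.ap B (some u) w * I.edgeProb B w u)
      (fun w => I.ap B' (some u) w * I.edgeProb B' w u) fun w hw =>
        ⟨mul_le_mul (ih w hw) (I.edgeProb_mono hB _ _) (I.edgeProb_nonneg _ _ _)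
          (I.ap_mem_Icc B' (I.borders_kid hw)).1,
          mul_le_one₀ (I.ap_mem_Icc B' (I.borders_kid hw)).2 (I.edgeProb_nonneg _ _ _)
            (I.edgeProb_le_one _ _ _)⟩
    linarith

/-- Boosting a node affects only the edges that enter it. Edges leading out of the part do not
matter for the activation inside it, and neither do edges into a seed. -/
lemma ap_congr (I : TreeInstance n) {B B' : Finset (Fin n)} {away : Option (Fin n)} {u : Fin n}
    (h : I.Borders away u) (hB : ∀ x ∈ I.side away u, x ∉ I.seeds → (x ∈ B ↔ x ∈ B')) :
    I.ap B away u = I.ap B' away u := by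
  refine I.side_induction (P := fun _ away u => (∀ x ∈ I.side away u, x ∉ I.seeds →
    (x ∈ B ↔ x ∈ B')) → I.ap B away u = I.ap B' away u)
    ?_ n away u h (I.card_side_le away u) hB
  intro fuel away u h _ ih hB
  rw [I.ap_eq B h, I.ap_eq B' h]
  split_ifs with hs
  · rfl
  · congr 2
    apply List.map_congr_left
    intro w hw
    have ha := (I.mem_kids.1 hw).1.symm
    rw [ih w hw fun x hx => hB x (I.side_subset h hw hx), I.edgeProb_of_adj B ha,
      I.edgeProb_of_adj B' ha]
    simp only [hB u (I.self_mem_side h) hs]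

/-- A node has at most three neighbours, hence a constant cost of its own, and the branches are
disjoint, so the total cost is linear in the size of the part. -/
lemma activation_time_le (I : TreeInstance n) (hI : ∀ v, (I.children v).card ≤ 2)
    (B : Fin n → Bool) (fuel : ℕ) {away : Option (Fin n)} {u : Fin n}
    (h : I.Borders away u) (hf : (I.side away u).card ≤ fuel) :
    (I.activation B fuel away u).time ≤ 30 * (I.side away u).card := by
  refine I.side_induction (P := fun fuel away u =>
    (I.activation B fuel away u).time ≤ 30 * (I.side away u).card) ?_ fuel away u h hf
  intro fuel away u h _ ih
  have hl := loop_time_le_skip (I.nbrs u) (1 : ℝ) (fun q w => do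
        let skip ← step (decide (away = some w))
        if skip then pure q else
          let a ← call (I.activation B fuel (some u) w)
          let p ← I.readProb (B u) w u
          reg q * (1 - reg a * reg p)) (fun w => decide (away = some w)) 7
        (fun w => if w ∈ I.kids away u then 30 * (I.side (some u) w).card else 0) (by
      intro s w hw
      by_cases hs : away = some w
      · simp [hs]
      · have hk : w ∈ I.kids away u := I.mem_kids.2 ⟨(I.mem_nbrs u w).1 hw, hs⟩
        have := ih w hk
        simp [hs, hk]
        omega)
  have hd := I.length_nbrs_le hI u
  have hsum : ((I.kids away u).map fun w =>
      if w ∈ I.kids away u then 30 * (I.side (some u) w).card else 0).sum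
      = 30 * ((I.kids away u).map fun w => (I.side (some u) w).card).sum := by
    rw [← List.sum_map_mul_left]
    congr 1
    apply List.map_congr_left
    intro w hw
    simp [hw]
  change _ ≤ _ + ((I.kids away u).map fun w =>
      if w ∈ I.kids away u then 30 * (I.side (some u) w).card else 0).sum at hl
  rw [hsum] at hl
  rw [I.card_side h, activation]
  by_cases hs : u ∈ I.seeds
  · simp [hs]
    omega
  · simp only [time_bind, time_readSeed, val_readSeed, hs, decide_false, Bool.false_eq_true,
      if_false, time_read, time_sub, time_one, time_reg, val_read]
    omega

end TreeInstance

end Boosting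

namespace Boosting

/-! ### Expectations over independent coins -/

section DependsOn

variable {ι : Type}

lemma dependsOn_mul {f g : (ι → Bool) → ℝ} {s t : Set ι} (hf : DependsOn f s)
    (hg : DependsOn g t) : DependsOn (fun c => f c * g c) (s ∪ t) := by
  intro c d h
  simp only
  rw [hf fun i hi => h i (Or.inl hi), hg fun i hi => h i (Or.inr hi)]

lemma dependsOn_one_sub {f : (ι → Bool) → ℝ} {s : Set ι} (hf : DependsOn f s) :
    DependsOn (fun c => 1 - f c) s := by
  intro c d h
  simp only
  rw [hf h]

lemma dependsOn_list_prod {α : Type} (l : List α) {F : α → (ι → Bool) → ℝ} {D : α → Set ι}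
    (hF : ∀ a ∈ l, DependsOn (F a) (D a)) :
    DependsOn (fun c => (l.map fun a => F a c).prod) {i | ∃ a ∈ l, i ∈ D a} := by
  intro c d h
  simp only
  congr 1
  apply List.map_congr_left
  intro a ha
  exact hF a ha fun i hi => h i ⟨a, ha, hi⟩

end DependsOn

section Coins

variable {ι : Type} [Fintype ι] [DecidableEq ι]

/-- The expectation of `f` when coin `i` shows `true` with probability `p i`. -/
noncomputable def coinMean (p : ι → ℝ) (f : (ι → Bool) → ℝ) : ℝ :=
  ∑ c : ι → Bool, (∏ i, if c i then p i else 1 - p i) * f c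

lemma sum_prod_bool (w : ι → Bool → ℝ) :
    ∑ c : ι → Bool, ∏ i, w i (c i) = ∏ i, (w i true + w i false) := by
  have := Finset.prod_univ_sum (fun _ : ι => (Finset.univ : Finset Bool)) w
  rw [Fintype.piFinset_univ] at this
  rw [← this]
  simp

lemma coinMean_one (p : ι → ℝ) : coinMean p (fun _ => 1) = 1 := by
  have := sum_prod_bool (fun i b => if b then p i else 1 - p i)
  simp only [coinMean, mul_one]
  rw [this]
  simp

lemma coinMean_coin (p : ι → ℝ) (i : ι) :
    coinMean p (fun c => if c i then 1 else 0) = p i := by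
  -- The indicator of coin `i` is written as a product over all coins, with factor `1` for `j ≠ i`,
  -- so that the sum over all outcomes factorizes.
  have := sum_prod_bool (fun j b => (if b then p j else 1 - p j) *
    (if j = i then (if b then 1 else 0) else 1))
  simp only [Finset.prod_mul_distrib, Finset.prod_ite_eq', Finset.mem_univ, if_true] at this
  rw [coinMean, this, Finset.prod_eq_single i]
  · simp
  · intro j _ hj
    simp [hj]
  · simp

lemma coinMean_sub (p : ι → ℝ) (f g : (ι → Bool) → ℝ) :
    coinMean p (fun c => f c - g c) = coinMean p f - coinMean p g := by
  simp [coinMean, mul_sub]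

/-- Independence by exchange: in the double sum over two outcomes `c` and `d`, exchanging their
coordinates outside `s` is an involution that preserves the product of the weights and turns `f c *
g c` into `f c * g d`. -/
lemma coinMean_mul (p : ι → ℝ) {f g : (ι → Bool) → ℝ} {s t : Set ι} (hf : DependsOn f s)
    (hg : DependsOn g t) (h : Disjoint s t) :
    coinMean p (fun c => f c * g c) = coinMean p f * coinMean p g := by
  classical
  -- The factor `coinMean p (fun _ => 1) = 1` supplies the second outcome.
  have key : coinMean p (fun c => f c * g c) * coinMean p (fun _ => 1)
      = coinMean p f * coinMean p g := by
    simp only [coinMean, Finset.sum_mul_sum, ← Finset.sum_product']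
    refine Finset.sum_nbij' (fun x => (s.piecewise x.1 x.2, s.piecewise x.2 x.1))
      (fun x => (s.piecewise x.1 x.2, s.piecewise x.2 x.1)) ?_ ?_ ?_ ?_ ?_
    · simp
    · simp
    · rintro ⟨c, d⟩ _
      ext i <;> by_cases hi : i ∈ s <;> simp [hi]
    · rintro ⟨c, d⟩ _
      ext i <;> by_cases hi : i ∈ s <;> simp [hi]
    · rintro ⟨c, d⟩ _
      have e1 : f (s.piecewise c d) = f c := hf fun i hi => by simp [hi]
      have e2 : g (s.piecewise d c) = g c := hg fun i hi => by
        have : i ∉ s := fun h' => (Set.disjoint_left.1 h) h' hi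
        simp [this]
      have e3 : (∏ i, if c i then p i else 1 - p i) * (∏ i, if d i then p i else 1 - p i)
          = (∏ i, if s.piecewise c d i then p i else 1 - p i) *
            (∏ i, if s.piecewise d c i then p i else 1 - p i) := by
        rw [← Finset.prod_mul_distrib, ← Finset.prod_mul_distrib]
        refine Finset.prod_congr rfl fun i _ => ?_
        by_cases hi : i ∈ s
        · simp [hi]
        · simp [hi, mul_comm]
      simp only [e1, e2]
      linear_combination (f c * g c) * e3
  rwa [coinMean_one, mul_one] at key

lemma coinMean_list_prod {α : Type} (p : ι → ℝ) (l : List α) {F : α → (ι → Bool) → ℝ}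
    {D : α → Set ι} (hF : ∀ a ∈ l, DependsOn (F a) (D a))
    (hD : l.Pairwise fun a b => Disjoint (D a) (D b)) :
    coinMean p (fun c => (l.map fun a => F a c).prod) = (l.map fun a => coinMean p (F a)).prod := by
  induction l with
  | nil => simpa using coinMean_one p
  | cons a l ih =>
    have hD' := List.pairwise_cons.1 hD
    have hF' : ∀ b ∈ l, DependsOn (F b) (D b) := fun b hb => hF b (by simp [hb])
    simp only [List.map_cons, List.prod_cons]
    rw [coinMean_mul p (hF a (by simp)) (dependsOn_list_prod l hF'), ih hF' hD'.2]
    rw [Set.disjoint_left]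
    rintro i hi ⟨b, hb, hi'⟩
    exact (Set.disjoint_left.1 (hD'.1 b hb)) hi hi'

end Coins

namespace TreeInstance

variable {n : ℕ}

/-! ### The diffusion process and live paths -/

/-- `u` is reached from a seed by a path of successful attempts that avoids `away`. -/
inductive Reached (I : TreeInstance n) (coin : Fin n × Fin n → Bool) :
    Option (Fin n) → Fin n → Prop
  | seed {away u} : u ∈ I.seeds → Reached I coin away u
  | step {away u w} : w ∈ I.kids away u → coin (w, u) = true → Reached I coin (some u) w →
      Reached I coin away u

lemma reached_iff (I : TreeInstance n) (coin : Fin n × Fin n → Bool) (away : Option (Fin n))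
    (u : Fin n) : I.Reached coin away u ↔
      u ∈ I.seeds ∨ ∃ w ∈ I.kids away u, coin (w, u) = true ∧ I.Reached coin (some u) w := by
  constructor
  · rintro (h | ⟨h1, h2, h3⟩)
    · exact Or.inl h
    · exact Or.inr ⟨_, h1, h2, h3⟩
  · rintro (h | ⟨w, h1, h2, h3⟩)
    · exact .seed h
    · exact .step h1 h2 h3

lemma Reached.to_none {I : TreeInstance n} {coin : Fin n × Fin n → Bool}
    {away : Option (Fin n)} {u : Fin n} (h : I.Reached coin away u) : I.Reached coin none u := by
  rcases h with h | ⟨h1, h2, h3⟩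
  · exact .seed h
  · exact .step (I.mem_kids.2 ⟨(I.mem_kids.1 h1).1, by simp⟩) h2 h3

/-- If the live path to `u` came from `v`, then `v` was reached before; otherwise that path avoids
`v` and the edge to `v` extends it. In both cases a path without backtracking results. -/
lemma Reached.spread {I : TreeInstance n} {coin : Fin n × Fin n → Bool} {u v : Fin n}
    (h : I.Reached coin none u) (ha : I.graph.Adj u v) (hc : coin (u, v) = true) :
    I.Reached coin none v := by
  have hv : u ∈ I.kids none v := I.mem_kids.2 ⟨ha.symm, by simp⟩
  rcases h with h | ⟨h1, h2, h3⟩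
  · exact .step hv hc (.seed h)
  · rename_i w
    by_cases hwv : w = v
    · subst hwv
      exact h3.to_none
    · exact .step hv hc (.step (I.mem_kids.2 ⟨(I.mem_kids.1 h1).1, by simpa using Ne.symm hwv⟩)
        h2 h3)

lemma diffusion_succ (I : TreeInstance n) (coin : Fin n × Fin n → Bool) (t : ℕ) :
    (I.diffusion coin (t + 1)).1 = (I.diffusion coin t).1 ∪ (I.diffusion coin (t + 1)).2 := rfl

lemma mem_diffusion_succ (I : TreeInstance n) (coin : Fin n × Fin n → Bool) (t : ℕ) (v : Fin n) :
    v ∈ (I.diffusion coin (t + 1)).2 ↔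
      v ∉ (I.diffusion coin t).1 ∧ ∃ u ∈ (I.diffusion coin t).2, coin (u, v) = true := by
  simp [diffusion]

lemma diffusion_new_subset (I : TreeInstance n) (coin : Fin n × Fin n → Bool) (t : ℕ) :
    (I.diffusion coin t).2 ⊆ (I.diffusion coin t).1 := by
  cases t with
  | zero => exact subset_rfl
  | succ t => rw [diffusion_succ]; exact Finset.subset_union_right

lemma diffusion_seeds_subset (I : TreeInstance n) (coin : Fin n × Fin n → Bool) (t : ℕ) :
    I.seeds ⊆ (I.diffusion coin t).1 := by
  induction t with
  | zero => exact subset_rfl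
  | succ t ih => rw [diffusion_succ]; exact ih.trans Finset.subset_union_left

/-- An active node that is not new has already made all its attempts. -/
lemma diffusion_closed (I : TreeInstance n) (coin : Fin n × Fin n → Bool) (t : ℕ) :
    ∀ u ∈ (I.diffusion coin t).1, u ∉ (I.diffusion coin t).2 →
      ∀ v, coin (u, v) = true → v ∈ (I.diffusion coin t).1 := by
  induction t with
  | zero => exact fun u h1 h2 => absurd h1 h2
  | succ t ih =>
    intro u h1 h2 v hc
    rw [diffusion_succ, Finset.mem_union] at h1 ⊢
    have h1 := h1.resolve_right h2
    by_cases hv : v ∈ (I.diffusion coin t).1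
    · exact Or.inl hv
    · by_cases hu : u ∈ (I.diffusion coin t).2
      · exact Or.inr ((I.mem_diffusion_succ coin t v).2 ⟨hv, u, hu, hc⟩)
      · exact absurd (ih u h1 hu v hc) hv

/-- Every round in which the process is still alive adds a node. After `n` rounds this would give
more than `n` active nodes, so the process has stopped. -/
lemma diffusion_card (I : TreeInstance n) (coin : Fin n × Fin n → Bool) (t : ℕ) :
    (I.diffusion coin t).2 = ∅ ∨ t + 1 ≤ (I.diffusion coin t).1.card := by
  induction t with
  | zero =>
    rcases Finset.eq_empty_or_nonempty I.seeds with h | h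
    · exact Or.inl h
    · exact Or.inr (Finset.card_pos.2 h)
  | succ t ih =>
    by_cases h : (I.diffusion coin (t + 1)).2 = ∅
    · exact Or.inl h
    · right
      obtain ⟨v, hv⟩ := Finset.nonempty_iff_ne_empty.2 h
      obtain ⟨h1, u, hu, -⟩ := (I.mem_diffusion_succ coin t v).1 hv
      have ih := ih.resolve_left (Finset.nonempty_iff_ne_empty.1 ⟨u, hu⟩)
      have : (I.diffusion coin t).1.card < (I.diffusion coin (t + 1)).1.card := by
        apply Finset.card_lt_card
        rw [diffusion_succ]
        exact ⟨Finset.subset_union_left, fun hs => h1 (hs (Finset.mem_union_right _ hv))⟩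
      omega

lemma diffusion_final (I : TreeInstance n) (coin : Fin n × Fin n → Bool) :
    ∀ u ∈ (I.diffusion coin n).1, ∀ v, coin (u, v) = true → v ∈ (I.diffusion coin n).1 := by
  intro u hu
  refine I.diffusion_closed coin n u hu ?_
  have h : (I.diffusion coin n).2 = ∅ := (I.diffusion_card coin n).resolve_right (by
    have := Finset.card_le_univ (I.diffusion coin n).1
    rw [Fintype.card_fin] at this
    omega)
  simp [h]

/-- Each attempt is made at most once, so it may be decided in advance. Coins on pairs that are not
edges must fail because the process itself does not look at the graph; outcomes violating this have
weight zero. -/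
lemma mem_diffusion_iff (I : TreeInstance n) (coin : Fin n × Fin n → Bool)
    (hc : ∀ u v, coin (u, v) = true → I.graph.Adj u v) (u : Fin n) :
    u ∈ (I.diffusion coin n).1 ↔ I.Reached coin none u := by
  constructor
  · have : ∀ t, ∀ u ∈ (I.diffusion coin t).1, I.Reached coin none u := by
      intro t
      induction t with
      | zero => exact fun u hu => .seed hu
      | succ t ih =>
        intro u hu
        rw [diffusion_succ, Finset.mem_union] at hu
        rcases hu with hu | hu
        · exact ih u hu
        · obtain ⟨-, v, hv, hv'⟩ := (I.mem_diffusion_succ coin t u).1 hu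
          exact (ih v (I.diffusion_new_subset coin t hv)).spread (hc _ _ hv') hv'
    exact this n u
  · have : ∀ away u, I.Reached coin away u → u ∈ (I.diffusion coin n).1 := by
      intro away u h
      induction h with
      | seed h => exact I.diffusion_seeds_subset coin n h
      | step h1 h2 _ ih => exact I.diffusion_final coin _ ih _ h2
    exact this none u

open Classical in
/-- The indicator of `Reached`. -/
noncomputable def reachedInd (I : TreeInstance n) (away : Option (Fin n)) (u : Fin n)
    (coin : Fin n × Fin n → Bool) : ℝ :=
  if I.Reached coin away u then 1 else 0

/-- The recursion `ap_eq` for one fixed outcome. As a product of indicators its expectation can be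
taken factor by factor. -/
lemma reachedInd_eq (I : TreeInstance n) (away : Option (Fin n)) (u : Fin n)
    (coin : Fin n × Fin n → Bool) :
    I.reachedInd away u coin = if u ∈ I.seeds then 1 else
      1 - ((I.kids away u).map fun w =>
        1 - (if coin (w, u) then 1 else 0) * I.reachedInd (some u) w coin).prod := by
  by_cases hs : u ∈ I.seeds
  · simp [reachedInd, hs, Reached.seed hs]
  · rw [if_neg hs, reachedInd]
    by_cases h : I.Reached coin away u
    · rw [if_pos h]
      obtain ⟨w, h1, h2, h3⟩ := ((I.reached_iff coin away u).1 h).resolve_left hs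
      rw [List.prod_eq_zero, sub_zero]
      rw [List.mem_map]
      exact ⟨w, h1, by simp [h2, reachedInd, h3]⟩
    · rw [if_neg h, List.prod_eq_one, sub_self]
      intro x hx
      obtain ⟨w, h1, rfl⟩ := List.mem_map.1 hx
      by_cases h2 : coin (w, u) = true
      · have h3 : ¬ I.Reached coin (some u) w := fun h3 => h (.step h1 h2 h3)
        simp [reachedInd, h3]
      · simp [h2]

/-- Coins are attributed to the head of their edge. Then the coin of `(w, u)` belongs to `u` and
lies outside of all branches at `u`, and the branches use disjoint sets of coins. -/
lemma reachedInd_dependsOn (I : TreeInstance n) {away : Option (Fin n)} {u : Fin n}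
    (h : I.Borders away u) : DependsOn (I.reachedInd away u) {e | e.2 ∈ I.side away u} := by
  refine I.side_induction (P := fun _ away u =>
    DependsOn (I.reachedInd away u) {e | e.2 ∈ I.side away u}) ?_ n away u h (I.card_side_le away u)
  intro fuel away u h _ ih c d hcd
  rw [reachedInd_eq, reachedInd_eq]
  congr 2
  congr 1
  apply List.map_congr_left
  intro w hw
  rw [ih w hw fun e he => hcd e (I.side_subset h hw he), hcd (w, u) (I.self_mem_side h)]

lemma coinMean_reachedInd (I : TreeInstance n) (B : Finset (Fin n)) {away : Option (Fin n)}
    {u : Fin n} (h : I.Borders away u) :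
    coinMean (fun e : Fin n × Fin n => I.edgeProb B e.1 e.2) (I.reachedInd away u)
      = I.ap B away u := by
  refine I.side_induction (P := fun _ away u =>
    coinMean (fun e : Fin n × Fin n => I.edgeProb B e.1 e.2) (I.reachedInd away u)
      = I.ap B away u) ?_ n away u h (I.card_side_le away u)
  intro fuel away u h _ ih
  rw [I.ap_eq B h, funext (I.reachedInd_eq away u)]
  by_cases hs : u ∈ I.seeds
  · simp only [hs, if_true]
    exact coinMean_one _
  · simp only [hs, if_false]
    have hcoin : ∀ w : Fin n, DependsOn
        (fun coin : Fin n × Fin n → Bool => if coin (w, u) then (1 : ℝ) else 0) {(w, u)} := by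
      intro w c d hcd
      simp only
      rw [hcd (w, u) rfl]
    have hdis : ∀ w ∈ I.kids away u,
        Disjoint ({(w, u)} : Set (Fin n × Fin n)) {e | e.2 ∈ I.side (some u) w} := by
      intro w hw
      rw [Set.disjoint_singleton_left]
      exact I.not_mem_side_some u w
    rw [coinMean_sub, coinMean_one, coinMean_list_prod _ (I.kids away u)
      (F := fun w coin => 1 - (if coin (w, u) then 1 else 0) * I.reachedInd (some u) w coin)
      (D := fun w => {(w, u)} ∪ {e | e.2 ∈ I.side (some u) w})]
    · congr 2
      apply List.map_congr_left
      intro w hw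
      rw [coinMean_sub, coinMean_one, coinMean_mul _ (hcoin w)
        (I.reachedInd_dependsOn (I.borders_kid hw)) (hdis w hw), ih w hw, coinMean_coin, mul_comm]
    · intro w hw
      exact dependsOn_one_sub (dependsOn_mul (hcoin w) (I.reachedInd_dependsOn (I.borders_kid hw)))
    · refine List.Pairwise.imp_of_mem ?_ (I.kids_nodup away u)
      intro v w hv hw hvw
      rw [Set.disjoint_left]
      rintro ⟨x, y⟩ (h1 | h1) (h2 | h2)
      · simp only [Set.mem_singleton_iff, Prod.mk.injEq] at h1 h2
        exact hvw (h1.1.symm.trans h2.1)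
      · obtain ⟨rfl, rfl⟩ : x = v ∧ y = u := by simpa using h1
        exact I.not_mem_side_some _ _ h2
      · obtain ⟨rfl, rfl⟩ : x = w ∧ y = u := by simpa using h2
        exact I.not_mem_side_some _ _ h1
      · exact (Finset.disjoint_left.1
          (I.side_disjoint (I.mem_kids.1 hv).1 (I.mem_kids.1 hw).1 hvw)) h1 h2

lemma adj_of_coinWeight_ne_zero (I : TreeInstance n) {B : Finset (Fin n)}
    {coin : Fin n × Fin n → Bool} (h : I.coinWeight B coin ≠ 0) (u v : Fin n)
    (hc : coin (u, v) = true) : I.graph.Adj u v := by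
  by_contra ha
  apply h
  rw [coinWeight]
  refine Finset.prod_eq_zero (Finset.mem_univ (u, v)) ?_
  simp [hc, edgeProb, ha]

/-- The spread is the sum of the activation probabilities. -/
lemma spread_eq_sum_ap (I : TreeInstance n) (B : Finset (Fin n)) :
    I.spread B = ∑ v, I.ap B none v := by
  have h1 : ∀ coin : Fin n × Fin n → Bool,
      I.coinWeight B coin * ((I.diffusion coin n).1.card : ℝ)
        = ∑ v, I.coinWeight B coin * I.reachedInd none v coin := by
    intro coin
    by_cases h : I.coinWeight B coin = 0
    · simp [h]
    -- Outcomes of positive weight succeed only along edges, so the characterization by `Reached`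
    -- applies to them.
    · rw [← Finset.mul_sum]
      simp only [reachedInd, ← I.mem_diffusion_iff coin (I.adj_of_coinWeight_ne_zero h)]
      simp
  rw [spread, Finset.sum_congr rfl fun coin _ => h1 coin, Finset.sum_comm]
  exact Finset.sum_congr rfl fun v _ => I.coinMean_reachedInd B (I.borders_none v)

lemma boost_eq_sum (I : TreeInstance n) (B : Finset (Fin n)) :
    I.boost B = ∑ v, (I.ap B none v - I.ap ∅ none v) := by
  rw [boost, spread_eq_sum_ap, spread_eq_sum_ap, Finset.sum_sub_distrib]

lemma boost_mono (I : TreeInstance n) {B B' : Finset (Fin n)} (h : B ⊆ B') :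
    I.boost B ≤ I.boost B' := by
  rw [boost_eq_sum, boost_eq_sum]
  exact Finset.sum_le_sum fun v _ => sub_le_sub_right (I.ap_mono h (I.borders_none v)) _

lemma boost_congr (I : TreeInstance n) {B B' : Finset (Fin n)}
    (h : ∀ x, x ∉ I.seeds → (x ∈ B ↔ x ∈ B')) : I.boost B = I.boost B' := by
  rw [boost_eq_sum, boost_eq_sum]
  exact Finset.sum_congr rfl fun v _ => by
    rw [I.ap_congr (I.borders_none v) fun x _ => h x]

end TreeInstance

end Boosting

namespace Boosting

open Prog

namespace Prog

variable {β : Type}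

/-! ### Loops that fill an array or raise a counter -/

lemma loop_write {ι α : Type} [DecidableEq ι] (l : List ι) (T : ι → α)
    (body : (ι → α) → ι → Prog (ι → α)) (h : ι → α)
    (hb : ∀ T i, (body T i).val = Function.update T i (h i)) {i : ι} (hi : i ∈ l) :
    (loop l T body).val i = h i := by
  refine loop_reach (P := fun T => T i = h i) l T body hi ?_ ?_
  · intro T hT j _
    rw [hb]
    by_cases hij : i = j
    · subst hij; simp
    · simpa [hij] using hT
  · intro T
    simp [hb]

lemma loop_measure_le {α : Type} (f : β → ℕ) (l : List α) (s : β) (body : β → α → Prog β)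
    (h : ∀ s a, f (body s a).val ≤ f s + 1) : f (loop l s body).val ≤ f s + l.length := by
  induction l generalizing s with
  | nil => simp [loop]
  | cons a l ih =>
    have h1 := h s a
    have h2 := ih (body s a).val
    simp only [loop, val_bind, val_call, List.length_cons]
    omega

end Prog

namespace TreeInstance

variable {n : ℕ}

/-! ### The greedy lower bound -/

lemma computeSpread_val (I : TreeInstance n) (B : Finset (Fin n)) :
    (I.computeSpread fun v => decide (v ∈ B)).val = I.spread B := by
  rw [computeSpread, loop_skip_add (skip := fun _ => false) (g := fun v => I.ap B none v)]
  · simp [spread_eq_sum_ap, Fin.sum_univ_def]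
  · intro q w
    simp [ap]

lemma computeSpread_time_le (I : TreeInstance n) (hI : ∀ v, (I.children v).card ≤ 2)
    (B : Fin n → Bool) : (I.computeSpread B).time ≤ n * (30 * n + 3) := by
  have := loop_time_le (List.finRange n) (0 : ℝ) (fun s v => do
    let a ← call (I.activation B n none v)
    reg s + reg a) (30 * n + 2) (by
      intro s v _
      have := I.activation_time_le hI B n (I.borders_none v) (I.card_side_le none v)
      simp at this ⊢
      omega)
  rw [List.length_finRange] at this
  rw [computeSpread]
  simpa [loop] using this

lemma card_filter_update (B : Fin n → Bool) (u : Fin n) :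
    (Finset.univ.filter fun v => Function.update B u true v = true).card
      ≤ (Finset.univ.filter fun v => B v = true).card + 1 := by
  refine (Finset.card_le_card ?_).trans (Finset.card_insert_le u _)
  intro v hv
  by_cases h : v = u
  · simp [h]
  · simpa [h] using hv

lemma greedyBoost_val (I : TreeInstance n) (k : ℕ) :
    ∃ B : Finset (Fin n), B.card ≤ k ∧ (I.greedyBoost k).val = fun v => decide (v ∈ B) := by
  refine ⟨Finset.univ.filter fun v => (I.greedyBoost k).val v = true, ?_, by simp⟩
  rw [greedyBoost]
  refine (loop_measure_le (fun B : Fin n → Bool => (Finset.univ.filter fun v => B v = true).card)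
    (List.range k) _ _ ?_).trans (by simp)
  intro B _
  rw [val_bind]
  split
  · simp
  · exact card_filter_update B _

lemma greedyBoost_time_le (I : TreeInstance n) (hI : ∀ v, (I.children v).card ≤ 2) (k : ℕ) :
    (I.greedyBoost k).time ≤ n + k * (n * (n * (30 * n + 3) + 7) + 2) := by
  rw [greedyBoost, time_bind, time_alloc, val_alloc]
  refine Nat.add_le_add_left (loopN_time_le k _ _ _ ?_) _
  intro B _ _
  rw [time_bind]
  refine Nat.add_le_add ?_ (b := n * (n * (30 * n + 3) + 7)) (d := 1) ?_
  · have := loop_time_le (List.finRange n) (none : Option (ℝ × Fin n)) (fun best u => do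
      let old ← read B u
      if old then pure best else
        let B' ← write B u true
        let s ← call (I.computeSpread B')
        let _ ← write B' u false
        match best with
        | none => step (some (s, u))
        | some (s₀, _) =>
          let b ← less s₀ s
          if b then step (some (s, u)) else pure best) (n * (30 * n + 3) + 6) (by
        intro best u _
        have := I.computeSpread_time_le hI (Function.update B u true)
        rcases best with _ | ⟨s₀, w⟩
        · by_cases hB : B u = true <;> simp [hB]
          omega
        · by_cases hB : B u = true <;> simp [hB]
          split_ifs <;> simp <;> omega)
    rwa [List.length_finRange] at this
  · split <;> simp

/-- All that matters is that the bound is the boost of some feasible set and hence at most the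
optimum; how good the greedy choice is plays no role. -/
lemma greedyLowerBound_val (I : TreeInstance n) (k : ℕ) :
    ∃ B : Finset (Fin n), B.card ≤ k ∧ (I.greedyLowerBound k).val = I.boost B := by
  obtain ⟨B, hB, h⟩ := I.greedyBoost_val k
  refine ⟨B, hB, ?_⟩
  have h0 : (fun _ : Fin n => false) = fun v => decide (v ∈ (∅ : Finset (Fin n))) := by simp
  simp only [greedyLowerBound, val_bind, val_call, val_alloc, h, val_sub, val_reg, boost]
  rw [h0, computeSpread_val, computeSpread_val]

lemma greedyLowerBound_time_le (I : TreeInstance n) (hI : ∀ v, (I.children v).card ≤ 2) (k : ℕ) :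
    (I.greedyLowerBound k).time
      ≤ 2 * n + k * (n * (n * (30 * n + 3) + 7) + 2) + 2 * (n * (30 * n + 3)) + 4 := by
  have h1 := I.greedyBoost_time_le hI k
  have h2 := I.computeSpread_time_le hI (I.greedyBoost k).val
  have h3 := I.computeSpread_time_le hI (fun _ => false)
  simp [greedyLowerBound]
  omega

/-! ### The rounding parameter -/

lemma pathProb_le_maxPathProb (I : TreeInstance n) {k : ℕ} {B : Finset (Fin n)}
    (h : B.card ≤ k) (x v : Fin n) : I.pathProb B x v ≤ I.maxPathProb k x v :=
  Finset.le_sup' (fun B => I.pathProb B x v) (by simpa using h)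

lemma exists_maxPathProb (I : TreeInstance n) (k : ℕ) (x v : Fin n) :
    ∃ B : Finset (Fin n), B.card ≤ k ∧ I.maxPathProb k x v = I.pathProb B x v := by
  obtain ⟨B, hB, h⟩ := Finset.exists_mem_eq_sup'
    (s := Finset.univ.filter fun B : Finset (Fin n) => B.card ≤ k) ⟨∅, by simp⟩
    (fun B => I.pathProb B x v)
  exact ⟨B, by simpa using hB, h⟩

lemma maxPathProb_self (I : TreeInstance n) (k : ℕ) (x : Fin n) : I.maxPathProb k x x = 1 := by
  obtain ⟨B, -, h⟩ := I.exists_maxPathProb k x x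
  rw [h, pathProb_self]

lemma maxPathProb_nonneg (I : TreeInstance n) (k : ℕ) (x v : Fin n) :
    0 ≤ I.maxPathProb k x v := by
  obtain ⟨B, -, h⟩ := I.exists_maxPathProb k x v
  rw [h]
  exact I.pathProb_nonneg B x v

lemma maxPathProb_le_one (I : TreeInstance n) (k : ℕ) (x v : Fin n) :
    I.maxPathProb k x v ≤ 1 := by
  obtain ⟨B, -, h⟩ := I.exists_maxPathProb k x v
  rw [h]
  exact I.pathProb_le_one B x v

lemma pathProb_congr (I : TreeInstance n) {B B' : Finset (Fin n)} {x v : Fin n}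
    (h : ∀ u ∈ (I.path x v).support, u ∈ B ↔ u ∈ B') : I.pathProb B x v = I.pathProb B' x v := by
  unfold pathProb
  congr 1
  apply List.map_congr_left
  intro e he
  rw [I.edgeProb_of_adj B e.adj, I.edgeProb_of_adj B' e.adj]
  simp only [h _ (SimpleGraph.Walk.dart_snd_mem_support_of_mem_darts _ he)]

lemma maxPathProb_zero (I : TreeInstance n) {x v w : Fin n} (h : I.Toward x (some v) w) :
    I.maxPathProb 0 x w = I.maxPathProb 0 x v * I.prob v w := by
  obtain ⟨B, hB, h1⟩ := I.exists_maxPathProb 0 x w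
  obtain ⟨B', hB', h2⟩ := I.exists_maxPathProb 0 x v
  rw [Nat.le_zero, Finset.card_eq_zero] at hB hB'
  subst hB hB'
  rw [h1, h2, I.pathProb_concat ∅ h.1 h.2, I.edgeProb_of_adj ∅ h.1]
  simp

/-- The last node `w` is not on the path from `x` to `v`. Whether `w` is boosted therefore affects
only the last factor, at the price of one unit of the budget for the rest of the path. -/
lemma maxPathProb_succ (I : TreeInstance n) {x v w : Fin n} (h : I.Toward x (some v) w) (j : ℕ) :
    I.maxPathProb (j + 1) x w = max (I.maxPathProb (j + 1) x v * I.prob v w)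
      (I.maxPathProb j x v * I.probBoost v w) := by
  have hp := I.prob_nonneg v w h.1
  have hp' := hp.trans (I.prob_le_probBoost v w h.1)
  have herase : ∀ B : Finset (Fin n), I.pathProb (B.erase w) x v = I.pathProb B x v := by
    intro B
    refine I.pathProb_congr fun u hu => ?_
    have : u ≠ w := fun hw => h.2 (hw ▸ hu)
    simp [this]
  have hinsert : ∀ B : Finset (Fin n), I.pathProb (insert w B) x v = I.pathProb B x v := by
    intro B
    refine I.pathProb_congr fun u hu => ?_
    have : u ≠ w := fun hw => h.2 (hw ▸ hu)
    simp [this]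
  apply le_antisymm
  · obtain ⟨B, hB, h1⟩ := I.exists_maxPathProb (j + 1) x w
    rw [h1, I.pathProb_concat B h.1 h.2, I.edgeProb_of_adj B h.1]
    by_cases hw : w ∈ B
    · rw [if_pos hw, ← herase]
      refine le_max_of_le_right (mul_le_mul_of_nonneg_right (I.pathProb_le_maxPathProb ?_ x v) hp')
      rw [Finset.card_erase_of_mem hw]
      omega
    · rw [if_neg hw]
      exact le_max_of_le_left
        (mul_le_mul_of_nonneg_right (I.pathProb_le_maxPathProb hB x v) hp)
  · apply max_le
    · obtain ⟨B, hB, h1⟩ := I.exists_maxPathProb (j + 1) x v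
      refine le_trans (le_of_eq ?_) (I.pathProb_le_maxPathProb (B := B.erase w)
        ((Finset.card_erase_le).trans hB) x w)
      rw [h1, I.pathProb_concat _ h.1 h.2, I.edgeProb_of_adj _ h.1, herase]
      simp
    · obtain ⟨B, hB, h1⟩ := I.exists_maxPathProb j x v
      refine le_trans (le_of_eq ?_) (I.pathProb_le_maxPathProb (B := insert w B)
        ((Finset.card_insert_le w B).trans (by omega)) x w)
      rw [h1, I.pathProb_concat _ h.1 h.2, I.edgeProb_of_adj _ h.1, hinsert]
      simp

/-- The array `j ↦ max (P j · p, P (j - 1) · p')` of `sumFrom`. -/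
noncomputable def extendProbs (k : ℕ) (P : ℕ → ℝ) (p p' : ℝ) : Prog (ℕ → ℝ) := do
  let Q₀ ← alloc (k + 1) (0 : ℝ)
  loopN (k + 1) Q₀ fun Q j => do
    let a ← read P j
    let isZero ← step (decide (j = 0))
    if isZero then
      let q ← reg a * reg p
      write Q j q
    else
      let a' ← read P (j - 1)
      let q ← max (reg a * reg p) (reg a' * reg p')
      write Q j q

lemma extendProbs_time_le (k : ℕ) (P : ℕ → ℝ) (p p' : ℝ) :
    (extendProbs k P p p').time ≤ 9 * (k + 1) := by
  rw [extendProbs, time_bind, time_alloc]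
  have := loopN_time_le (k + 1) (fun _ : ℕ => (0 : ℝ)) (fun Q j => do
    let a ← read P j
    let isZero ← step (decide (j = 0))
    if isZero then
      let q ← reg a * reg p
      write Q j q
    else
      let a' ← read P (j - 1)
      let q ← max (reg a * reg p) (reg a' * reg p')
      write Q j q) 7 (by
        intro Q j _
        by_cases hj : j = 0 <;> simp [hj])
  simp only [val_alloc]
  omega

lemma extendProbs_val (I : TreeInstance n) (k : ℕ) (P : ℕ → ℝ) {x v w : Fin n}
    (h : I.Toward x (some v) w) (hP : ∀ j ≤ k, P j = I.maxPathProb j x v) (j : ℕ) (hj : j ≤ k) :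
    (extendProbs k P (I.prob v w) (I.probBoost v w)).val j = I.maxPathProb j x w := by
  rw [extendProbs, val_bind, loopN, loop_write (h := fun j => if j = 0 then P j * I.prob v w else
    max (P j * I.prob v w) (P (j - 1) * I.probBoost v w)) _ _ _ _ (List.mem_range.2 (by omega))]
  · cases j with
    | zero => simp [hP, I.maxPathProb_zero h]
    | succ j =>
      simp [hP _ hj, hP j (by omega), I.maxPathProb_succ h]
  · intro T i
    by_cases hi : i = 0 <;> simp [hi]

/-- Naming the inner loop `extendProbs` reassociates the binds. This leaves values unchanged, but
times agree only up to associativity of addition, so both components are compared. -/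
lemma sumFrom_succ (I : TreeInstance n) (k fuel : ℕ) (away : Option (Fin n)) (v : Fin n)
    (P : ℕ → ℝ) : I.sumFrom k (fuel + 1) away v P = (do
      let s₀ ← read P k
      loop (I.nbrs v) s₀ fun s w => do
        let skip ← step (decide (away = some w))
        if skip then pure s else
          let p ← I.readProb false v w
          let p' ← I.readProb true v w
          let Q ← extendProbs k P p p'
          let t ← call (I.sumFrom k fuel (some v) w Q)
          reg s + reg t) := by
  rw [sumFrom]
  congr 1
  funext s₀
  congr 1
  funext s w
  congr 1
  funext skip
  cases skip
  · simp only [Bool.false_eq_true, if_false]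
    congr 1
    funext p
    congr 1
    funext p'
    simp only [extendProbs]
    change Prog.mk _ _ = Prog.mk _ _
    simp only [time_bind, val_bind]
    simp only [Nat.add_assoc]
  · rfl

/-- The array `P` has to be correct for all budgets up to `k`, although only the entry at `k` is
summed: the entries for smaller budgets are needed further down. -/
lemma sumFrom_val (I : TreeInstance n) (k fuel : ℕ) {x : Fin n} {away : Option (Fin n)}
    {v : Fin n} (h : I.Toward x away v) (hf : (I.side away v).card ≤ fuel) (P : ℕ → ℝ)
    (hP : ∀ j ≤ k, P j = I.maxPathProb j x v) :
    (I.sumFrom k fuel away v P).val = ∑ y ∈ I.side away v, I.maxPathProb k x y := by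
  refine I.side_induction (P := fun fuel away v => ∀ P : ℕ → ℝ, I.Toward x away v →
    (∀ j ≤ k, P j = I.maxPathProb j x v) →
    (I.sumFrom k fuel away v P).val = ∑ y ∈ I.side away v, I.maxPathProb k x y) ?_
    fuel away v h.borders hf P h hP
  intro fuel away v hb _ ih P h hP
  rw [sumFrom_succ, val_bind, val_read, loop_skip_add (skip := fun w => decide (away = some w))
    (g := fun w => (I.sumFrom k fuel (some v) w
      (extendProbs k P (I.prob v w) (I.probBoost v w)).val).val), I.sum_side hb, hP k le_rfl]
  · congr 2
    apply List.map_congr_left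
    intro w hw
    exact ih w hw _ (h.kid hw) (I.extendProbs_val k P (h.kid hw) hP)
  · intro q w
    by_cases hs : away = some w <;> simp [hs]

lemma sumFrom_time_le (I : TreeInstance n) (hI : ∀ v, (I.children v).card ≤ 2) (k fuel : ℕ)
    {away : Option (Fin n)} {v : Fin n} (h : I.Borders away v)
    (hf : (I.side away v).card ≤ fuel) (P : ℕ → ℝ) :
    (I.sumFrom k fuel away v P).time ≤ 50 * (k + 1) * (I.side away v).card := by
  refine I.side_induction (P := fun fuel away v => ∀ P : ℕ → ℝ,
    (I.sumFrom k fuel away v P).time ≤ 50 * (k + 1) * (I.side away v).card) ?_ fuel away v h hf P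
  intro fuel away v h _ ih P
  have hl := loop_time_le_skip (I.nbrs v) (P k) (fun s w => do
        let skip ← step (decide (away = some w))
        if skip then pure s else
          let p ← I.readProb false v w
          let p' ← I.readProb true v w
          let Q ← extendProbs k P p p'
          let t ← call (I.sumFrom k fuel (some v) w Q)
          reg s + reg t) (fun w => decide (away = some w)) (9 * (k + 1) + 5)
        (fun w => if w ∈ I.kids away v then 50 * (k + 1) * (I.side (some v) w).card else 0) (by
      intro s w hw
      by_cases hs : away = some w
      · simp [hs]
      · have hk : w ∈ I.kids away v := I.mem_kids.2 ⟨(I.mem_nbrs v w).1 hw, hs⟩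
        have h1 := ih w hk (extendProbs k P (I.prob v w) (I.probBoost v w)).val
        have h2 := extendProbs_time_le k P (I.prob v w) (I.probBoost v w)
        simp [hs, hk]
        omega)
  have hd := I.length_nbrs_le hI v
  have hsum : ((I.kids away v).map fun w =>
      if w ∈ I.kids away v then 50 * (k + 1) * (I.side (some v) w).card else 0).sum
      = 50 * (k + 1) * ((I.kids away v).map fun w => (I.side (some v) w).card).sum := by
    rw [← List.sum_map_mul_left]
    congr 1
    apply List.map_congr_left
    intro w hw
    simp [hw]
  change _ ≤ _ + ((I.kids away v).map fun w =>
      if w ∈ I.kids away v then 50 * (k + 1) * (I.side (some v) w).card else 0).sum at hl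
  rw [hsum] at hl
  rw [I.card_side h, sumFrom_succ, time_bind, time_read, val_read, mul_add]
  have := Nat.mul_le_mul_right (9 * (k + 1) + 5 + 1) hd
  omega

/-- `∑_v ∑_x p^{(k)}(x ⇝ v)`. -/
noncomputable def totalPathProb (I : TreeInstance n) (k : ℕ) : ℝ :=
  ∑ v, ∑ x, I.maxPathProb k x v

lemma roundingParameter_val (I : TreeInstance n) (k : ℕ) (ε LB : ℝ) :
    (I.roundingParameter k ε LB).val = ε * max LB 1 / I.totalPathProb k := by
  rw [roundingParameter, val_bind, loop_skip_add (skip := fun _ => false)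
    (g := fun x => ∑ y, I.maxPathProb k x y)]
  · have : ((List.finRange n).map fun x => ∑ y, I.maxPathProb k x y).sum = I.totalPathProb k := by
      -- The searches sum over the ends for each source, while `totalPathProb` sums over the sources
      -- for each end.
      rw [← Fin.sum_univ_def, totalPathProb, Finset.sum_comm]
    simp [this]
  · intro q x
    simp only [val_bind, val_alloc, val_call, val_add, val_reg, Bool.false_eq_true, if_false]
    rw [I.sumFrom_val k n (x := x) (away := none) rfl (I.card_side_le none x) _
      (fun j _ => (I.maxPathProb_self j x).symm)]
    simp

lemma roundingParameter_time_le (I : TreeInstance n) (hI : ∀ v, (I.children v).card ≤ 2) (k : ℕ)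
    (ε LB : ℝ) :
    (I.roundingParameter k ε LB).time ≤ n * (50 * (k + 1) * n + (k + 1) + 3) + 3 := by
  rw [roundingParameter, time_bind]
  have := loop_time_le (List.finRange n) (0 : Prog ℝ).val (fun s x => do
    let P ← alloc (k + 1) (1 : ℝ)
    let t ← call (I.sumFrom k n none x P)
    reg s + reg t) (50 * (k + 1) * n + (k + 1) + 2) (by
      intro s x _
      have := I.sumFrom_time_le hI k n (I.borders_none x) (I.card_side_le none x) (fun _ => 1)
      simp at this ⊢
      omega)
  rw [List.length_finRange] at this
  simp at this ⊢
  exact this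

lemma card_pos (I : TreeInstance n) : 0 < n := Fin.pos I.root

lemma one_le_totalPathProb (I : TreeInstance n) (k : ℕ) : 1 ≤ I.totalPathProb k := by
  rw [totalPathProb, ← I.maxPathProb_self k I.root]
  refine le_trans ?_ (Finset.single_le_sum (f := fun v => ∑ x, I.maxPathProb k x v)
    (fun v _ => Finset.sum_nonneg fun x _ => I.maxPathProb_nonneg k x v) (Finset.mem_univ I.root))
  exact Finset.single_le_sum (f := fun x => I.maxPathProb k x I.root)
    (fun x _ => I.maxPathProb_nonneg k x I.root) (Finset.mem_univ I.root)

lemma totalPathProb_le (I : TreeInstance n) (k : ℕ) : I.totalPathProb k ≤ (n : ℝ) ^ 2 := by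
  have : I.totalPathProb k ≤ ∑ _v : Fin n, ∑ _x : Fin n, (1 : ℝ) :=
    Finset.sum_le_sum fun v _ => Finset.sum_le_sum fun x _ => I.maxPathProb_le_one k x v
  simpa [sq] using this

end TreeInstance

end Boosting

namespace Boosting

open Prog

/-! ### Running time of the dynamic program -/

/-- Counting the call of the iteration within `c` keeps nested bounds products. Without iterations
`c` may be `0`, hence the case distinction. -/
lemma Prog.loopN_time_le_mul {β : Type} (m : ℕ) (s : β) (body : β → ℕ → Prog β) (c : ℕ)
    (h : ∀ s, ∀ i < m, (body s i).time + 1 ≤ c) : (loopN m s body).time ≤ m * c := by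
  rcases Nat.eq_zero_or_pos m with rfl | hm
  · simp [loopN, loop]
  · have h0 := h s 0 hm
    obtain ⟨c, rfl⟩ : ∃ d, c = d + 1 := ⟨c - 1, by omega⟩
    exact loopN_time_le m s body c fun s i hi => by have := h s i hi; omega

namespace NodeSet

variable {n : ℕ}

/-- The nodes of a stored node set. -/
def support : NodeSet n → Finset (Fin n)
  | .empty => ∅
  | .single v => {v}
  | .union s t => s.support ∪ t.support

/-- The number of cells of a stored node set. -/
def size : NodeSet n → ℕ
  | .empty => 1
  | .single _ => 1
  | .union s t => s.size + t.size + 1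

/-- Writing out costs time proportional to the number of unfolded cells, which a priori has no
relation to the number of nodes; it is controlled by `SoundEntry.size_le`. -/
lemma flatten_time_le (s : NodeSet n) (acc : List (Fin n)) :
    (s.flatten acc).time ≤ 3 * s.size := by
  induction s generalizing acc with
  | empty => simp [flatten, size]
  | single v => simp [flatten, size]
  | union s t ihs iht =>
    have h1 := iht acc
    have h2 := ihs (t.flatten acc).val
    simp only [flatten, size, time_bind, time_call, val_call]
    omega

lemma flatten_val (s : NodeSet n) (acc : List (Fin n)) :
    (s.flatten acc).val.toFinset = s.support ∪ acc.toFinset := by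
  induction s generalizing acc with
  | empty => simp [flatten, support]
  | single v => ext; simp [flatten, support]
  | union s t ihs iht => simp [flatten, support, ihs, iht, Finset.union_assoc]

end NodeSet

variable {n : ℕ}

lemma Entry.best_time_le (e₁ e₂ : Entry n) : (Entry.best e₁ e₂).time ≤ 2 := by
  rcases e₁ with _ | ⟨x, s⟩
  · simp [Entry.best]
  · rcases e₂ with _ | ⟨y, t⟩
    · simp [Entry.best]
    · simp [Entry.best]

lemma Entry.add_time_le (e₁ e₂ : Entry n) : (Entry.add e₁ e₂).time ≤ 2 := by
  rcases e₁ with _ | ⟨x, s⟩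
  · simp [Entry.add]
  · rcases e₂ with _ | ⟨y, t⟩
    · simp [Entry.add]
    · simp [Entry.add]

lemma Table.improve_time_le (T : Table n) (i : ℕ × ℕ × ℕ) (e : Entry n) :
    (T.improve i e).time ≤ 4 := by
  have := Entry.best_time_le (T i) e
  simp [Table.improve]
  omega

lemma roundedValue_time_le (δ : ℝ) (M j : ℕ) : (roundedValue δ M j).time ≤ 2 := by
  by_cases h : j < M <;> simp [roundedValue, h]

lemma roundDown_time_le (δ : ℝ) (M : ℕ) (x : ℝ) : (roundDown δ M x).time ≤ 3 := by
  by_cases h : x < 1 <;> simp [roundDown, h]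

namespace TreeInstance

@[simp] lemma time_gain (c f p a₀ : ℝ) : (gain c f p a₀).time = 7 := by
  simp [gain]

@[simp] lemma time_newTable (n k M : ℕ) :
    (newTable n k M).time = (k + 1) * (M + 1) * (M + 1) := rfl

lemma newTable_time_le (n k M : ℕ) :
    (newTable n k M).time ≤ (k + 1) ^ 2 * (M + 1) ^ 3 := by
  rw [time_newTable]
  have : (k + 1) ^ 2 * (M + 1) ^ 3 = (k + 1) * (M + 1) * (M + 1) * ((k + 1) * (M + 1)) := by ring
  rw [this]
  exact Nat.le_mul_of_pos_right _ (by positivity)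

lemma leafTable_time_le (I : TreeInstance n) (ap₀ : Fin n → ℝ) (k : ℕ) (δ : ℝ) (M : ℕ)
    (parent : Option (Fin n)) (v : Fin n) :
    (I.leafTable ap₀ k δ M parent v).time ≤ 25 * ((k + 1) ^ 2 * (M + 1) ^ 3) := by
  have h0 := newTable_time_le n k M
  have h1 := fun j => roundedValue_time_le δ M j
  have hl : ∀ (T : Table n) (ci : ℕ) (c : ℝ), (loopN (k + 1) T fun T κ => do
    let b ← step (decide (0 < κ))
    let p ← I.readParentProb b parent v
    loopN (M + 1) T fun T fi => do
      let f ← roundedValue δ M fi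
      let g ← gain c f p (ap₀ v)
      T.improve (κ, ci, fi) (some (g, boostNode b v))).time ≤ (k + 1) * ((M + 1) * 17) := by
    intro T ci c
    refine loopN_time_le_mul _ _ _ _ fun T κ _ => ?_
    simp only [time_bind, time_step, time_readParentProb, val_step]
    refine (Nat.add_le_add_right (Nat.add_le_add_left (Nat.add_le_add_left
      (loopN_time_le_mul (M + 1) _ _ 14 fun T fi _ => ?_) _) _) _).trans
        (by omega : 1 + (1 + (M + 1) * 14) + 1 ≤ (M + 1) * 17)
    simp only [time_bind, time_gain]
    have h2 := h1 fi
    have h3 := Table.improve_time_le T (κ, ci, fi) (some ((gain c (roundedValue δ M fi).val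
      (I.readParentProb (decide (0 < κ)) parent v).val (ap₀ v)).val, boostNode (decide (0 < κ)) v))
    omega
  have h2 : (k + 1) * ((M + 1) * 17) ≤ 17 * ((k + 1) ^ 2 * (M + 1) ^ 3) := by
    have : 17 * ((k + 1) ^ 2 * (M + 1) ^ 3)
      = (k + 1) * ((M + 1) * 17) * ((k + 1) * (M + 1) ^ 2) := by ring
    rw [this]
    exact Nat.le_mul_of_pos_right _ (by positivity)
  have h3 : 0 < (k + 1) ^ 2 * (M + 1) ^ 3 := by positivity
  have h4 := hl (newTable n k M).val (if v ∈ I.seeds then M else 0)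
    (roundedValue δ M (if v ∈ I.seeds then M else 0)).val
  have h5 := h1 (if v ∈ I.seeds then M else 0)
  rw [leafTable]
  simp only [time_bind, time_readSeed, time_read, time_step, val_step, val_readSeed, val_read,
    decide_eq_true_eq]
  omega

lemma bestBelowSeed_time_le (k M : ℕ) (T : Table n) :
    (bestBelowSeed k M T).time ≤ 10 * ((k + 1) ^ 2 * (M + 1) ^ 3) := by
  have hl : ∀ h : ℕ → Entry n, (loopN (k + 1) h fun h κ =>
    loopN (M + 1) h fun h ci => do
      let e ← read T (κ, ci, M)
      let old ← read h κ
      let new ← Entry.best old e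
      write h κ new).time ≤ (k + 1) * ((M + 1) * 8) := by
    intro h
    refine loopN_time_le_mul _ _ _ _ fun h κ _ => ?_
    refine (Nat.add_le_add_right (loopN_time_le_mul (M + 1) _ _ 6 fun h ci _ => ?_) _).trans
        (by omega : (M + 1) * 6 + 1 ≤ (M + 1) * 8)
    have := Entry.best_time_le (h κ) (T (κ, ci, M))
    simp only [time_bind, time_read, val_read, time_write]
    omega
  have h1 := hl fun _ => none
  have h2 : (k + 1) * ((M + 1) * 8) + (k + 1) ≤ 10 * ((k + 1) ^ 2 * (M + 1) ^ 3) := by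
    have e : 10 * ((k + 1) ^ 2 * (M + 1) ^ 3)
      = (k + 1) * ((M + 1) * 10) * ((k + 1) * (M + 1) ^ 2) := by ring
    rw [e]
    refine le_trans ?_ (Nat.le_mul_of_pos_right _ (by positivity))
    rw [← Nat.mul_succ]
    exact Nat.mul_le_mul_left _ (by omega)
  rw [bestBelowSeed]
  simp only [time_bind, time_alloc, val_alloc]
  omega

lemma seedTable_time_le (k M : ℕ) (h : ℕ → Entry n) :
    (seedTable k M h).time ≤ 9 * ((k + 1) ^ 2 * (M + 1) ^ 3) := by
  have h0 := newTable_time_le n k M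
  have hl : ∀ T : Table n, (loopN (k + 1) T fun T κ =>
    loopN (M + 1) T fun T fi => do
      let e ← read h κ
      T.improve (κ, M, fi) e).time ≤ (k + 1) * ((M + 1) * 8) := by
    intro T
    refine loopN_time_le_mul _ _ _ _ fun T κ _ => ?_
    refine (Nat.add_le_add_right (loopN_time_le_mul (M + 1) _ _ 6 fun T fi _ => ?_) _).trans
        (by omega : (M + 1) * 6 + 1 ≤ (M + 1) * 8)
    have := Table.improve_time_le T (κ, M, fi) (h κ)
    simp only [time_bind, time_read, val_read]
    omega
  have h1 := hl (newTable n k M).val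
  have h2 : (k + 1) * ((M + 1) * 8) ≤ 8 * ((k + 1) ^ 2 * (M + 1) ^ 3) := by
    have e : 8 * ((k + 1) ^ 2 * (M + 1) ^ 3)
      = (k + 1) * ((M + 1) * 8) * ((k + 1) * (M + 1) ^ 2) := by ring
    rw [e]
    exact Nat.le_mul_of_pos_right _ (by positivity)
  rw [seedTable, time_bind]
  omega

lemma seedTableOne_time_le (k M : ℕ) (T₁ : Table n) :
    (seedTableOne k M T₁).time ≤ 20 * ((k + 1) ^ 2 * (M + 1) ^ 3) := by
  have h1 := bestBelowSeed_time_le k M T₁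
  have h2 := seedTable_time_le k M (bestBelowSeed k M T₁).val
  have h3 : 0 < (k + 1) ^ 2 * (M + 1) ^ 3 := by positivity
  simp only [seedTableOne, time_bind, time_call, val_call]
  omega

/-- The maxima over `κ = κ₁ + κ₂` of `seedTableTwo`. -/
noncomputable def combineBelowSeed (k : ℕ) (h₁ h₂ : ℕ → Entry n) : Prog (ℕ → Entry n) := do
  let h₀ ← alloc (k + 1) (none : Entry n)
  loopN (k + 1) h₀ fun h κ₁ =>
    loopN (k + 1) h fun h κ₂ => do
      let fits ← step (decide (κ₁ + κ₂ ≤ k))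
      if fits then
        let e₁ ← read h₁ κ₁
        let e₂ ← read h₂ κ₂
        let e ← Entry.add e₁ e₂
        let old ← read h (κ₁ + κ₂)
        let new ← Entry.best old e
        write h (κ₁ + κ₂) new
      else pure h

lemma combineBelowSeed_time_le (k : ℕ) (h₁ h₂ : ℕ → Entry n) :
    (combineBelowSeed k h₁ h₂).time ≤ 13 * (k + 1) ^ 2 := by
  have hl : ∀ h : ℕ → Entry n, (loopN (k + 1) h fun h κ₁ =>
    loopN (k + 1) h fun h κ₂ => do
      let fits ← step (decide (κ₁ + κ₂ ≤ k))
      if fits then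
        let e₁ ← read h₁ κ₁
        let e₂ ← read h₂ κ₂
        let e ← Entry.add e₁ e₂
        let old ← read h (κ₁ + κ₂)
        let new ← Entry.best old e
        write h (κ₁ + κ₂) new
      else pure h).time ≤ (k + 1) * ((k + 1) * 12) := by
    intro h
    refine loopN_time_le_mul _ _ _ _ fun h κ₁ _ => ?_
    refine (Nat.add_le_add_right (loopN_time_le_mul (k + 1) _ _ 10 fun h κ₂ _ => ?_) _).trans
        (by omega : (k + 1) * 10 + 1 ≤ (k + 1) * 12)
    have a1 := Entry.add_time_le (h₁ κ₁) (h₂ κ₂)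
    have a2 := Entry.best_time_le (h (κ₁ + κ₂)) (Entry.add (h₁ κ₁) (h₂ κ₂)).val
    by_cases hk : κ₁ + κ₂ ≤ k
    · simp [hk]
      omega
    · simp [hk]
  have h1 := hl fun _ => none
  have h2 : (k + 1) * ((k + 1) * 12) + (k + 1) ≤ 13 * (k + 1) ^ 2 := by nlinarith
  rw [combineBelowSeed]
  simp only [time_bind, time_alloc, val_alloc]
  omega

lemma seedTableTwo_val (k M : ℕ) (T₁ T₂ : Table n) :
    (seedTableTwo k M T₁ T₂).val = (seedTable k M
      (combineBelowSeed k (bestBelowSeed k M T₁).val (bestBelowSeed k M T₂).val).val).val := rfl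

/-- Extracting `combineBelowSeed` changes the bracketing of the binds, hence that of the times. -/
lemma seedTableTwo_time_eq (k M : ℕ) (T₁ T₂ : Table n) :
    (seedTableTwo k M T₁ T₂).time = (bestBelowSeed k M T₁).time + 1 +
      ((bestBelowSeed k M T₂).time + 1 +
      ((combineBelowSeed k (bestBelowSeed k M T₁).val (bestBelowSeed k M T₂).val).time +
        (seedTable k M (combineBelowSeed k (bestBelowSeed k M T₁).val
          (bestBelowSeed k M T₂).val).val).time)) := by
  simp only [seedTableTwo, combineBelowSeed, time_bind, time_call, val_call, val_bind,
    Nat.add_assoc]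

lemma seedTableTwo_time_le (k M : ℕ) (T₁ T₂ : Table n) :
    (seedTableTwo k M T₁ T₂).time ≤ 45 * ((k + 1) ^ 2 * (M + 1) ^ 3) := by
  have h1 := bestBelowSeed_time_le k M T₁
  have h2 := bestBelowSeed_time_le k M T₂
  have h3 := combineBelowSeed_time_le k (bestBelowSeed k M T₁).val (bestBelowSeed k M T₂).val
  have h4 := seedTable_time_le k M (combineBelowSeed k (bestBelowSeed k M T₁).val
    (bestBelowSeed k M T₂).val).val
  have h5 : 0 < (k + 1) ^ 2 * (M + 1) ^ 3 := by positivity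
  have h6 : (k + 1) ^ 2 ≤ (k + 1) ^ 2 * (M + 1) ^ 3 := Nat.le_mul_of_pos_right _ (by positivity)
  rw [seedTableTwo_time_eq]
  omega

/-- The updates of the table of a non-seed node with one child for fixed `b` and fixed rounded
values. -/
noncomputable def improveOne (k : ℕ) (b : Bool) (v : Fin n) (T₁ : Table n) (g : ℝ)
    (ci ci₁ fi fi₁ : ℕ) (T : Table n) : Prog (Table n) :=
  loopN (k + 1) T fun T κ₁ => do
    let κ ← step (κ₁ + b.toNat)
    let fits ← step (decide (κ ≤ k))
    if fits then
      let e₁ ← read T₁ (κ₁, ci₁, fi₁)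
      let e ← Entry.add (some (g, boostNode b v)) e₁
      T.improve (κ, ci, fi) e
    else pure T

lemma improveOne_time_le (k : ℕ) (b : Bool) (v : Fin n) (T₁ : Table n) (g : ℝ)
    (ci ci₁ fi fi₁ : ℕ) (T : Table n) :
    (improveOne k b v T₁ g ci ci₁ fi fi₁ T).time ≤ (k + 1) * 10 := by
  refine loopN_time_le_mul _ _ _ _ fun T κ₁ _ => ?_
  have a1 := Entry.add_time_le (some (g, boostNode b v)) (T₁ (κ₁, ci₁, fi₁))
  have a2 := Table.improve_time_le T (κ₁ + b.toNat, ci, fi)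
    (Entry.add (some (g, boostNode b v)) (T₁ (κ₁, ci₁, fi₁))).val
  by_cases hk : κ₁ + b.toNat ≤ k
  · simp [hk]
    omega
  · simp [hk]

/-- The body of the loops of `nonseedTableOne`. -/
noncomputable def stepOne (ap₀ : Fin n → ℝ) (k : ℕ) (δ : ℝ) (M : ℕ)
    (v : Fin n) (T₁ : Table n) (b : Bool) (p p₁ : ℝ) (ci₁ fi : ℕ) (T : Table n) :
    Prog (Table n) := do
  let c₁ ← roundedValue δ M ci₁
  let f ← roundedValue δ M fi
  let x ← reg c₁ * reg p₁
  let ci ← roundDown δ M x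
  let c ← roundedValue δ M ci
  let y₁ ← reg f * reg p
  let fi₁ ← roundDown δ M y₁
  let g ← gain c f p (ap₀ v)
  improveOne k b v T₁ g ci ci₁ fi fi₁ T

lemma stepOne_time_le (ap₀ : Fin n → ℝ) (k : ℕ) (δ : ℝ) (M : ℕ)
    (v : Fin n) (T₁ : Table n) (b : Bool) (p p₁ : ℝ) (ci₁ fi : ℕ) (T : Table n) :
    (stepOne ap₀ k δ M v T₁ b p p₁ ci₁ fi T).time + 1 ≤ (k + 1) * 40 := by
  rw [stepOne]
  simp only [time_bind, time_mul, time_reg, time_gain]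
  have a1 := fun j => roundedValue_time_le δ M j
  have a2 := fun x => roundDown_time_le δ M x
  refine (Nat.add_le_add_right (Nat.add_le_add (a1 _) (Nat.add_le_add (a1 _)
    (Nat.add_le_add le_rfl (Nat.add_le_add (a2 _) (Nat.add_le_add (a1 _)
    (Nat.add_le_add le_rfl (Nat.add_le_add (a2 _) (Nat.add_le_add le_rfl
    (improveOne_time_le _ _ _ _ _ _ _ _ _ _))))))))) 1).trans ?_
  omega

lemma nonseedTableOne_eq (I : TreeInstance n) (ap₀ : Fin n → ℝ) (k : ℕ) (δ : ℝ) (M : ℕ)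
    (parent : Option (Fin n)) (v w : Fin n) (T₁ : Table n) :
    I.nonseedTableOne ap₀ k δ M parent v w T₁ = (do
      let T₀ ← newTable n k M
      let _ ← read ap₀ v
      loop [false, true] T₀ fun T b => do
        let p ← I.readParentProb b parent v
        let p₁ ← I.readProb b w v
        loopN (M + 1) T fun T ci₁ =>
          loopN (M + 1) T fun T fi => stepOne ap₀ k δ M v T₁ b p p₁ ci₁ fi T) := rfl

lemma nonseedTableOne_time_le (I : TreeInstance n) (ap₀ : Fin n → ℝ) (k : ℕ) (δ : ℝ) (M : ℕ)
    (parent : Option (Fin n)) (v w : Fin n) (T₁ : Table n) :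
    (I.nonseedTableOne ap₀ k δ M parent v w T₁).time ≤ 200 * ((k + 1) ^ 2 * (M + 1) ^ 3) := by
  rw [nonseedTableOne_eq, time_bind, time_bind, time_read]
  have h0 := newTable_time_le n k M
  have hl := loop_time_le [false, true] (newTable n k M).val (fun T b => do
        let p ← I.readParentProb b parent v
        let p₁ ← I.readProb b w v
        loopN (M + 1) T fun T ci₁ =>
          loopN (M + 1) T fun T fi => stepOne ap₀ k δ M v T₁ b p p₁ ci₁ fi T)
      (2 + (M + 1) * ((M + 1) * ((k + 1) * 40) + 1)) (by
    intro T b _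
    rw [time_bind, time_bind, time_readParentProb, time_readProb, ← Nat.add_assoc]
    refine Nat.add_le_add_left (loopN_time_le _ _ _ _ fun T ci₁ _ => ?_) _
    exact loopN_time_le_mul _ _ _ _ fun T fi _ => stepOne_time_le _ _ _ _ _ _ _ _ _ _ _ _)
  have h2 : 2 * (2 + (M + 1) * ((M + 1) * ((k + 1) * 40) + 1) + 1)
      ≤ 100 * ((k + 1) ^ 2 * (M + 1) ^ 3) := by
    have e : 100 * ((k + 1) ^ 2 * (M + 1) ^ 3)
      = ((k + 1) * (M + 1) ^ 2 * 100) * ((k + 1) * (M + 1)) := by ring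
    rw [e]
    refine le_trans ?_ (Nat.le_mul_of_pos_right _ (by positivity))
    have e1 : 1 ≤ (k + 1) * (M + 1) ^ 2 := Nat.pos_of_ne_zero (by positivity)
    have e2 : M + 1 ≤ (k + 1) * (M + 1) ^ 2 := by
      have : (k + 1) * (M + 1) ^ 2 = (M + 1) * ((k + 1) * (M + 1)) := by ring
      rw [this]
      exact Nat.le_mul_of_pos_right _ (by positivity)
    have e3 : (M + 1) * ((M + 1) * ((k + 1) * 40) + 1) = 40 * ((k + 1) * (M + 1) ^ 2) + (M + 1) := by
      ring
    rw [e3]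
    omega
  have h3 : 0 < (k + 1) ^ 2 * (M + 1) ^ 3 := by positivity
  simp only [List.length_cons, List.length_nil, zero_add, Nat.reduceAdd] at hl
  omega

/-- The updates of the table of a non-seed node with two children for fixed `b` and fixed rounded
values. -/
noncomputable def improveTwo (k : ℕ) (b : Bool) (v : Fin n) (T₁ T₂ : Table n) (g : ℝ)
    (ci ci₁ ci₂ fi fi₁ fi₂ : ℕ) (T : Table n) : Prog (Table n) :=
  loopN (k + 1) T fun T κ₁ =>
    loopN (k + 1) T fun T κ₂ => do
      let κ ← step (κ₁ + κ₂ + b.toNat)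
      let fits ← step (decide (κ ≤ k))
      if fits then
        let e₁ ← read T₁ (κ₁, ci₁, fi₁)
        let e₂ ← read T₂ (κ₂, ci₂, fi₂)
        let e' ← Entry.add e₁ e₂
        let e ← Entry.add (some (g, boostNode b v)) e'
        T.improve (κ, ci, fi) e
      else pure T

lemma improveTwo_time_le (k : ℕ) (b : Bool) (v : Fin n) (T₁ T₂ : Table n) (g : ℝ)
    (ci ci₁ ci₂ fi fi₁ fi₂ : ℕ) (T : Table n) :
    (improveTwo k b v T₁ T₂ g ci ci₁ ci₂ fi fi₁ fi₂ T).time ≤ (k + 1) * ((k + 1) * 15) := by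
  refine loopN_time_le_mul _ _ _ _ fun T κ₁ _ => ?_
  refine (Nat.add_le_add_right (loopN_time_le_mul (k + 1) _ _ 13 fun T κ₂ _ => ?_) _).trans
      (by omega : (k + 1) * 13 + 1 ≤ (k + 1) * 15)
  have a0 := Entry.add_time_le (T₁ (κ₁, ci₁, fi₁)) (T₂ (κ₂, ci₂, fi₂))
  have a1 := Entry.add_time_le (some (g, boostNode b v))
    (Entry.add (T₁ (κ₁, ci₁, fi₁)) (T₂ (κ₂, ci₂, fi₂))).val
  have a2 := Table.improve_time_le T (κ₁ + κ₂ + b.toNat, ci, fi)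
    (Entry.add (some (g, boostNode b v))
      (Entry.add (T₁ (κ₁, ci₁, fi₁)) (T₂ (κ₂, ci₂, fi₂))).val).val
  by_cases hk : κ₁ + κ₂ + b.toNat ≤ k
  · simp [hk]
    omega
  · simp [hk]

/-- The body of the loops of `nonseedTableTwo`. -/
noncomputable def stepTwo (ap₀ : Fin n → ℝ) (k : ℕ) (δ : ℝ) (M : ℕ)
    (v : Fin n) (T₁ T₂ : Table n) (b : Bool) (p p₁ p₂ : ℝ) (ci₁ ci₂ fi : ℕ) (T : Table n) :
    Prog (Table n) := do
  let c₁ ← roundedValue δ M ci₁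
  let c₂ ← roundedValue δ M ci₂
  let f ← roundedValue δ M fi
  let x ← 1 - (1 - reg c₁ * reg p₁) * (1 - reg c₂ * reg p₂)
  let ci ← roundDown δ M x
  let c ← roundedValue δ M ci
  let y₁ ← 1 - (1 - reg f * reg p) * (1 - reg c₂ * reg p₂)
  let fi₁ ← roundDown δ M y₁
  let y₂ ← 1 - (1 - reg f * reg p) * (1 - reg c₁ * reg p₁)
  let fi₂ ← roundDown δ M y₂
  let g ← gain c f p (ap₀ v)
  improveTwo k b v T₁ T₂ g ci ci₁ ci₂ fi fi₁ fi₂ T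

lemma stepTwo_time_le (ap₀ : Fin n → ℝ) (k : ℕ) (δ : ℝ) (M : ℕ)
    (v : Fin n) (T₁ T₂ : Table n) (b : Bool) (p p₁ p₂ : ℝ) (ci₁ ci₂ fi : ℕ) (T : Table n) :
    (stepTwo ap₀ k δ M v T₁ T₂ b p p₁ p₂ ci₁ ci₂ fi T).time + 1 ≤ (k + 1) ^ 2 * 70 := by
  rw [stepTwo]
  simp only [time_bind, time_mul, time_sub, time_one, time_reg, time_gain]
  have a1 := fun j => roundedValue_time_le δ M j
  have a2 := fun x => roundDown_time_le δ M x
  refine (Nat.add_le_add_right (Nat.add_le_add (a1 _) (Nat.add_le_add (a1 _) (Nat.add_le_add (a1 _)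
    (Nat.add_le_add le_rfl (Nat.add_le_add (a2 _) (Nat.add_le_add (a1 _)
    (Nat.add_le_add le_rfl (Nat.add_le_add (a2 _) (Nat.add_le_add le_rfl
    (Nat.add_le_add (a2 _) (Nat.add_le_add le_rfl
    (improveTwo_time_le _ _ _ _ _ _ _ _ _ _ _ _ _)))))))))))) 1).trans ?_
  have e1 : 1 ≤ (k + 1) ^ 2 := Nat.pos_of_ne_zero (by positivity)
  have e2 : (k + 1) * ((k + 1) * 15) = 15 * (k + 1) ^ 2 := by ring
  rw [e2]
  omega

lemma nonseedTableTwo_eq (I : TreeInstance n) (ap₀ : Fin n → ℝ) (k : ℕ) (δ : ℝ) (M : ℕ)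
    (parent : Option (Fin n)) (v w₁ w₂ : Fin n) (T₁ T₂ : Table n) :
    I.nonseedTableTwo ap₀ k δ M parent v w₁ w₂ T₁ T₂ = (do
      let T₀ ← newTable n k M
      let _ ← read ap₀ v
      loop [false, true] T₀ fun T b => do
        let p ← I.readParentProb b parent v
        let p₁ ← I.readProb b w₁ v
        let p₂ ← I.readProb b w₂ v
        loopN (M + 1) T fun T ci₁ =>
          loopN (M + 1) T fun T ci₂ =>
            loopN (M + 1) T fun T fi =>
              stepTwo ap₀ k δ M v T₁ T₂ b p p₁ p₂ ci₁ ci₂ fi T) := rfl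

lemma nonseedTableTwo_time_le (I : TreeInstance n) (ap₀ : Fin n → ℝ) (k : ℕ) (δ : ℝ) (M : ℕ)
    (parent : Option (Fin n)) (v w₁ w₂ : Fin n) (T₁ T₂ : Table n) :
    (I.nonseedTableTwo ap₀ k δ M parent v w₁ w₂ T₁ T₂).time
      ≤ 200 * ((k + 1) ^ 2 * (M + 1) ^ 3) := by
  rw [nonseedTableTwo_eq, time_bind, time_bind, time_read]
  have h0 := newTable_time_le n k M
  have hl := loop_time_le [false, true] (newTable n k M).val (fun T b => do
        let p ← I.readParentProb b parent v
        let p₁ ← I.readProb b w₁ v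
        let p₂ ← I.readProb b w₂ v
        loopN (M + 1) T fun T ci₁ =>
          loopN (M + 1) T fun T ci₂ =>
            loopN (M + 1) T fun T fi =>
              stepTwo ap₀ k δ M v T₁ T₂ b p p₁ p₂ ci₁ ci₂ fi T)
      (3 + (M + 1) * ((M + 1) * ((M + 1) * ((k + 1) ^ 2 * 70) + 1) + 1)) (by
    intro T b _
    rw [time_bind, time_bind, time_bind, time_readParentProb, time_readProb, time_readProb,
      ← Nat.add_assoc, ← Nat.add_assoc]
    refine Nat.add_le_add_left (loopN_time_le _ _ _ _ fun T ci₁ _ => ?_) _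
    refine loopN_time_le _ _ _ _ fun T ci₂ _ => ?_
    exact loopN_time_le_mul _ _ _ _ fun T fi _ =>
      stepTwo_time_le _ _ _ _ _ _ _ _ _ _ _ _ _ _ _)
  have h2 : 2 * (3 + (M + 1) * ((M + 1) * ((M + 1) * ((k + 1) ^ 2 * 70) + 1) + 1) + 1)
      ≤ 190 * ((k + 1) ^ 2 * (M + 1) ^ 3) := by
    have e1 : 1 ≤ (k + 1) ^ 2 * (M + 1) ^ 3 := Nat.pos_of_ne_zero (by positivity)
    have e2 : M + 1 ≤ (k + 1) ^ 2 * (M + 1) ^ 3 := by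
      have : (k + 1) ^ 2 * (M + 1) ^ 3 = (M + 1) * ((k + 1) ^ 2 * (M + 1) ^ 2) := by ring
      rw [this]
      exact Nat.le_mul_of_pos_right _ (by positivity)
    have e3 : (M + 1) ^ 2 ≤ (k + 1) ^ 2 * (M + 1) ^ 3 := by
      have : (k + 1) ^ 2 * (M + 1) ^ 3 = (M + 1) ^ 2 * ((k + 1) ^ 2 * (M + 1)) := by ring
      rw [this]
      exact Nat.le_mul_of_pos_right _ (by positivity)
    have e4 : (M + 1) * ((M + 1) * ((M + 1) * ((k + 1) ^ 2 * 70) + 1) + 1)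
        = 70 * ((k + 1) ^ 2 * (M + 1) ^ 3) + (M + 1) ^ 2 + (M + 1) := by ring
    rw [e4]
    omega
  have h3 : 0 < (k + 1) ^ 2 * (M + 1) ^ 3 := by positivity
  simp only [List.length_cons, List.length_nil, zero_add, Nat.reduceAdd] at hl
  omega

/-- The computation of the table of `v` from the tables of its children. -/
noncomputable def tableOf (I : TreeInstance n) (ap₀ : Fin n → ℝ) (k : ℕ) (δ : ℝ) (M : ℕ)
    (parent : Option (Fin n)) (v : Fin n) (s : Bool) (below : List (Fin n × Table n)) :
    Prog (Table n) :=
  match below with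
  | [] => call (I.leafTable ap₀ k δ M parent v)
  | [(w, T₁)] =>
    if s then call (seedTableOne k M T₁)
    else call (I.nonseedTableOne ap₀ k δ M parent v w T₁)
  | [(w₁, T₁), (w₂, T₂)] =>
    if s then call (seedTableTwo k M T₁ T₂)
    else call (I.nonseedTableTwo ap₀ k δ M parent v w₁ w₂ T₁ T₂)
  | _ => newTable n k M

lemma dpTable_succ (I : TreeInstance n) (ap₀ : Fin n → ℝ) (k : ℕ) (δ : ℝ) (M fuel : ℕ)
    (parent : Option (Fin n)) (v : Fin n) :
    I.dpTable ap₀ k δ M (fuel + 1) parent v = (do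
      let below ← loop (I.nbrs v) ([] : List (Fin n × Table n)) fun l w => do
        let skip ← step (decide (parent = some w))
        if skip then pure l else
          let T ← call (I.dpTable ap₀ k δ M fuel (some v) w)
          step (l ++ [(w, T)])
      let s ← I.readSeed v
      I.tableOf ap₀ k δ M parent v s below) := by
  rw [dpTable]
  rfl

lemma tableOf_time_le (I : TreeInstance n) (ap₀ : Fin n → ℝ) (k : ℕ) (δ : ℝ) (M : ℕ)
    (parent : Option (Fin n)) (v : Fin n) (s : Bool) (below : List (Fin n × Table n)) :
    (I.tableOf ap₀ k δ M parent v s below).time ≤ 201 * ((k + 1) ^ 2 * (M + 1) ^ 3) := by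
  have h3 : 0 < (k + 1) ^ 2 * (M + 1) ^ 3 := by positivity
  rw [tableOf.eq_def]
  split
  · have := I.leafTable_time_le ap₀ k δ M parent v
    rw [time_call]
    omega
  · rename_i w T₁
    have h1 := seedTableOne_time_le k M T₁
    have h2 := I.nonseedTableOne_time_le ap₀ k δ M parent v w T₁
    rw [time_ite, time_call, time_call]
    split_ifs <;> omega
  · rename_i w₁ T₁ w₂ T₂
    have h1 := seedTableTwo_time_le k M T₁ T₂
    have h2 := I.nonseedTableTwo_time_le ap₀ k δ M parent v w₁ w₂ T₁ T₂
    rw [time_ite, time_call, time_call]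
    split_ifs <;> omega
  · have := newTable_time_le n k M
    omega

/-- One table and the overhead of at most three neighbours are charged to each node of the subtree.
-/
lemma dpTable_time_le (I : TreeInstance n) (hI : ∀ v, (I.children v).card ≤ 2)
    (ap₀ : Fin n → ℝ) (k : ℕ) (δ : ℝ) (M fuel : ℕ) {parent : Option (Fin n)} {v : Fin n}
    (h : I.Borders parent v) (hf : (I.side parent v).card ≤ fuel) :
    (I.dpTable ap₀ k δ M fuel parent v).time
      ≤ 220 * ((k + 1) ^ 2 * (M + 1) ^ 3) * (I.side parent v).card := by
  have h3 : 0 < (k + 1) ^ 2 * (M + 1) ^ 3 := by positivity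
  have ht := I.tableOf_time_le ap₀ k δ M
  -- The cost unit of a table becomes an opaque number; that it is positive is enough to absorb the
  -- constants.
  generalize (k + 1) ^ 2 * (M + 1) ^ 3 = W at h3 ht ⊢
  refine I.side_induction (P := fun fuel parent v =>
    (I.dpTable ap₀ k δ M fuel parent v).time ≤ 220 * W * (I.side parent v).card) ?_
    fuel parent v h hf
  intro fuel away v h _ ih
  have hl := loop_time_le_skip (I.nbrs v) ([] : List (Fin n × Table n)) (fun l w => do
        let skip ← step (decide (away = some w))
        if skip then pure l else
          let T ← call (I.dpTable ap₀ k δ M fuel (some v) w)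
          step (l ++ [(w, T)])) (fun w => decide (away = some w)) 3
        (fun w => if w ∈ I.kids away v then 220 * W * (I.side (some v) w).card else 0) (by
      intro s w hw
      by_cases hs : away = some w
      · simp [hs]
      · have hk : w ∈ I.kids away v := I.mem_kids.2 ⟨(I.mem_nbrs v w).1 hw, hs⟩
        have h1 := ih w hk
        simp [hs, hk]
        omega)
  have hd := I.length_nbrs_le hI v
  have hsum : ((I.kids away v).map fun w =>
      if w ∈ I.kids away v then 220 * W * (I.side (some v) w).card else 0).sum
      = 220 * W * ((I.kids away v).map fun w => (I.side (some v) w).card).sum := by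
    rw [← List.sum_map_mul_left]
    congr 1
    apply List.map_congr_left
    intro w hw
    simp [hw]
  change _ ≤ _ + ((I.kids away v).map fun w =>
      if w ∈ I.kids away v then 220 * W * (I.side (some v) w).card else 0).sum at hl
  rw [hsum] at hl
  rw [I.card_side h, dpTable_succ, time_bind, time_bind, time_readSeed, mul_add]
  have := ht away v (I.readSeed v).val (loop (I.nbrs v) ([] : List (Fin n × Table n)) fun l w => do
        let skip ← step (decide (away = some w))
        if skip then pure l else
          let T ← call (I.dpTable ap₀ k δ M fuel (some v) w)
          step (l ++ [(w, T)])).val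
  omega

end TreeInstance

end Boosting

namespace Boosting

open Prog

/-! ### Rounded values -/

/-- `M` is the number of multiples of `δ` in `[0, 1)`. -/
structure IsRounding (δ : ℝ) (M : ℕ) : Prop where
  pos : 0 < δ
  eq_ceil : M = ⌈1 / δ⌉₊

/-- The rounded value with index `j`. -/
noncomputable def rounded (δ : ℝ) (M j : ℕ) : ℝ := (roundedValue δ M j).val

/-- The index of the largest rounded value that is at most `x`. -/
noncomputable def roundIdx (δ : ℝ) (M : ℕ) (x : ℝ) : ℕ := (roundDown δ M x).val

lemma rounded_eq (δ : ℝ) (M j : ℕ) : rounded δ M j = if j < M then (j : ℝ) * δ else 1 := by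
  by_cases h : j < M <;> simp [rounded, roundedValue, h]

lemma roundIdx_eq (δ : ℝ) (M : ℕ) (x : ℝ) :
    roundIdx δ M x = if x < 1 then ⌊x / δ⌋₊ else M := by
  by_cases h : x < 1 <;> simp [roundIdx, roundDown, h]

namespace IsRounding

variable {δ : ℝ} {M : ℕ}

/-- By the choice of the ceiling, the indices below `M` are exactly the multiples of `δ` below `1`,
so that `1` occurs once, with index `M`. -/
lemma lt_iff (h : IsRounding δ M) (j : ℕ) : j < M ↔ (j : ℝ) * δ < 1 := by
  rw [h.eq_ceil, Nat.lt_ceil, lt_div_iff₀ h.pos]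

lemma rounded_nonneg (h : IsRounding δ M) (j : ℕ) : 0 ≤ rounded δ M j := by
  have := h.pos
  rw [rounded_eq]
  split_ifs <;> positivity

lemma rounded_le_one (h : IsRounding δ M) (j : ℕ) : rounded δ M j ≤ 1 := by
  rw [rounded_eq]
  split_ifs with hj
  · exact ((h.lt_iff j).1 hj).le
  · exact le_rfl

lemma rounded_mem_Icc (h : IsRounding δ M) (j : ℕ) :
    0 ≤ rounded δ M j ∧ rounded δ M j ≤ 1 :=
  ⟨h.rounded_nonneg j, h.rounded_le_one j⟩

lemma rounded_self : rounded δ M M = 1 := by simp [rounded_eq]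

lemma rounded_zero (h : IsRounding δ M) : rounded δ M 0 = 0 := by
  rw [rounded_eq, if_pos ((h.lt_iff 0).2 (by simp))]
  simp

lemma floor_lt (h : IsRounding δ M) {x : ℝ} (hx : 0 ≤ x) (hx1 : x < 1) : ⌊x / δ⌋₊ < M := by
  rw [h.lt_iff]
  have := Nat.floor_le (div_nonneg hx h.pos.le)
  rw [le_div_iff₀ h.pos] at this
  linarith

lemma rounded_roundIdx_le (h : IsRounding δ M) {x : ℝ} (hx : 0 ≤ x) :
    rounded δ M (roundIdx δ M x) ≤ x := by
  rw [roundIdx_eq]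
  split_ifs with hx1
  · rw [rounded_eq, if_pos (h.floor_lt hx hx1)]
    have := Nat.floor_le (div_nonneg hx h.pos.le)
    rwa [le_div_iff₀ h.pos] at this
  · rw [rounded_self]
    linarith

lemma le_rounded_roundIdx (h : IsRounding δ M) {x : ℝ} (hx : 0 ≤ x) (hx1 : x ≤ 1) :
    x - δ ≤ rounded δ M (roundIdx δ M x) := by
  rw [roundIdx_eq]
  split_ifs with h1
  · rw [rounded_eq, if_pos (h.floor_lt hx h1)]
    have := Nat.lt_floor_add_one (x / δ)
    rw [div_lt_iff₀ h.pos] at this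
    linarith
  · rw [rounded_self]
    linarith [h.pos]

lemma roundIdx_le (h : IsRounding δ M) {x : ℝ} (hx : 0 ≤ x) : roundIdx δ M x ≤ M := by
  rw [roundIdx_eq]
  split_ifs with h1
  · exact (h.floor_lt hx h1).le
  · exact le_rfl

end IsRounding

/-! ### Entries of tables -/

variable {n : ℕ}

lemma Entry.best_val (e₁ e₂ : Entry n) :
    (Entry.best e₁ e₂).val = e₁ ∨ (Entry.best e₁ e₂).val = e₂ := by
  rcases e₁ with _ | ⟨x, s⟩
  · right; rfl
  · rcases e₂ with _ | ⟨y, t⟩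
    · left; rfl
    · by_cases h : x < y <;> simp [Entry.best, h]

/-- The entry has at least the value `x`. -/
def Entry.Reaches (e : Entry n) (x : ℝ) : Prop := ∃ y, e = some y ∧ x ≤ y.1

lemma Entry.best_reaches_left {e₁ : Entry n} (e₂ : Entry n) {x : ℝ} (h : e₁.Reaches x) :
    Entry.Reaches (Entry.best e₁ e₂).val x := by
  obtain ⟨⟨y, s⟩, rfl, hy⟩ := h
  rcases e₂ with _ | ⟨z, t⟩
  · exact ⟨(y, s), rfl, hy⟩
  · by_cases h : y < z
    · exact ⟨(z, t), by simp [Entry.best, h], hy.trans h.le⟩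
    · exact ⟨(y, s), by simp [Entry.best, h], hy⟩

lemma Entry.best_reaches_right (e₁ : Entry n) {e₂ : Entry n} {x : ℝ} (h : e₂.Reaches x) :
    Entry.Reaches (Entry.best e₁ e₂).val x := by
  obtain ⟨⟨y, s⟩, rfl, hy⟩ := h
  rcases e₁ with _ | ⟨z, t⟩
  · exact ⟨(y, s), rfl, hy⟩
  · by_cases h : z < y
    · exact ⟨(y, s), by simp [Entry.best, h], hy⟩
    · exact ⟨(z, t), by simp [Entry.best, h], hy.trans (not_lt.1 h)⟩

lemma Entry.add_some (y z : ℝ × NodeSet n) :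
    (Entry.add (some y) (some z)).val = some (y.1 + z.1, NodeSet.union y.2 z.2) := rfl

lemma Entry.add_eq_some {e₁ e₂ : Entry n} {y : ℝ × NodeSet n}
    (h : (Entry.add e₁ e₂).val = some y) :
    ∃ y₁ y₂, e₁ = some y₁ ∧ e₂ = some y₂ ∧ y = (y₁.1 + y₂.1, NodeSet.union y₁.2 y₂.2) := by
  rcases e₁ with _ | y₁
  · simp [Entry.add] at h
  · rcases e₂ with _ | y₂
    · simp [Entry.add] at h
    · rw [Entry.add_some] at h
      exact ⟨y₁, y₂, rfl, rfl, (Option.some.inj h).symm⟩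

lemma Entry.add_reaches {e₁ e₂ : Entry n} {x y : ℝ} (h₁ : e₁.Reaches x) (h₂ : e₂.Reaches y) :
    Entry.Reaches (Entry.add e₁ e₂).val (x + y) := by
  obtain ⟨y₁, rfl, h₁⟩ := h₁
  obtain ⟨y₂, rfl, h₂⟩ := h₂
  exact ⟨_, Entry.add_some y₁ y₂, add_le_add h₁ h₂⟩

/-- All entries of an array other than `-∞` have the property `Q`. -/
def AllEntries {ι : Type} (Q : ι → ℝ × NodeSet n → Prop) (T : ι → Entry n) : Prop :=
  ∀ i y, T i = some y → Q i y

lemma allEntries_none {ι : Type} (Q : ι → ℝ × NodeSet n → Prop) :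
    AllEntries Q fun _ => (none : Entry n) := by
  intro i y h
  simp at h

lemma allEntries_best {ι : Type} [DecidableEq ι] {Q : ι → ℝ × NodeSet n → Prop}
    {T : ι → Entry n} (hT : AllEntries Q T) {i : ι} {e : Entry n} (he : ∀ y, e = some y → Q i y) :
    AllEntries Q (Function.update T i (Entry.best (T i) e).val) := by
  intro j y h
  by_cases hj : j = i
  · subst hj
    rw [Function.update_self] at h
    rcases Entry.best_val (T j) e with h' | h' <;> rw [h'] at h
    · exact hT j y h
    · exact he y h
  · rw [Function.update_of_ne hj] at h
    exact hT j y h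

lemma reaches_best {ι : Type} [DecidableEq ι] {T : ι → Entry n} (i : ι) (e : Entry n) {j : ι}
    {x : ℝ} (h : (T j).Reaches x) :
    Entry.Reaches (Function.update T i (Entry.best (T i) e).val j) x := by
  by_cases hj : j = i
  · subst hj
    rw [Function.update_self]
    exact Entry.best_reaches_left e h
  · rwa [Function.update_of_ne hj]

lemma reaches_best_self {ι : Type} [DecidableEq ι] (T : ι → Entry n) (i : ι) {e : Entry n}
    {x : ℝ} (h : e.Reaches x) :
    Entry.Reaches (Function.update T i (Entry.best (T i) e).val i) x := by
  rw [Function.update_self]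
  exact Entry.best_reaches_right (T i) h

lemma Table.improve_val (T : Table n) (i : ℕ × ℕ × ℕ) (e : Entry n) :
    (T.improve i e).val = Function.update T i (Entry.best (T i) e).val := rfl

namespace TreeInstance

/-! ### Entries of the tables of the dynamic program -/

/-- A cell is `-∞` until an update writes it, and an update keeps one of the two competing entries.
So a property of all entries that updates may offer holds for the whole table. The other lemmas
ending in `_all` follow the same principle and carry the soundness proof. -/
lemma leafTable_all (I : TreeInstance n) (ap₀ : Fin n → ℝ) (k : ℕ) (δ : ℝ) (M : ℕ)
    (parent : Option (Fin n)) (v : Fin n) {Q : ℕ × ℕ × ℕ → ℝ × NodeSet n → Prop}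
    (hQ : ∀ κ fi, Q (κ, (if v ∈ I.seeds then M else 0), fi)
      ((gain (rounded δ M (if v ∈ I.seeds then M else 0)) (rounded δ M fi)
        (I.readParentProb (decide (0 < κ)) parent v).val (ap₀ v)).val,
        boostNode (decide (0 < κ)) v)) :
    AllEntries Q (I.leafTable ap₀ k δ M parent v).val := by
  rw [leafTable]
  simp only [val_bind, val_readSeed, val_read, val_step, decide_eq_true_eq]
  refine loopN_induction _ _ _ (allEntries_none Q) fun T hT κ _ => ?_
  simp only [val_bind, val_step]
  refine loopN_induction _ _ _ hT fun T hT fi _ => ?_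
  simp only [val_bind, Table.improve_val]
  refine allEntries_best hT fun y hy => ?_
  rw [← Option.some.inj hy]
  exact hQ κ fi

/-- Updates never decrease a cell, so the one iteration that offers the value is enough. This is the
principle of all lemmas ending in `_reaches`, which carry the completeness proof. -/
lemma leafTable_reaches (I : TreeInstance n) (ap₀ : Fin n → ℝ) (k : ℕ) (δ : ℝ) (M : ℕ)
    (parent : Option (Fin n)) (v : Fin n) {κ fi : ℕ} (hκ : κ ≤ k) (hfi : fi ≤ M) :
    Entry.Reaches ((I.leafTable ap₀ k δ M parent v).val (κ, (if v ∈ I.seeds then M else 0), fi))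
      (gain (rounded δ M (if v ∈ I.seeds then M else 0)) (rounded δ M fi)
        (I.readParentProb (decide (0 < κ)) parent v).val (ap₀ v)).val := by
  rw [leafTable]
  simp only [val_bind, val_readSeed, val_read, val_step, decide_eq_true_eq]
  refine loopN_reach (i := κ) (P := fun T : Table n => Entry.Reaches (T _) _) _ _ _ (by omega)
    (fun T hT κ _ => ?_) fun T => ?_
  · simp only [val_bind, val_step]
    refine loopN_induction (P := fun T : Table n => Entry.Reaches (T _) _) _ _ _ hT
      fun T hT fi _ => ?_
    exact reaches_best _ _ hT
  · simp only [val_bind, val_step]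
    refine loopN_reach (i := fi) (P := fun T : Table n => Entry.Reaches (T _) _) _ _ _ (by omega)
      (fun T hT fi _ => reaches_best _ _ hT) fun T => ?_
    exact reaches_best_self _ _ ⟨_, rfl, le_rfl⟩

lemma bestBelowSeed_all (k M : ℕ) (T : Table n) {Q : ℕ → ℝ × NodeSet n → Prop}
    (hQ : ∀ κ ci y, T (κ, ci, M) = some y → Q κ y) : AllEntries Q (bestBelowSeed k M T).val := by
  rw [bestBelowSeed]
  refine loopN_induction _ _ _ (allEntries_none Q) fun h hh κ _ => ?_
  refine loopN_induction _ _ _ hh fun h hh ci _ => ?_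
  exact allEntries_best hh fun y hy => hQ κ ci y hy

lemma bestBelowSeed_reaches (k M : ℕ) (T : Table n) {κ ci : ℕ} (hκ : κ ≤ k) (hci : ci ≤ M)
    {x : ℝ} (hx : (T (κ, ci, M)).Reaches x) :
    Entry.Reaches ((bestBelowSeed k M T).val κ) x := by
  rw [bestBelowSeed]
  refine loopN_reach (i := κ) (P := fun T : ℕ → Entry n => Entry.Reaches (T _) _) _ _ _
    (by omega) (fun h hh κ _ => ?_) fun h => ?_
  · exact loopN_induction (P := fun T : ℕ → Entry n => Entry.Reaches (T _) _) _ _ _ hh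
      fun h hh ci _ => reaches_best _ _ hh
  · refine loopN_reach (i := ci) (P := fun T : ℕ → Entry n => Entry.Reaches (T _) _) _ _ _
      (by omega) (fun h hh ci _ => reaches_best _ _ hh) fun h => ?_
    exact reaches_best_self _ _ hx

lemma seedTable_all (k M : ℕ) (h : ℕ → Entry n) {Q : ℕ × ℕ × ℕ → ℝ × NodeSet n → Prop}
    (hQ : ∀ κ fi y, h κ = some y → Q (κ, M, fi) y) : AllEntries Q (seedTable k M h).val := by
  rw [seedTable]
  refine loopN_induction _ _ _ (allEntries_none Q) fun T hT κ _ => ?_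
  refine loopN_induction _ _ _ hT fun T hT fi _ => ?_
  exact allEntries_best hT fun y hy => hQ κ fi y hy

lemma seedTable_reaches (k M : ℕ) (h : ℕ → Entry n) {κ fi : ℕ} (hκ : κ ≤ k) (hfi : fi ≤ M)
    {x : ℝ} (hx : (h κ).Reaches x) : Entry.Reaches ((seedTable k M h).val (κ, M, fi)) x := by
  rw [seedTable]
  refine loopN_reach (i := κ) (P := fun T : Table n => Entry.Reaches (T _) _) _ _ _ (by omega)
    (fun T hT κ _ => ?_) fun T => ?_
  · exact loopN_induction (P := fun T : Table n => Entry.Reaches (T _) _) _ _ _ hT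
      fun T hT fi _ => reaches_best _ _ hT
  · refine loopN_reach (i := fi) (P := fun T : Table n => Entry.Reaches (T _) _) _ _ _ (by omega)
      (fun T hT fi _ => reaches_best _ _ hT) fun T => ?_
    exact reaches_best_self _ _ hx

lemma combineBelowSeed_all (k : ℕ) (h₁ h₂ : ℕ → Entry n) {Q : ℕ → ℝ × NodeSet n → Prop}
    (hQ : ∀ κ₁ κ₂ y₁ y₂, h₁ κ₁ = some y₁ → h₂ κ₂ = some y₂ →
      Q (κ₁ + κ₂) (y₁.1 + y₂.1, NodeSet.union y₁.2 y₂.2)) :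
    AllEntries Q (combineBelowSeed k h₁ h₂).val := by
  rw [combineBelowSeed]
  refine loopN_induction _ _ _ (allEntries_none Q) fun h hh κ₁ _ => ?_
  refine loopN_induction _ _ _ hh fun h hh κ₂ _ => ?_
  by_cases hk : κ₁ + κ₂ ≤ k
  · simp only [val_bind, val_step, hk, decide_true, if_true, val_read, val_write]
    refine allEntries_best hh fun y hy => ?_
    obtain ⟨y₁, y₂, e₁, e₂, rfl⟩ := Entry.add_eq_some hy
    exact hQ κ₁ κ₂ y₁ y₂ e₁ e₂
  · simpa [hk] using hh

lemma combineBelowSeed_reaches (k : ℕ) (h₁ h₂ : ℕ → Entry n) {κ₁ κ₂ : ℕ} (hκ : κ₁ + κ₂ ≤ k)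
    {x₁ x₂ : ℝ} (hx₁ : (h₁ κ₁).Reaches x₁) (hx₂ : (h₂ κ₂).Reaches x₂) :
    Entry.Reaches ((combineBelowSeed k h₁ h₂).val (κ₁ + κ₂)) (x₁ + x₂) := by
  rw [combineBelowSeed]
  -- No other iteration spoils what has been reached; this is needed before as well as after the
  -- inner loop of interest.
  have hstep : ∀ (κ₁' κ₂' : ℕ) (h : ℕ → Entry n), Entry.Reaches (h (κ₁ + κ₂)) (x₁ + x₂) →
      Entry.Reaches ((do
        let fits ← step (decide (κ₁' + κ₂' ≤ k))
        if fits then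
          let e₁ ← read h₁ κ₁'
          let e₂ ← read h₂ κ₂'
          let e ← Entry.add e₁ e₂
          let old ← read h (κ₁' + κ₂')
          let new ← Entry.best old e
          write h (κ₁' + κ₂') new
        else pure h : Prog (ℕ → Entry n)).val (κ₁ + κ₂)) (x₁ + x₂) := by
    intro κ₁' κ₂' h hh
    by_cases hk : κ₁' + κ₂' ≤ k
    · simp only [val_bind, val_step, hk, decide_true, if_true, val_read, val_write]
      exact reaches_best _ _ hh
    · simpa [hk] using hh
  refine loopN_reach (i := κ₁) (P := fun T : ℕ → Entry n => Entry.Reaches (T _) _) _ _ _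
    (by omega) (fun h hh κ₁' _ => ?_) fun h => ?_
  · exact loopN_induction (P := fun T : ℕ → Entry n => Entry.Reaches (T _) _) _ _ _ hh
      fun h hh κ₂' _ => hstep κ₁' κ₂' h hh
  · refine loopN_reach (i := κ₂) (P := fun T : ℕ → Entry n => Entry.Reaches (T _) _) _ _ _
      (by omega) (fun h hh κ₂' _ => hstep κ₁ κ₂' h hh) fun h => ?_
    simp only [val_bind, val_step, hκ, decide_true, if_true, val_read, val_write]
    exact reaches_best_self _ _ (Entry.add_reaches hx₁ hx₂)

lemma improveOne_all (k : ℕ) (b : Bool) (v : Fin n) (T₁ : Table n) (g : ℝ) (ci ci₁ fi fi₁ : ℕ)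
    {Q : ℕ × ℕ × ℕ → ℝ × NodeSet n → Prop}
    (hQ : ∀ κ₁ y₁, T₁ (κ₁, ci₁, fi₁) = some y₁ →
      Q (κ₁ + b.toNat, ci, fi) (g + y₁.1, NodeSet.union (boostNode b v) y₁.2))
    {T : Table n} (hT : AllEntries Q T) :
    AllEntries Q (improveOne k b v T₁ g ci ci₁ fi fi₁ T).val := by
  rw [improveOne]
  refine loopN_induction _ _ _ hT fun T hT κ₁ _ => ?_
  by_cases hk : κ₁ + b.toNat ≤ k
  · simp only [val_bind, val_step, hk, decide_true, if_true, val_read, Table.improve_val]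
    refine allEntries_best hT fun y hy => ?_
    obtain ⟨y₁, y₂, e₁, e₂, rfl⟩ := Entry.add_eq_some hy
    rw [← Option.some.inj e₁]
    exact hQ κ₁ y₂ e₂
  · simpa [hk] using hT

lemma improveOne_mono (k : ℕ) (b : Bool) (v : Fin n) (T₁ : Table n) (g : ℝ) (ci ci₁ fi fi₁ : ℕ)
    {T : Table n} {i : ℕ × ℕ × ℕ} {x : ℝ} (hT : (T i).Reaches x) :
    Entry.Reaches ((improveOne k b v T₁ g ci ci₁ fi fi₁ T).val i) x := by
  rw [improveOne]
  refine loopN_induction (P := fun T : Table n => Entry.Reaches (T i) x) _ _ _ hT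
    fun T hT κ₁ _ => ?_
  by_cases hk : κ₁ + b.toNat ≤ k
  · simp only [val_bind, val_step, hk, decide_true, if_true, val_read, Table.improve_val]
    exact reaches_best _ _ hT
  · simpa [hk] using hT

lemma improveOne_reaches (k : ℕ) (b : Bool) (v : Fin n) (T₁ : Table n) (g : ℝ)
    (ci ci₁ fi fi₁ : ℕ) (T : Table n) {κ₁ : ℕ} (hκ : κ₁ + b.toNat ≤ k) {x : ℝ}
    (hx : (T₁ (κ₁, ci₁, fi₁)).Reaches x) :
    Entry.Reaches ((improveOne k b v T₁ g ci ci₁ fi fi₁ T).val (κ₁ + b.toNat, ci, fi))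
      (g + x) := by
  rw [improveOne]
  refine loopN_reach (i := κ₁) (P := fun T : Table n => Entry.Reaches (T _) _) _ _ _
    (by omega) (fun T hT κ₁' _ => ?_) fun T => ?_
  · by_cases hk : κ₁' + b.toNat ≤ k
    · simp only [val_bind, val_step, hk, decide_true, if_true, val_read, Table.improve_val]
      exact reaches_best _ _ hT
    · simpa [hk] using hT
  · simp only [val_bind, val_step, hκ, decide_true, if_true, val_read, Table.improve_val]
    exact reaches_best_self _ _ (Entry.add_reaches ⟨_, rfl, le_rfl⟩ hx)

lemma stepOne_val (ap₀ : Fin n → ℝ) (k : ℕ) (δ : ℝ) (M : ℕ)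
    (v : Fin n) (T₁ : Table n) (b : Bool) (p p₁ : ℝ) (ci₁ fi : ℕ) (T : Table n) :
    (stepOne ap₀ k δ M v T₁ b p p₁ ci₁ fi T).val =
      (improveOne k b v T₁ (gain (rounded δ M (roundIdx δ M (rounded δ M ci₁ * p₁)))
          (rounded δ M fi) p (ap₀ v)).val
        (roundIdx δ M (rounded δ M ci₁ * p₁)) ci₁ fi
        (roundIdx δ M (rounded δ M fi * p)) T).val := rfl

lemma nonseedTableOne_all (I : TreeInstance n) (ap₀ : Fin n → ℝ) (k : ℕ) (δ : ℝ) (M : ℕ)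
    (parent : Option (Fin n)) (v w : Fin n) (T₁ : Table n)
    {Q : ℕ × ℕ × ℕ → ℝ × NodeSet n → Prop}
    (hQ : ∀ (b : Bool) (ci₁ fi κ₁ : ℕ) (p p₁ : ℝ) y₁, p = (I.readParentProb b parent v).val →
      p₁ = (I.readProb b w v).val →
      T₁ (κ₁, ci₁, roundIdx δ M (rounded δ M fi * p)) = some y₁ →
      Q (κ₁ + b.toNat, roundIdx δ M (rounded δ M ci₁ * p₁), fi)
        ((gain (rounded δ M (roundIdx δ M (rounded δ M ci₁ * p₁)))
          (rounded δ M fi) p (ap₀ v)).val + y₁.1, NodeSet.union (boostNode b v) y₁.2)) :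
    AllEntries Q (I.nonseedTableOne ap₀ k δ M parent v w T₁).val := by
  rw [nonseedTableOne_eq, val_bind, val_bind]
  refine loop_induction _ _ _ (allEntries_none Q) fun T hT b _ => ?_
  refine loopN_induction _ _ _ hT fun T hT ci₁ _ => ?_
  refine loopN_induction _ _ _ hT fun T hT fi _ => ?_
  rw [stepOne_val]
  exact improveOne_all _ _ _ _ _ _ _ _ _ (fun κ₁ y₁ h => hQ b ci₁ fi κ₁ _ _ y₁ rfl rfl h) hT

lemma nonseedTableOne_reaches (I : TreeInstance n) (ap₀ : Fin n → ℝ) (k : ℕ) (δ : ℝ) (M : ℕ)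
    (parent : Option (Fin n)) (v w : Fin n) (T₁ : Table n) (b : Bool) {p p₁ : ℝ}
    (hp : p = (I.readParentProb b parent v).val) (hp₁ : p₁ = (I.readProb b w v).val)
    {ci₁ fi κ₁ : ℕ} (hci₁ : ci₁ ≤ M) (hfi : fi ≤ M) (hκ : κ₁ + b.toNat ≤ k) {x : ℝ}
    (hx : (T₁ (κ₁, ci₁, roundIdx δ M (rounded δ M fi * p))).Reaches x) :
    Entry.Reaches ((I.nonseedTableOne ap₀ k δ M parent v w T₁).val
      (κ₁ + b.toNat, roundIdx δ M (rounded δ M ci₁ * p₁), fi))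
      ((gain (rounded δ M (roundIdx δ M (rounded δ M ci₁ * p₁)))
          (rounded δ M fi) p (ap₀ v)).val + x) := by
  subst hp hp₁
  rw [nonseedTableOne_eq, val_bind, val_bind]
  refine loop_reach (a := b) (P := fun T : Table n => Entry.Reaches (T _) _) [false, true] _ _
    (by cases b <;> simp) (fun T hT b' _ => ?_) fun T => ?_
  · refine loopN_induction (P := fun T : Table n => Entry.Reaches (T _) _) _ _ _ hT
      fun T hT ci₁ _ => ?_
    exact loopN_induction (P := fun T : Table n => Entry.Reaches (T _) _) _ _ _ hT
      fun T hT fi _ => improveOne_mono _ _ _ _ _ _ _ _ _ hT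
  · refine loopN_reach (i := ci₁) (P := fun T : Table n => Entry.Reaches (T _) _) _ _ _
      (by omega) (fun T hT ci₁' _ => ?_) fun T => ?_
    · exact loopN_induction (P := fun T : Table n => Entry.Reaches (T _) _) _ _ _ hT
        fun T hT fi _ => improveOne_mono _ _ _ _ _ _ _ _ _ hT
    · refine loopN_reach (i := fi) (P := fun T : Table n => Entry.Reaches (T _) _) _ _ _
        (by omega) (fun T hT fi' _ => improveOne_mono _ _ _ _ _ _ _ _ _ hT) fun T => ?_
      exact improveOne_reaches _ _ _ _ _ _ _ _ _ _ hκ hx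

lemma improveTwo_all (k : ℕ) (b : Bool) (v : Fin n) (T₁ T₂ : Table n) (g : ℝ)
    (ci ci₁ ci₂ fi fi₁ fi₂ : ℕ) {Q : ℕ × ℕ × ℕ → ℝ × NodeSet n → Prop}
    (hQ : ∀ κ₁ κ₂ y₁ y₂, T₁ (κ₁, ci₁, fi₁) = some y₁ → T₂ (κ₂, ci₂, fi₂) = some y₂ →
      Q (κ₁ + κ₂ + b.toNat, ci, fi)
        (g + (y₁.1 + y₂.1), NodeSet.union (boostNode b v) (NodeSet.union y₁.2 y₂.2)))
    {T : Table n} (hT : AllEntries Q T) :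
    AllEntries Q (improveTwo k b v T₁ T₂ g ci ci₁ ci₂ fi fi₁ fi₂ T).val := by
  rw [improveTwo]
  refine loopN_induction _ _ _ hT fun T hT κ₁ _ => ?_
  refine loopN_induction _ _ _ hT fun T hT κ₂ _ => ?_
  by_cases hk : κ₁ + κ₂ + b.toNat ≤ k
  · simp only [val_bind, val_step, hk, decide_true, if_true, val_read, Table.improve_val]
    refine allEntries_best hT fun y hy => ?_
    obtain ⟨y₀, y', e₀, e', rfl⟩ := Entry.add_eq_some hy
    obtain ⟨y₁, y₂, e₁, e₂, rfl⟩ := Entry.add_eq_some e'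
    rw [← Option.some.inj e₀]
    exact hQ κ₁ κ₂ y₁ y₂ e₁ e₂
  · simpa [hk] using hT

lemma improveTwo_mono (k : ℕ) (b : Bool) (v : Fin n) (T₁ T₂ : Table n) (g : ℝ)
    (ci ci₁ ci₂ fi fi₁ fi₂ : ℕ) {T : Table n} {i : ℕ × ℕ × ℕ} {x : ℝ} (hT : (T i).Reaches x) :
    Entry.Reaches ((improveTwo k b v T₁ T₂ g ci ci₁ ci₂ fi fi₁ fi₂ T).val i) x := by
  rw [improveTwo]
  refine loopN_induction (P := fun T : Table n => Entry.Reaches (T i) x) _ _ _ hT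
    fun T hT κ₁ _ => ?_
  refine loopN_induction (P := fun T : Table n => Entry.Reaches (T i) x) _ _ _ hT
    fun T hT κ₂ _ => ?_
  by_cases hk : κ₁ + κ₂ + b.toNat ≤ k
  · simp only [val_bind, val_step, hk, decide_true, if_true, val_read, Table.improve_val]
    exact reaches_best _ _ hT
  · simpa [hk] using hT

lemma improveTwo_reaches (k : ℕ) (b : Bool) (v : Fin n) (T₁ T₂ : Table n) (g : ℝ)
    (ci ci₁ ci₂ fi fi₁ fi₂ : ℕ) (T : Table n) {κ₁ κ₂ : ℕ} (hκ : κ₁ + κ₂ + b.toNat ≤ k)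
    {x₁ x₂ : ℝ} (hx₁ : (T₁ (κ₁, ci₁, fi₁)).Reaches x₁) (hx₂ : (T₂ (κ₂, ci₂, fi₂)).Reaches x₂) :
    Entry.Reaches ((improveTwo k b v T₁ T₂ g ci ci₁ ci₂ fi fi₁ fi₂ T).val
      (κ₁ + κ₂ + b.toNat, ci, fi)) (g + (x₁ + x₂)) := by
  rw [improveTwo]
  have hstep : ∀ (κ₁' κ₂' : ℕ) (i : ℕ × ℕ × ℕ) (x : ℝ) (T : Table n), Entry.Reaches (T i) x →
      Entry.Reaches ((do
        let κ ← step (κ₁' + κ₂' + b.toNat)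
        let fits ← step (decide (κ ≤ k))
        if fits then
          let e₁ ← read T₁ (κ₁', ci₁, fi₁)
          let e₂ ← read T₂ (κ₂', ci₂, fi₂)
          let e' ← Entry.add e₁ e₂
          let e ← Entry.add (some (g, boostNode b v)) e'
          T.improve (κ, ci, fi) e
        else pure T : Prog (Table n)).val i) x := by
    intro κ₁' κ₂' i x T hT
    by_cases hk : κ₁' + κ₂' + b.toNat ≤ k
    · simp only [val_bind, val_step, hk, decide_true, if_true, val_read, Table.improve_val]
      exact reaches_best _ _ hT
    · simpa [hk] using hT
  refine loopN_reach (i := κ₁) (P := fun T : Table n => Entry.Reaches (T _) _) _ _ _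
    (by omega) (fun T hT κ₁' _ => ?_) fun T => ?_
  · exact loopN_induction (P := fun T : Table n => Entry.Reaches (T _) _) _ _ _ hT
      fun T hT κ₂' _ => hstep κ₁' κ₂' _ _ T hT
  · refine loopN_reach (i := κ₂) (P := fun T : Table n => Entry.Reaches (T _) _) _ _ _
      (by omega) (fun T hT κ₂' _ => hstep κ₁ κ₂' _ _ T hT) fun T => ?_
    simp only [val_bind, val_step, hκ, decide_true, if_true, val_read, Table.improve_val]
    exact reaches_best_self _ _ (Entry.add_reaches ⟨_, rfl, le_rfl⟩ (Entry.add_reaches hx₁ hx₂))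

lemma stepTwo_val (ap₀ : Fin n → ℝ) (k : ℕ) (δ : ℝ) (M : ℕ)
    (v : Fin n) (T₁ T₂ : Table n) (b : Bool) (p p₁ p₂ : ℝ) (ci₁ ci₂ fi : ℕ) (T : Table n) :
    (stepTwo ap₀ k δ M v T₁ T₂ b p p₁ p₂ ci₁ ci₂ fi T).val =
      (improveTwo k b v T₁ T₂
        (gain (rounded δ M (roundIdx δ M
            (1 - (1 - rounded δ M ci₁ * p₁) * (1 - rounded δ M ci₂ * p₂))))
          (rounded δ M fi) p (ap₀ v)).val
        (roundIdx δ M (1 - (1 - rounded δ M ci₁ * p₁) * (1 - rounded δ M ci₂ * p₂))) ci₁ ci₂ fi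
        (roundIdx δ M (1 - (1 - rounded δ M fi * p) * (1 - rounded δ M ci₂ * p₂)))
        (roundIdx δ M (1 - (1 - rounded δ M fi * p) * (1 - rounded δ M ci₁ * p₁))) T).val := rfl

lemma nonseedTableTwo_all (I : TreeInstance n) (ap₀ : Fin n → ℝ) (k : ℕ) (δ : ℝ) (M : ℕ)
    (parent : Option (Fin n)) (v w₁ w₂ : Fin n) (T₁ T₂ : Table n)
    {Q : ℕ × ℕ × ℕ → ℝ × NodeSet n → Prop}
    (hQ : ∀ (b : Bool) (ci₁ ci₂ fi κ₁ κ₂ : ℕ) (p p₁ p₂ : ℝ) y₁ y₂,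
      p = (I.readParentProb b parent v).val →
      p₁ = (I.readProb b w₁ v).val → p₂ = (I.readProb b w₂ v).val →
      T₁ (κ₁, ci₁, roundIdx δ M (1 - (1 - rounded δ M fi * p) * (1 - rounded δ M ci₂ * p₂)))
        = some y₁ →
      T₂ (κ₂, ci₂, roundIdx δ M (1 - (1 - rounded δ M fi * p) * (1 - rounded δ M ci₁ * p₁)))
        = some y₂ →
      Q (κ₁ + κ₂ + b.toNat,
          roundIdx δ M (1 - (1 - rounded δ M ci₁ * p₁) * (1 - rounded δ M ci₂ * p₂)), fi)
        ((gain (rounded δ M (roundIdx δ M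
            (1 - (1 - rounded δ M ci₁ * p₁) * (1 - rounded δ M ci₂ * p₂))))
          (rounded δ M fi) p (ap₀ v)).val + (y₁.1 + y₂.1),
          NodeSet.union (boostNode b v) (NodeSet.union y₁.2 y₂.2))) :
    AllEntries Q (I.nonseedTableTwo ap₀ k δ M parent v w₁ w₂ T₁ T₂).val := by
  rw [nonseedTableTwo_eq, val_bind, val_bind]
  refine loop_induction _ _ _ (allEntries_none Q) fun T hT b _ => ?_
  refine loopN_induction _ _ _ hT fun T hT ci₁ _ => ?_
  refine loopN_induction _ _ _ hT fun T hT ci₂ _ => ?_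
  refine loopN_induction _ _ _ hT fun T hT fi _ => ?_
  rw [stepTwo_val]
  exact improveTwo_all _ _ _ _ _ _ _ _ _ _ _ _
    (fun κ₁ κ₂ y₁ y₂ h₁ h₂ => hQ b ci₁ ci₂ fi κ₁ κ₂ _ _ _ y₁ y₂ rfl rfl rfl h₁ h₂) hT

lemma nonseedTableTwo_reaches (I : TreeInstance n) (ap₀ : Fin n → ℝ) (k : ℕ) (δ : ℝ) (M : ℕ)
    (parent : Option (Fin n)) (v w₁ w₂ : Fin n) (T₁ T₂ : Table n) (b : Bool) {p p₁ p₂ : ℝ}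
    (hp : p = (I.readParentProb b parent v).val) (hp₁ : p₁ = (I.readProb b w₁ v).val)
    (hp₂ : p₂ = (I.readProb b w₂ v).val)
    {ci₁ ci₂ fi κ₁ κ₂ : ℕ} (hci₁ : ci₁ ≤ M) (hci₂ : ci₂ ≤ M) (hfi : fi ≤ M)
    (hκ : κ₁ + κ₂ + b.toNat ≤ k) {x₁ x₂ : ℝ}
    (hx₁ : (T₁ (κ₁, ci₁, roundIdx δ M
      (1 - (1 - rounded δ M fi * p) * (1 - rounded δ M ci₂ * p₂)))).Reaches x₁)
    (hx₂ : (T₂ (κ₂, ci₂, roundIdx δ M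
      (1 - (1 - rounded δ M fi * p) * (1 - rounded δ M ci₁ * p₁)))).Reaches x₂) :
    Entry.Reaches ((I.nonseedTableTwo ap₀ k δ M parent v w₁ w₂ T₁ T₂).val
      (κ₁ + κ₂ + b.toNat,
        roundIdx δ M (1 - (1 - rounded δ M ci₁ * p₁) * (1 - rounded δ M ci₂ * p₂)), fi))
      ((gain (rounded δ M (roundIdx δ M
            (1 - (1 - rounded δ M ci₁ * p₁) * (1 - rounded δ M ci₂ * p₂))))
          (rounded δ M fi) p (ap₀ v)).val + (x₁ + x₂)) := by
  subst hp hp₁ hp₂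
  rw [nonseedTableTwo_eq, val_bind, val_bind]
  refine loop_reach (a := b) (P := fun T : Table n => Entry.Reaches (T _) _) [false, true] _ _
    (by cases b <;> simp) (fun T hT b' _ => ?_) fun T => ?_
  · refine loopN_induction (P := fun T : Table n => Entry.Reaches (T _) _) _ _ _ hT
      fun T hT ci₁ _ => ?_
    refine loopN_induction (P := fun T : Table n => Entry.Reaches (T _) _) _ _ _ hT
      fun T hT ci₂ _ => ?_
    exact loopN_induction (P := fun T : Table n => Entry.Reaches (T _) _) _ _ _ hT
      fun T hT fi _ => improveTwo_mono _ _ _ _ _ _ _ _ _ _ _ _ hT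
  · refine loopN_reach (i := ci₁) (P := fun T : Table n => Entry.Reaches (T _) _) _ _ _
      (by omega) (fun T hT ci₁' _ => ?_) fun T => ?_
    · refine loopN_induction (P := fun T : Table n => Entry.Reaches (T _) _) _ _ _ hT
        fun T hT ci₂ _ => ?_
      exact loopN_induction (P := fun T : Table n => Entry.Reaches (T _) _) _ _ _ hT
        fun T hT fi _ => improveTwo_mono _ _ _ _ _ _ _ _ _ _ _ _ hT
    · refine loopN_reach (i := ci₂) (P := fun T : Table n => Entry.Reaches (T _) _) _ _ _
        (by omega) (fun T hT ci₂' _ => ?_) fun T => ?_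
      · exact loopN_induction (P := fun T : Table n => Entry.Reaches (T _) _) _ _ _ hT
          fun T hT fi _ => improveTwo_mono _ _ _ _ _ _ _ _ _ _ _ _ hT
      · refine loopN_reach (i := fi) (P := fun T : Table n => Entry.Reaches (T _) _) _ _ _
          (by omega) (fun T hT fi' _ => improveTwo_mono _ _ _ _ _ _ _ _ _ _ _ _ hT) fun T => ?_
        exact improveTwo_reaches _ _ _ _ _ _ _ _ _ _ _ _ _ hκ hx₁ hx₂

/-- The skipping loop collects the tables in the order of the adjacency list, which identifies the
cases of `tableOf` with the shapes of `kids`. -/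
lemma dpTable_succ_val (I : TreeInstance n) (ap₀ : Fin n → ℝ) (k : ℕ) (δ : ℝ) (M fuel : ℕ)
    (parent : Option (Fin n)) (v : Fin n) :
    (I.dpTable ap₀ k δ M (fuel + 1) parent v).val
      = (I.tableOf ap₀ k δ M parent v (decide (v ∈ I.seeds)) ((I.kids parent v).map fun w =>
        (w, (I.dpTable ap₀ k δ M fuel (some v) w).val))).val := by
  have hl : ∀ (l : List (Fin n)) (l₀ : List (Fin n × Table n)), (loop l l₀ fun l w => do
        let skip ← step (decide (parent = some w))
        if skip then pure l else
          let T ← call (I.dpTable ap₀ k δ M fuel (some v) w)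
          step (l ++ [(w, T)])).val = l₀ ++ (l.filter fun w => !decide (parent = some w)).map
            fun w => (w, (I.dpTable ap₀ k δ M fuel (some v) w).val) := by
    intro l
    induction l with
    | nil => intro l₀; simp [loop]
    | cons a l ih =>
      intro l₀
      rw [loop, val_bind, val_call]
      by_cases h : parent = some a
      · rw [ih]; simp [h]
      · rw [ih]; simp [h]
  rw [dpTable_succ, val_bind, hl, val_bind, List.nil_append, val_readSeed]
  rfl

end TreeInstance

end Boosting

namespace Boosting

open Prog

variable {n : ℕ}

namespace TreeInstance

/-! ### Activation probabilities around a node -/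

lemma nbrs_perm_toList (I : TreeInstance n) {parent : Option (Fin n)} {v : Fin n}
    (h : I.Borders parent v) : (I.nbrs v).Perm (parent.toList ++ I.kids parent v) := by
  cases parent with
  | none => simp [kids_none]
  | some u => simpa using I.nbrs_perm_cons (I.borders_some.1 h)

/-- The probability that the parent of `v` is activated from outside of the subtree of `v` and
activates `v`. -/
noncomputable def fromParent (I : TreeInstance n) (B : Finset (Fin n)) (parent : Option (Fin n))
    (v : Fin n) : ℝ :=
  match parent with
  | none => 0
  | some u => I.ap B (some v) u * I.edgeProb B u v

lemma borders_swap (I : TreeInstance n) {u v : Fin n} (h : I.Borders (some u) v) :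
    I.Borders (some v) u :=
  I.borders_some.2 (I.borders_some.1 h).symm

lemma fromParent_mem_Icc (I : TreeInstance n) (B : Finset (Fin n)) {parent : Option (Fin n)}
    {v : Fin n} (h : I.Borders parent v) :
    0 ≤ I.fromParent B parent v ∧ I.fromParent B parent v ≤ 1 := by
  cases parent with
  | none => simp [fromParent]
  | some u =>
    have h1 := I.ap_mem_Icc B (I.borders_swap h)
    exact ⟨mul_nonneg h1.1 (I.edgeProb_nonneg _ _ _),
      mul_le_one₀ h1.2 (I.edgeProb_nonneg _ _ _) (I.edgeProb_le_one _ _ _)⟩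

lemma prod_toList_parent (I : TreeInstance n) (B : Finset (Fin n)) (parent : Option (Fin n))
    (v : Fin n) :
    (parent.toList.map fun w => 1 - I.ap B (some v) w * I.edgeProb B w v).prod
      = 1 - I.fromParent B parent v := by
  cases parent <;> simp [fromParent]

/-- The neighbours of `v` are its children and its parent. Grouping the product accordingly gives
the exact counterpart of the expression in `gain`, with `ap B parent v` for `c` and `fromParent` for
`f * p`. -/
lemma ap_none_eq (I : TreeInstance n) (B : Finset (Fin n)) {parent : Option (Fin n)} {v : Fin n}
    (h : I.Borders parent v) :
    I.ap B none v = 1 - (1 - I.ap B parent v) * (1 - I.fromParent B parent v) := by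
  by_cases hs : v ∈ I.seeds
  · rw [I.ap_seed B (I.borders_none v) hs, I.ap_seed B h hs]
    ring
  · rw [I.ap_eq B (I.borders_none v), I.ap_eq B h, if_neg hs, if_neg hs, kids_none,
      ((I.nbrs_perm_toList h).map _).prod_eq, List.map_append, List.prod_append,
      prod_toList_parent]
    ring

lemma kids_kid_perm (I : TreeInstance n) {parent : Option (Fin n)} {v w : Fin n}
    (h : I.Borders parent v) (hw : w ∈ I.kids parent v) :
    (I.kids (some w) v).Perm
      (parent.toList ++ (I.kids parent v).filter fun x => decide (x ≠ w)) := by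
  refine (I.kids_perm (I.nbrs_perm_toList h)).trans (List.Perm.of_eq ?_)
  rw [List.filter_append]
  congr 1
  have := (I.mem_kids.1 hw).2
  cases parent with
  | none => rfl
  | some u =>
    have : u ≠ w := fun h => this (by rw [h])
    simp [this]

/-- What a child `w` sees above it: the parent of `v` and the siblings of `w`. This is the exact
counterpart of the value `f_i` passed down to `w`. -/
lemma ap_kid (I : TreeInstance n) (B : Finset (Fin n)) {parent : Option (Fin n)} {v w : Fin n}
    (h : I.Borders parent v) (hs : v ∉ I.seeds) (hw : w ∈ I.kids parent v) :
    I.ap B (some w) v = 1 - (1 - I.fromParent B parent v) *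
      (((I.kids parent v).filter fun x => decide (x ≠ w)).map fun x =>
        1 - I.ap B (some v) x * I.edgeProb B x v).prod := by
  rw [I.ap_eq B (I.borders_swap (I.borders_kid hw)), if_neg hs,
    ((I.kids_kid_perm h hw).map _).prod_eq, List.map_append, List.prod_append, prod_toList_parent]

lemma ap_one (I : TreeInstance n) (B : Finset (Fin n)) {parent : Option (Fin n)} {v w : Fin n}
    (h : I.Borders parent v) (hs : v ∉ I.seeds) (hk : I.kids parent v = [w]) :
    I.ap B parent v = I.ap B (some v) w * I.edgeProb B w v := by
  rw [I.ap_eq B h, if_neg hs, hk]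
  simp

lemma ap_one_kid (I : TreeInstance n) (B : Finset (Fin n)) {parent : Option (Fin n)} {v w : Fin n}
    (h : I.Borders parent v) (hs : v ∉ I.seeds) (hk : I.kids parent v = [w]) :
    I.ap B (some w) v = I.fromParent B parent v := by
  rw [I.ap_kid B h hs (w := w) (by simp [hk]), hk]
  simp

lemma ap_two (I : TreeInstance n) (B : Finset (Fin n)) {parent : Option (Fin n)} {v w₁ w₂ : Fin n}
    (h : I.Borders parent v) (hs : v ∉ I.seeds) (hk : I.kids parent v = [w₁, w₂]) :
    I.ap B parent v = 1 - (1 - I.ap B (some v) w₁ * I.edgeProb B w₁ v) *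
      (1 - I.ap B (some v) w₂ * I.edgeProb B w₂ v) := by
  rw [I.ap_eq B h, if_neg hs, hk]
  simp

lemma ne_of_kids_two (I : TreeInstance n) {parent : Option (Fin n)} {v w₁ w₂ : Fin n}
    (hk : I.kids parent v = [w₁, w₂]) : w₁ ≠ w₂ := by
  have := I.kids_nodup parent v
  rw [hk] at this
  simpa using this

lemma ap_two_kid₁ (I : TreeInstance n) (B : Finset (Fin n)) {parent : Option (Fin n)}
    {v w₁ w₂ : Fin n} (h : I.Borders parent v) (hs : v ∉ I.seeds)
    (hk : I.kids parent v = [w₁, w₂]) :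
    I.ap B (some w₁) v = 1 - (1 - I.fromParent B parent v) *
      (1 - I.ap B (some v) w₂ * I.edgeProb B w₂ v) := by
  rw [I.ap_kid B h hs (w := w₁) (by simp [hk]), hk]
  simp [(I.ne_of_kids_two hk).symm]

lemma ap_two_kid₂ (I : TreeInstance n) (B : Finset (Fin n)) {parent : Option (Fin n)}
    {v w₁ w₂ : Fin n} (h : I.Borders parent v) (hs : v ∉ I.seeds)
    (hk : I.kids parent v = [w₁, w₂]) :
    I.ap B (some w₂) v = 1 - (1 - I.fromParent B parent v) *
      (1 - I.ap B (some v) w₁ * I.edgeProb B w₁ v) := by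
  rw [I.ap_kid B h hs (w := w₂) (by simp [hk]), hk]
  simp [I.ne_of_kids_two hk]

lemma side_of_kids_nil (I : TreeInstance n) {parent : Option (Fin n)} {v : Fin n}
    (h : I.Borders parent v) (hk : I.kids parent v = []) : I.side parent v = {v} := by
  simp [I.side_eq h, hk]

/-- The increase of the activation probability of `v` when `B` is boosted. -/
noncomputable def nodeBoost (I : TreeInstance n) (B : Finset (Fin n)) (v : Fin n) : ℝ :=
  I.ap B none v - I.ap ∅ none v

lemma nodeBoost_nonneg (I : TreeInstance n) (B : Finset (Fin n)) (v : Fin n) :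
    0 ≤ I.nodeBoost B v :=
  sub_nonneg.2 (I.ap_mono (Finset.empty_subset B) (I.borders_none v))

lemma nodeBoost_seed (I : TreeInstance n) (B : Finset (Fin n)) {v : Fin n} (hs : v ∈ I.seeds) :
    I.nodeBoost B v = 0 := by
  rw [nodeBoost, I.ap_seed B (I.borders_none v) hs, I.ap_seed ∅ (I.borders_none v) hs, sub_self]

lemma gain_val (c f p a₀ : ℝ) : (gain c f p a₀).val = max (1 - (1 - c) * (1 - f * p) - a₀) 0 := rfl

/-- Underestimates of both arguments give an underestimate of the activation probability, and the
truncation at `0` is harmless because boosting never lowers that probability. -/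
lemma gain_le (I : TreeInstance n) (B : Finset (Fin n)) {parent : Option (Fin n)} {v : Fin n}
    (h : I.Borders parent v) {c f p : ℝ} (hc : c ≤ I.ap B parent v)
    (hf : f * p ≤ I.fromParent B parent v) :
    (gain c f p (I.ap ∅ none v)).val ≤ I.nodeBoost B v := by
  rw [gain_val]
  refine max_le ?_ (I.nodeBoost_nonneg B v)
  rw [nodeBoost, I.ap_none_eq B h]
  have h1 := (I.ap_mem_Icc B h).2
  have h2 := (I.fromParent_mem_Icc B h).2
  nlinarith

lemma readParentProb_mem_Icc (I : TreeInstance n) (b : Bool) {parent : Option (Fin n)} {v : Fin n}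
    (h : I.Borders parent v) :
    0 ≤ (I.readParentProb b parent v).val ∧ (I.readParentProb b parent v).val ≤ 1 := by
  cases parent with
  | none => simp [readParentProb]
  | some u =>
    have ha := I.borders_some.1 h
    have h1 := I.prob_nonneg u v ha
    have h2 := I.prob_le_probBoost u v ha
    have h3 := I.probBoost_le_one u v ha
    cases b
    · exact ⟨h1, h2.trans h3⟩
    · exact ⟨h1.trans h2, h3⟩

lemma readProb_eq (I : TreeInstance n) (B : Finset (Fin n)) {b : Bool} {u v : Fin n}
    (h : I.graph.Adj u v) (hb : v ∈ B ↔ b = true) :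
    (I.readProb b u v).val = I.edgeProb B u v := by
  rw [← I.readProb_eq_edgeProb B h]
  congr 2
  cases b <;> simpa using hb

lemma mul_readParentProb_le (I : TreeInstance n) (B : Finset (Fin n)) {b : Bool}
    {parent : Option (Fin n)} {v : Fin n} (h : I.Borders parent v) (hb : v ∈ B ↔ b = true) {f : ℝ}
    (hf : ∀ u, parent = some u → f ≤ I.ap B (some v) u) :
    f * (I.readParentProb b parent v).val ≤ I.fromParent B parent v := by
  cases parent with
  | none => simp [readParentProb, fromParent]
  | some u =>
    rw [readParentProb, I.readProb_eq B (I.borders_some.1 h) hb]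
    exact mul_le_mul_of_nonneg_right (hf u rfl) (I.edgeProb_nonneg _ _ _)

lemma boostNode_support (b : Bool) (v : Fin n) :
    (boostNode b v).support = if b then {v} else ∅ := by
  cases b <;> rfl

lemma boostNode_size (b : Bool) (v : Fin n) : (boostNode b v).size = 1 := by
  cases b <;> rfl

lemma card_boostNode (b : Bool) (v : Fin n) : (boostNode b v).support.card = b.toNat := by
  cases b <;> simp [boostNode_support]

lemma boostNode_subset (b : Bool) (v : Fin n) : (boostNode b v).support ⊆ {v} := by
  cases b <;> simp [boostNode_support]

/-! ### Values of the dynamic program are attained -/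

/-- The value of a table entry of `v` is at most the boost that its node set achieves in the
subtree of `v`. -/
structure SoundEntry (I : TreeInstance n) (δ : ℝ) (M : ℕ) (parent : Option (Fin n)) (v : Fin n)
    (i : ℕ × ℕ × ℕ) (y : ℝ × NodeSet n) : Prop where
  card_le : y.2.support.card ≤ i.1
  subset : y.2.support ⊆ I.side parent v
  size_le : y.2.size ≤ 3 * (I.side parent v).card
  rounded_le : ∀ B : Finset (Fin n), (∀ w ∈ I.side parent v, w ∈ B ↔ w ∈ y.2.support) →
    rounded δ M i.2.1 ≤ I.ap B parent v
  value_le : ∀ B : Finset (Fin n), (∀ w ∈ I.side parent v, w ∈ B ↔ w ∈ y.2.support) →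
    (∀ u, parent = some u → rounded δ M i.2.2 ≤ I.ap B (some v) u) →
    y.1 ≤ ∑ w ∈ I.side parent v, I.nodeBoost B w

section Sound

variable {I : TreeInstance n} {δ : ℝ} {M : ℕ} {parent : Option (Fin n)} {v : Fin n}

lemma leafTable_sound (hδ : IsRounding δ M) (h : I.Borders parent v)
    (hk : I.kids parent v = []) (k : ℕ) :
    AllEntries (I.SoundEntry δ M parent v)
      (I.leafTable (fun v => I.ap ∅ none v) k δ M parent v).val := by
  refine I.leafTable_all _ k δ M parent v fun κ fi => ?_
  have hside := I.side_of_kids_nil h hk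
  have hap : ∀ B, I.ap B parent v = rounded δ M (if v ∈ I.seeds then M else 0) := by
    intro B
    rw [I.ap_eq B h, hk]
    split_ifs
    · exact IsRounding.rounded_self.symm
    · simp [hδ.rounded_zero]
  constructor
  · rw [card_boostNode]
    by_cases hκ : 0 < κ <;> simp [hκ]
    omega
  · rw [hside]
    exact boostNode_subset _ v
  · rw [boostNode_size, hside]
    simp
  · exact fun B _ => (hap B).ge
  · intro B hB hf
    rw [hside, Finset.sum_singleton]
    -- A leaf is boosted as soon as its budget is positive. A larger budget is wasted, so the size
    -- of the node set is only bounded by `κ`.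
    have hb : v ∈ B ↔ decide (0 < κ) = true := by
      rw [hB v (by simp [hside]), boostNode_support]
      split_ifs with h <;> simp [h]
    exact I.gain_le B h (hap B).ge (I.mul_readParentProb_le B h hb hf)

/-- A seed decouples what is above it from what is below: the child sees probability exactly `1`,
which is the rounded value with index `M`, and the seed itself gains nothing. -/
lemma seedTableOne_sound {w : Fin n} {T₁ : Table n} (h : I.Borders parent v)
    (hs : v ∈ I.seeds) (hk : I.kids parent v = [w])
    (h₁ : AllEntries (I.SoundEntry δ M (some v) w) T₁) (k : ℕ) :
    AllEntries (I.SoundEntry δ M parent v) (seedTableOne k M T₁).val := by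
  have hw : w ∈ I.kids parent v := by simp [hk]
  refine seedTable_all k M _ fun κ fi y hy => ?_
  obtain ⟨ci, hy⟩ : ∃ ci, T₁ (κ, ci, M) = some y :=
    bestBelowSeed_all k M T₁ (Q := fun κ y => ∃ ci, T₁ (κ, ci, M) = some y)
      (fun κ ci y h => ⟨ci, h⟩) κ y hy
  have e := h₁ _ _ hy
  have hsub := I.side_subset h hw
  constructor
  · exact e.card_le
  · exact e.subset.trans hsub
  · exact e.size_le.trans (Nat.mul_le_mul_left 3 (Finset.card_le_card hsub))
  · intro B _
    rw [I.ap_seed B h hs]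
    exact IsRounding.rounded_self.le
  · intro B hB _
    have := e.value_le B (fun x hx => hB x (hsub hx)) (by
      intro u hu
      obtain rfl := Option.some.inj hu
      rw [I.ap_seed B (I.borders_swap (I.borders_kid hw)) hs]
      exact IsRounding.rounded_self.le)
    rw [I.sum_side h, hk, I.nodeBoost_seed B hs]
    simpa using this

lemma not_mem_of_subset_side {w : Fin n} {s : Finset (Fin n)} (h : s ⊆ I.side (some v) w) :
    v ∉ s :=
  fun hv => I.not_mem_side_some v w (h hv)

lemma seedTableTwo_sound {w₁ w₂ : Fin n} {T₁ T₂ : Table n}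
    (h : I.Borders parent v) (hs : v ∈ I.seeds) (hk : I.kids parent v = [w₁, w₂])
    (h₁ : AllEntries (I.SoundEntry δ M (some v) w₁) T₁)
    (h₂ : AllEntries (I.SoundEntry δ M (some v) w₂) T₂) (k : ℕ) :
    AllEntries (I.SoundEntry δ M parent v) (seedTableTwo k M T₁ T₂).val := by
  have hw₁ : w₁ ∈ I.kids parent v := by simp [hk]
  have hw₂ : w₂ ∈ I.kids parent v := by simp [hk]
  rw [seedTableTwo_val]
  refine seedTable_all k M _ fun κ fi y hy => ?_
  obtain ⟨κ₁, κ₂, ci₁, ci₂, y₁, y₂, hy₁, hy₂, rfl, rfl⟩ : ∃ κ₁ κ₂ ci₁ ci₂ y₁ y₂,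
      T₁ (κ₁, ci₁, M) = some y₁ ∧ T₂ (κ₂, ci₂, M) = some y₂ ∧ κ = κ₁ + κ₂ ∧
        y = (y₁.1 + y₂.1, NodeSet.union y₁.2 y₂.2) := by
    refine combineBelowSeed_all k _ _ (Q := fun κ y => ∃ κ₁ κ₂ ci₁ ci₂ y₁ y₂,
      T₁ (κ₁, ci₁, M) = some y₁ ∧ T₂ (κ₂, ci₂, M) = some y₂ ∧ κ = κ₁ + κ₂ ∧
        y = (y₁.1 + y₂.1, NodeSet.union y₁.2 y₂.2)) (fun κ₁ κ₂ y₁ y₂ hy₁ hy₂ => ?_) κ y hy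
    obtain ⟨ci₁, hy₁⟩ := bestBelowSeed_all k M T₁ (Q := fun κ y => ∃ ci, T₁ (κ, ci, M) = some y)
      (fun κ ci y h => ⟨ci, h⟩) κ₁ y₁ hy₁
    obtain ⟨ci₂, hy₂⟩ := bestBelowSeed_all k M T₂ (Q := fun κ y => ∃ ci, T₂ (κ, ci, M) = some y)
      (fun κ ci y h => ⟨ci, h⟩) κ₂ y₂ hy₂
    exact ⟨κ₁, κ₂, ci₁, ci₂, y₁, y₂, hy₁, hy₂, rfl, rfl⟩
  have e₁ := h₁ _ _ hy₁
  have e₂ := h₂ _ _ hy₂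
  have hsub₁ := I.side_subset h hw₁
  have hsub₂ := I.side_subset h hw₂
  have hdis := I.side_disjoint (I.mem_kids.1 hw₁).1 (I.mem_kids.1 hw₂).1 (I.ne_of_kids_two hk)
  constructor
  · exact (Finset.card_union_le _ _).trans (Nat.add_le_add e₁.card_le e₂.card_le)
  · exact Finset.union_subset (e₁.subset.trans hsub₁) (e₂.subset.trans hsub₂)
  · have s₁ := e₁.size_le
    have s₂ := e₂.size_le
    rw [I.card_side h, hk]
    simp [NodeSet.size]
    omega
  · intro B _
    rw [I.ap_seed B h hs]
    exact IsRounding.rounded_self.le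
  · intro B hB _
    have hf : ∀ w ∈ I.kids parent v, ∀ u, some v = some u → rounded δ M M ≤ I.ap B (some w) u := by
      intro w hw u hu
      obtain rfl := Option.some.inj hu
      rw [I.ap_seed B (I.borders_swap (I.borders_kid hw)) hs]
      exact IsRounding.rounded_self.le
    have g₁ := e₁.value_le B (fun x hx => by
      rw [hB x (hsub₁ hx), NodeSet.support, Finset.mem_union]
      exact or_iff_left fun h => (Finset.disjoint_left.1 hdis hx) (e₂.subset h)) (hf w₁ hw₁)
    have g₂ := e₂.value_le B (fun x hx => by
      rw [hB x (hsub₂ hx), NodeSet.support, Finset.mem_union]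
      exact or_iff_right fun h => (Finset.disjoint_left.1 hdis (e₁.subset h)) hx) (hf w₂ hw₂)
    rw [I.sum_side h, hk, I.nodeBoost_seed B hs]
    simpa using add_le_add g₁ g₂

lemma nonseedTableOne_sound {w : Fin n} {T₁ : Table n} (hδ : IsRounding δ M)
    (h : I.Borders parent v) (hs : v ∉ I.seeds) (hk : I.kids parent v = [w])
    (h₁ : AllEntries (I.SoundEntry δ M (some v) w) T₁) (k : ℕ) :
    AllEntries (I.SoundEntry δ M parent v)
      (I.nonseedTableOne (fun v => I.ap ∅ none v) k δ M parent v w T₁).val := by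
  have hw : w ∈ I.kids parent v := by simp [hk]
  have hsub := I.side_subset h hw
  have hadj := (I.mem_kids.1 hw).1.symm
  refine I.nonseedTableOne_all _ k δ M parent v w T₁ ?_
  rintro b ci₁ fi κ₁ p p₁ y₁ hp hp₁ hy₁
  have e₁ := h₁ _ _ hy₁
  have hv₁ := not_mem_of_subset_side e₁.subset
  have hp0 : 0 ≤ p ∧ p ≤ 1 := hp ▸ I.readParentProb_mem_Icc b h
  -- The stored set is a disjoint union, so agreement with it on the subtree splits into the
  -- decision at `v` and agreement on the branch.
  have hB₁ : ∀ B : Finset (Fin n), (∀ x ∈ I.side parent v, x ∈ B ↔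
      x ∈ (NodeSet.union (boostNode b v) y₁.2).support) →
      (v ∈ B ↔ b = true) ∧ ∀ x ∈ I.side (some v) w, x ∈ B ↔ x ∈ y₁.2.support := by
    intro B hB
    constructor
    · rw [hB v (I.self_mem_side h), NodeSet.support, Finset.mem_union, boostNode_support]
      cases b <;> simp [hv₁]
    · intro x hx
      rw [hB x (hsub hx), NodeSet.support, Finset.mem_union]
      refine or_iff_right fun hx' => ?_
      obtain rfl := Finset.mem_singleton.1 (boostNode_subset b v hx')
      exact I.not_mem_side_some _ _ hx
  have hc : ∀ B : Finset (Fin n), (∀ x ∈ I.side parent v, x ∈ B ↔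
      x ∈ (NodeSet.union (boostNode b v) y₁.2).support) →
      rounded δ M (roundIdx δ M (rounded δ M ci₁ * p₁)) ≤ I.ap B parent v := by
    intro B hB
    obtain ⟨hb, hB₁⟩ := hB₁ B hB
    have hp₁ : p₁ = I.edgeProb B w v := by rw [hp₁, I.readProb_eq B hadj hb]
    have hp₁0 := I.edgeProb_nonneg B w v
    rw [← hp₁] at hp₁0
    refine (hδ.rounded_roundIdx_le (mul_nonneg (hδ.rounded_nonneg _) hp₁0)).trans ?_
    rw [I.ap_one B h hs hk, ← hp₁]
    exact mul_le_mul_of_nonneg_right (e₁.rounded_le B hB₁) hp₁0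
  constructor
  · refine (Finset.card_union_le _ _).trans ?_
    rw [card_boostNode, add_comm]
    exact Nat.add_le_add_right e₁.card_le _
  · refine Finset.union_subset ((boostNode_subset b v).trans ?_) (e₁.subset.trans hsub)
    simpa using I.self_mem_side h
  · have s₁ := e₁.size_le
    rw [I.card_side h, hk]
    simp [NodeSet.size, boostNode_size]
    omega
  · exact hc
  · intro B hB hf
    obtain ⟨hb, hB₁⟩ := hB₁ B hB
    have hfp : rounded δ M fi * p ≤ I.fromParent B parent v :=
      hp ▸ I.mul_readParentProb_le B h hb hf
    have g₁ := e₁.value_le B hB₁ (by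
      intro u hu
      obtain rfl := Option.some.inj hu
      rw [I.ap_one_kid B h hs hk]
      exact (hδ.rounded_roundIdx_le (mul_nonneg (hδ.rounded_nonneg _) hp0.1)).trans hfp)
    rw [I.sum_side h, hk]
    simpa using add_le_add (I.gain_le B h (hc B hB) hfp) g₁

/-! ### Combining two independent activation probabilities -/

lemma one_sub_mul_one_sub_mono {x y x' y' : ℝ} (hx : x ≤ x') (hy : y ≤ y') (hx' : x' ≤ 1)
    (hy' : y' ≤ 1) : 1 - (1 - x) * (1 - y) ≤ 1 - (1 - x') * (1 - y') := by
  nlinarith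

lemma one_sub_mul_one_sub_mem_Icc {x y : ℝ} (hx : 0 ≤ x ∧ x ≤ 1) (hy : 0 ≤ y ∧ y ≤ 1) :
    0 ≤ 1 - (1 - x) * (1 - y) ∧ 1 - (1 - x) * (1 - y) ≤ 1 := by
  constructor <;> nlinarith [hx.1, hx.2, hy.1, hy.2]

lemma mul_mem_Icc {x y : ℝ} (hx : 0 ≤ x ∧ x ≤ 1) (hy : 0 ≤ y ∧ y ≤ 1) :
    0 ≤ x * y ∧ x * y ≤ 1 :=
  ⟨mul_nonneg hx.1 hy.1, mul_le_one₀ hx.2 hy.1 hy.2⟩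

lemma readProb_mem_Icc (I : TreeInstance n) (b : Bool) {u v : Fin n} (h : I.graph.Adj u v) :
    0 ≤ (I.readProb b u v).val ∧ (I.readProb b u v).val ≤ 1 :=
  I.readParentProb_mem_Icc b (I.borders_some.2 h)

/-- Monotonicity passes underestimates upwards, from both children to `c`, and downwards, from the
parent and the sibling to `f₁` and `f₂`; rounding down keeps them underestimates. -/
lemma nonseedTableTwo_sound {w₁ w₂ : Fin n} {T₁ T₂ : Table n} (hδ : IsRounding δ M)
    (h : I.Borders parent v) (hs : v ∉ I.seeds) (hk : I.kids parent v = [w₁, w₂])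
    (h₁ : AllEntries (I.SoundEntry δ M (some v) w₁) T₁)
    (h₂ : AllEntries (I.SoundEntry δ M (some v) w₂) T₂) (k : ℕ) :
    AllEntries (I.SoundEntry δ M parent v)
      (I.nonseedTableTwo (fun v => I.ap ∅ none v) k δ M parent v w₁ w₂ T₁ T₂).val := by
  have hw₁ : w₁ ∈ I.kids parent v := by simp [hk]
  have hw₂ : w₂ ∈ I.kids parent v := by simp [hk]
  have hsub₁ := I.side_subset h hw₁
  have hsub₂ := I.side_subset h hw₂
  have hadj₁ := (I.mem_kids.1 hw₁).1.symm
  have hadj₂ := (I.mem_kids.1 hw₂).1.symm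
  have hdis := I.side_disjoint hadj₁.symm hadj₂.symm (I.ne_of_kids_two hk)
  refine I.nonseedTableTwo_all _ k δ M parent v w₁ w₂ T₁ T₂ ?_
  rintro b ci₁ ci₂ fi κ₁ κ₂ p p₁ p₂ y₁ y₂ hp hp₁ hp₂ hy₁ hy₂
  have e₁ := h₁ _ _ hy₁
  have e₂ := h₂ _ _ hy₂
  have hv₁ := not_mem_of_subset_side e₁.subset
  have hv₂ := not_mem_of_subset_side e₂.subset
  have hp0 : 0 ≤ p ∧ p ≤ 1 := hp ▸ I.readParentProb_mem_Icc b h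
  have hp₁0 : 0 ≤ p₁ ∧ p₁ ≤ 1 := hp₁ ▸ readProb_mem_Icc I b hadj₁
  have hp₂0 : 0 ≤ p₂ ∧ p₂ ≤ 1 := hp₂ ▸ readProb_mem_Icc I b hadj₂
  have hfp0 := mul_mem_Icc (hδ.rounded_mem_Icc fi) hp0
  have hcp₁0 := mul_mem_Icc (hδ.rounded_mem_Icc ci₁) hp₁0
  have hcp₂0 := mul_mem_Icc (hδ.rounded_mem_Icc ci₂) hp₂0
  have hB₁ : ∀ B : Finset (Fin n), (∀ x ∈ I.side parent v, x ∈ B ↔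
      x ∈ (NodeSet.union (boostNode b v) (NodeSet.union y₁.2 y₂.2)).support) →
      (v ∈ B ↔ b = true) ∧ (∀ x ∈ I.side (some v) w₁, x ∈ B ↔ x ∈ y₁.2.support) ∧
      ∀ x ∈ I.side (some v) w₂, x ∈ B ↔ x ∈ y₂.2.support := by
    intro B hB
    refine ⟨?_, ?_, ?_⟩
    · rw [hB v (I.self_mem_side h)]
      simp only [NodeSet.support, Finset.mem_union, boostNode_support]
      cases b <;> simp [hv₁, hv₂]
    · intro x hx
      have hxv : x ∉ (boostNode b v).support := fun hx' => by
        obtain rfl := Finset.mem_singleton.1 (boostNode_subset b v hx')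
        exact I.not_mem_side_some _ _ hx
      have hx₂ : x ∉ y₂.2.support := fun h => Finset.disjoint_left.1 hdis hx (e₂.subset h)
      rw [hB x (hsub₁ hx)]
      simp [NodeSet.support, hxv, hx₂]
    · intro x hx
      have hxv : x ∉ (boostNode b v).support := fun hx' => by
        obtain rfl := Finset.mem_singleton.1 (boostNode_subset b v hx')
        exact I.not_mem_side_some _ _ hx
      have hx₁ : x ∉ y₁.2.support := fun h => Finset.disjoint_left.1 hdis (e₁.subset h) hx
      rw [hB x (hsub₂ hx)]
      simp [NodeSet.support, hxv, hx₁]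
  -- The upper bounds by `1` are carried along because `1 - (1 - x)(1 - y)` is monotone only on that
  -- range.
  have hcp : ∀ B : Finset (Fin n), (∀ x ∈ I.side parent v, x ∈ B ↔
      x ∈ (NodeSet.union (boostNode b v) (NodeSet.union y₁.2 y₂.2)).support) →
      (rounded δ M ci₁ * p₁ ≤ I.ap B (some v) w₁ * I.edgeProb B w₁ v ∧
        I.ap B (some v) w₁ * I.edgeProb B w₁ v ≤ 1) ∧
      (rounded δ M ci₂ * p₂ ≤ I.ap B (some v) w₂ * I.edgeProb B w₂ v ∧
        I.ap B (some v) w₂ * I.edgeProb B w₂ v ≤ 1) := by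
    intro B hB
    obtain ⟨hb, hB₁, hB₂⟩ := hB₁ B hB
    have a₁ := (I.ap_mem_Icc B (I.borders_kid hw₁)).2
    have a₂ := (I.ap_mem_Icc B (I.borders_kid hw₂)).2
    have hp₁' : p₁ = I.edgeProb B w₁ v := by rw [hp₁, I.readProb_eq B hadj₁ hb]
    have hp₂' : p₂ = I.edgeProb B w₂ v := by rw [hp₂, I.readProb_eq B hadj₂ hb]
    rw [← hp₁', ← hp₂']
    exact ⟨⟨mul_le_mul_of_nonneg_right (e₁.rounded_le B hB₁) hp₁0.1,
      mul_le_one₀ a₁ hp₁0.1 hp₁0.2⟩, mul_le_mul_of_nonneg_right (e₂.rounded_le B hB₂) hp₂0.1,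
      mul_le_one₀ a₂ hp₂0.1 hp₂0.2⟩
  have hc : ∀ B : Finset (Fin n), (∀ x ∈ I.side parent v, x ∈ B ↔
      x ∈ (NodeSet.union (boostNode b v) (NodeSet.union y₁.2 y₂.2)).support) →
      rounded δ M (roundIdx δ M (1 - (1 - rounded δ M ci₁ * p₁) * (1 - rounded δ M ci₂ * p₂)))
        ≤ I.ap B parent v := by
    intro B hB
    obtain ⟨c₁, c₂⟩ := hcp B hB
    refine (hδ.rounded_roundIdx_le (one_sub_mul_one_sub_mem_Icc hcp₁0 hcp₂0).1).trans ?_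
    rw [I.ap_two B h hs hk]
    exact one_sub_mul_one_sub_mono c₁.1 c₂.1 c₁.2 c₂.2
  constructor
  · refine (Finset.card_union_le _ _).trans ?_
    rw [card_boostNode, add_comm]
    exact Nat.add_le_add_right
      ((Finset.card_union_le _ _).trans (Nat.add_le_add e₁.card_le e₂.card_le)) _
  · refine Finset.union_subset ((boostNode_subset b v).trans ?_)
      (Finset.union_subset (e₁.subset.trans hsub₁) (e₂.subset.trans hsub₂))
    simpa using I.self_mem_side h
  · have s₁ := e₁.size_le
    have s₂ := e₂.size_le
    rw [I.card_side h, hk]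
    simp [NodeSet.size, boostNode_size]
    omega
  · exact hc
  · intro B hB hf
    obtain ⟨hb, hB₁, hB₂⟩ := hB₁ B hB
    obtain ⟨c₁, c₂⟩ := hcp B hB
    have hfp : rounded δ M fi * p ≤ I.fromParent B parent v :=
      hp ▸ I.mul_readParentProb_le B h hb hf
    have hfp1 := (I.fromParent_mem_Icc B h).2
    have g₁ := e₁.value_le B hB₁ (by
      intro u hu
      obtain rfl := Option.some.inj hu
      rw [I.ap_two_kid₁ B h hs hk]
      exact (hδ.rounded_roundIdx_le (one_sub_mul_one_sub_mem_Icc hfp0 hcp₂0).1).trans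
        (one_sub_mul_one_sub_mono hfp c₂.1 hfp1 c₂.2))
    have g₂ := e₂.value_le B hB₂ (by
      intro u hu
      obtain rfl := Option.some.inj hu
      rw [I.ap_two_kid₂ B h hs hk]
      exact (hδ.rounded_roundIdx_le (one_sub_mul_one_sub_mem_Icc hfp0 hcp₁0).1).trans
        (one_sub_mul_one_sub_mono hfp c₁.1 hfp1 c₁.2))
    rw [I.sum_side h, hk]
    simpa using add_le_add (I.gain_le B h (hc B hB) hfp) (add_le_add g₁ g₂)

lemma dpTable_sound (hI : ∀ v, (I.children v).card ≤ 2) (hδ : IsRounding δ M) (k fuel : ℕ)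
    (h : I.Toward I.root parent v) (hf : (I.side parent v).card ≤ fuel) :
    AllEntries (I.SoundEntry δ M parent v)
      (I.dpTable (fun v => I.ap ∅ none v) k δ M fuel parent v).val := by
  refine I.side_induction (P := fun fuel parent v => I.Toward I.root parent v →
    AllEntries (I.SoundEntry δ M parent v)
      (I.dpTable (fun v => I.ap ∅ none v) k δ M fuel parent v).val) ?_ fuel parent v h.borders hf h
  intro fuel parent v hb _ ih h
  have hlen := h.length_kids_le hI
  have ih' := fun w hw => ih w hw (h.kid hw)
  rw [dpTable_succ_val]
  match hk : I.kids parent v, hlen with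
  | [], _ => exact leafTable_sound hδ hb hk k
  | [w], _ =>
    rw [hk] at ih'
    have h₁ := ih' w (by simp)
    by_cases hs : v ∈ I.seeds
    · simpa [tableOf, hs] using seedTableOne_sound hb hs hk h₁ k
    · simpa [tableOf, hs] using nonseedTableOne_sound hδ hb hs hk h₁ k
  | [w₁, w₂], _ =>
    rw [hk] at ih'
    have h₁ := ih' w₁ (by simp)
    have h₂ := ih' w₂ (by simp)
    by_cases hs : v ∈ I.seeds
    · simpa [tableOf, hs] using seedTableTwo_sound hb hs hk h₁ h₂ k
    · simpa [tableOf, hs] using nonseedTableTwo_sound hδ hb hs hk h₁ h₂ k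
  | _ :: _ :: _ :: _, hl => simp at hl

end Sound

end TreeInstance

end Boosting

namespace Boosting

open Prog

variable {n : ℕ}

lemma Entry.Reaches.mono {e : Entry n} {x y : ℝ} (h : e.Reaches x) (hxy : y ≤ x) :
    e.Reaches y := by
  obtain ⟨z, hz, hx⟩ := h
  exact ⟨z, hz, hxy.trans hx⟩

namespace TreeInstance

/-! ### Loss by rounding -/

/-- The contribution of the parent of `v` to `pathSum B none v`. -/
noncomputable def sumParent (I : TreeInstance n) (B : Finset (Fin n)) (parent : Option (Fin n))
    (v : Fin n) : ℝ :=
  match parent with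
  | none => 0
  | some u => I.pathSum B (some v) u * I.edgeProb B u v

lemma sumParent_nonneg (I : TreeInstance n) (B : Finset (Fin n)) (parent : Option (Fin n))
    (v : Fin n) : 0 ≤ I.sumParent B parent v := by
  cases parent with
  | none => exact le_rfl
  | some u => exact mul_nonneg (I.pathSum_nonneg _ _ _) (I.edgeProb_nonneg _ _ _)

lemma sum_toList_parent (I : TreeInstance n) (B : Finset (Fin n)) (parent : Option (Fin n))
    (v : Fin n) :
    (parent.toList.map fun w => I.pathSum B (some v) w * I.edgeProb B w v).sum
      = I.sumParent B parent v := by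
  cases parent <;> simp [sumParent]

lemma pathSum_none_eq (I : TreeInstance n) (B : Finset (Fin n)) {parent : Option (Fin n)}
    {v : Fin n} (h : I.Borders parent v) :
    I.pathSum B none v = I.pathSum B parent v + I.sumParent B parent v := by
  rw [I.pathSum_eq B (I.borders_none v), I.pathSum_eq B h, kids_none,
    ((I.nbrs_perm_toList h).map _).sum_eq, List.map_append, List.sum_append, sum_toList_parent]
  ring

lemma pathSum_kid (I : TreeInstance n) (B : Finset (Fin n)) {parent : Option (Fin n)} {v w : Fin n}
    (h : I.Borders parent v) (hw : w ∈ I.kids parent v) :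
    I.pathSum B (some w) v = 1 + (I.sumParent B parent v +
      (((I.kids parent v).filter fun x => decide (x ≠ w)).map fun x =>
        I.pathSum B (some v) x * I.edgeProb B x v).sum) := by
  rw [I.pathSum_eq B (I.borders_swap (I.borders_kid hw)),
    ((I.kids_kid_perm h hw).map _).sum_eq, List.map_append, List.sum_append, sum_toList_parent]

/-- Replacing `x'` by `x` at fixed `y` costs at most `d * (1 - y)`, and replacing `y'` by `y` at
fixed `x'` costs at most `e * (1 - x')`. So losses add up and are not amplified. -/
lemma one_sub_mul_one_sub_loss {x y x' y' d e : ℝ} (hy : 0 ≤ y) (hy1 : y ≤ 1)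
    (hx' : 0 ≤ x' ∧ x' ≤ 1) (hd : 0 ≤ d) (he : 0 ≤ e) (h₁ : x' - d ≤ x) (h₂ : y' - e ≤ y) :
    1 - (1 - x') * (1 - y') - (d + e) ≤ 1 - (1 - x) * (1 - y) := by
  nlinarith [mul_nonneg (sub_nonneg.2 h₁) (sub_nonneg.2 hy1), mul_nonneg hd hy,
    mul_nonneg (sub_nonneg.2 hx'.2) (sub_nonneg.2 h₂), mul_nonneg hx'.1 he]

/-- The losses from below and from above add up to the loss of all paths to `v`, which is `pathSum B
none v`. No rounding is applied to the gain itself. -/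
lemma le_gain (I : TreeInstance n) (B : Finset (Fin n)) {parent : Option (Fin n)} {v : Fin n}
    (h : I.Borders parent v) {δ c f p : ℝ} (hδ : 0 ≤ δ)
    (hf0 : 0 ≤ f * p ∧ f * p ≤ 1)
    (hc : I.ap B parent v - δ * I.pathSum B parent v ≤ c)
    (hf : I.fromParent B parent v - δ * I.sumParent B parent v ≤ f * p) :
    I.nodeBoost B v - δ * I.pathSum B none v ≤ (gain c f p (I.ap ∅ none v)).val := by
  rw [gain_val]
  refine le_max_of_le_left ?_
  rw [nodeBoost, I.ap_none_eq B h, I.pathSum_none_eq B h]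
  have := one_sub_mul_one_sub_loss hf0.1 hf0.2 (I.ap_mem_Icc B h)
    (mul_nonneg hδ (I.pathSum_nonneg B parent v)) (mul_nonneg hδ (I.sumParent_nonneg B parent v))
    hc hf
  linarith

lemma le_mul_readParentProb (I : TreeInstance n) (B : Finset (Fin n)) {b : Bool}
    {parent : Option (Fin n)} {v : Fin n} (h : I.Borders parent v) (hb : v ∈ B ↔ b = true)
    {δ f : ℝ} (hf : ∀ u, parent = some u → I.ap B (some v) u - δ * I.pathSum B (some v) u ≤ f) :
    I.fromParent B parent v - δ * I.sumParent B parent v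
      ≤ f * (I.readParentProb b parent v).val := by
  cases parent with
  | none => simp [readParentProb, fromParent, sumParent]
  | some u =>
    rw [readParentProb, I.readProb_eq B (I.borders_some.1 h) hb, fromParent, sumParent]
    have := mul_le_mul_of_nonneg_right (hf u rfl) (I.edgeProb_nonneg B u v)
    linarith

/-! ### Good values occur in the tables -/

/-- `a` distributes the budget over the nodes: it is the indicator of `B`, except that a leaf may
receive more than `1`, and that boosting an inner seed is pointless. -/
structure Allocation (I : TreeInstance n) (B : Finset (Fin n)) (a : Fin n → ℕ) : Prop where
  leaf : ∀ parent v, I.Toward I.root parent v → I.kids parent v = [] → (v ∈ B ↔ 0 < a v)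
  inner : ∀ parent v, I.Toward I.root parent v → I.kids parent v ≠ [] →
    a v = (decide (v ∈ B)).toNat
  seed : ∀ parent v, I.Toward I.root parent v → I.kids parent v ≠ [] → v ∈ I.seeds → a v = 0

/-- The value that remains in the subtree of `v` after the losses by rounding. -/
noncomputable def target (I : TreeInstance n) (B : Finset (Fin n)) (δ : ℝ)
    (parent : Option (Fin n)) (v : Fin n) : ℝ :=
  ∑ x ∈ I.side parent v, (I.nodeBoost B x - δ * I.pathSum B none x)

/-- For some rounded `c` and every sufficiently large rounded `f` the table of `v` has an entry
with value at least `target`. -/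
def CompleteTable (I : TreeInstance n) (B : Finset (Fin n)) (a : Fin n → ℕ) (δ : ℝ) (M : ℕ)
    (parent : Option (Fin n)) (v : Fin n) (T : Table n) : Prop :=
  ∃ ci ≤ M, I.ap B parent v - δ * I.pathSum B parent v ≤ rounded δ M ci ∧
    ∀ fi ≤ M, (∀ u, parent = some u →
      I.ap B (some v) u - δ * I.pathSum B (some v) u ≤ rounded δ M fi) →
      (T (∑ x ∈ I.side parent v, a x, ci, fi)).Reaches (I.target B δ parent v)

section Complete

variable {I : TreeInstance n} {δ : ℝ} {M : ℕ} {parent : Option (Fin n)} {v : Fin n}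
  {B : Finset (Fin n)} {a : Fin n → ℕ} {k : ℕ}

lemma leafTable_complete (hδ : IsRounding δ M) (ha : I.Allocation B a) (hk : ∑ x, a x ≤ k)
    (ht : I.Toward I.root parent v) (hkids : I.kids parent v = []) :
    I.CompleteTable B a δ M parent v
      (I.leafTable (fun v => I.ap ∅ none v) k δ M parent v).val := by
  have h := ht.borders
  have hside := I.side_of_kids_nil h hkids
  have hE := mul_nonneg hδ.pos.le (I.pathSum_nonneg B parent v)
  have hap : I.ap B parent v = rounded δ M (if v ∈ I.seeds then M else 0) := by
    rw [I.ap_eq B h, hkids]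
    split_ifs
    · exact IsRounding.rounded_self.symm
    · simp [hδ.rounded_zero]
  have hc : I.ap B parent v - δ * I.pathSum B parent v
      ≤ rounded δ M (if v ∈ I.seeds then M else 0) := by
    rw [← hap]
    linarith
  -- At a leaf `c` is exact: the index `M` stands for `1` and the index `0` for `0`.
  refine ⟨if v ∈ I.seeds then M else 0, by split_ifs <;> simp, hc, fun fi hfi hf => ?_⟩
  rw [hside, Finset.sum_singleton, target, hside, Finset.sum_singleton]
  have hav : a v ≤ k := (Finset.single_le_sum (fun x _ => Nat.zero_le (a x))
    (Finset.mem_univ v)).trans hk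
  refine (I.leafTable_reaches _ k δ M parent v hav hfi).mono ?_
  have hb : v ∈ B ↔ decide (0 < a v) = true := by
    rw [ha.leaf parent v ht hkids]
    simp
  exact I.le_gain B h hδ.pos.le
    (mul_mem_Icc (hδ.rounded_mem_Icc fi) (I.readParentProb_mem_Icc _ h)) hc
    (I.le_mul_readParentProb B h hb hf)

lemma sum_side_le (hk : ∑ x, a x ≤ k) : ∑ x ∈ I.side parent v, a x ≤ k :=
  (Finset.sum_le_sum_of_subset (Finset.subset_univ _)).trans hk

lemma seed_complete_of_reaches (hδ : IsRounding δ M) (h : I.Borders parent v)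
    (hs : v ∈ I.seeds) {T : Table n}
    (hT : ∀ fi ≤ M, (T (∑ x ∈ I.side parent v, a x, M, fi)).Reaches (I.target B δ parent v)) :
    I.CompleteTable B a δ M parent v T := by
  refine ⟨M, le_rfl, ?_, fun fi hfi _ => hT fi hfi⟩
  rw [IsRounding.rounded_self, I.ap_seed B h hs]
  linarith [mul_nonneg hδ.pos.le (I.pathSum_nonneg B parent v)]

/-- `target` charges a loss to seeds too, whereas their tables contain only the values of the
branches. The sign of the seed's own term shows that this charge only weakens the target. -/
lemma seed_loss_nonpos (hδ : IsRounding δ M) (hs : v ∈ I.seeds) :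
    I.nodeBoost B v - δ * I.pathSum B none v ≤ 0 := by
  rw [I.nodeBoost_seed B hs]
  linarith [mul_nonneg hδ.pos.le (I.pathSum_nonneg B none v)]

/-- Below a seed `f = 1` is always large enough. Maximizing over `c` is harmless because a seed is
active whatever arrives from below. -/
lemma bestBelowSeed_complete (hδ : IsRounding δ M) (hk : ∑ x, a x ≤ k)
    {w : Fin n} (hw : w ∈ I.kids parent v) {T : Table n}
    (hT : I.CompleteTable B a δ M (some v) w T) :
    Entry.Reaches ((bestBelowSeed k M T).val (∑ x ∈ I.side (some v) w, a x))
      (I.target B δ (some v) w) := by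
  obtain ⟨ci, hci, -, hT⟩ := hT
  refine bestBelowSeed_reaches k M T (sum_side_le hk) hci (hT M le_rfl ?_)
  intro u hu
  obtain rfl := Option.some.inj hu
  have hb := I.borders_swap (I.borders_kid hw)
  rw [IsRounding.rounded_self]
  linarith [(I.ap_mem_Icc B hb).2, mul_nonneg hδ.pos.le (I.pathSum_nonneg B (some w) v)]

lemma seedTableOne_complete (hδ : IsRounding δ M) (ha : I.Allocation B a) (hk : ∑ x, a x ≤ k)
    (ht : I.Toward I.root parent v) {w : Fin n} (hkids : I.kids parent v = [w])
    (hs : v ∈ I.seeds) {T₁ : Table n} (h₁ : I.CompleteTable B a δ M (some v) w T₁) :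
    I.CompleteTable B a δ M parent v (seedTableOne k M T₁).val := by
  have h := ht.borders
  refine seed_complete_of_reaches hδ h hs fun fi hfi => ?_
  have hg := bestBelowSeed_complete hδ hk (parent := parent) (by simp [hkids]) h₁
  have hκ : ∑ x ∈ I.side parent v, a x = ∑ x ∈ I.side (some v) w, a x := by
    rw [I.sum_side h, hkids, ha.seed parent v ht (by simp [hkids]) hs]
    simp
  rw [hκ]
  refine (seedTable_reaches k M _ (sum_side_le hk) hfi hg).mono ?_
  rw [target, I.sum_side h, hkids]
  have := seed_loss_nonpos (B := B) hδ hs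
  simp only [List.map_cons, List.map_nil, List.sum_cons, List.sum_nil]
  simp only [target]
  linarith

lemma seedTableTwo_complete (hδ : IsRounding δ M) (ha : I.Allocation B a) (hk : ∑ x, a x ≤ k)
    (ht : I.Toward I.root parent v) {w₁ w₂ : Fin n} (hkids : I.kids parent v = [w₁, w₂])
    (hs : v ∈ I.seeds) {T₁ T₂ : Table n} (h₁ : I.CompleteTable B a δ M (some v) w₁ T₁)
    (h₂ : I.CompleteTable B a δ M (some v) w₂ T₂) :
    I.CompleteTable B a δ M parent v (seedTableTwo k M T₁ T₂).val := by
  have h := ht.borders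
  refine seed_complete_of_reaches hδ h hs fun fi hfi => ?_
  have hg₁ := bestBelowSeed_complete hδ hk (parent := parent) (by simp [hkids]) h₁
  have hg₂ := bestBelowSeed_complete hδ hk (parent := parent) (by simp [hkids]) h₂
  have hκ : ∑ x ∈ I.side parent v, a x
      = ∑ x ∈ I.side (some v) w₁, a x + ∑ x ∈ I.side (some v) w₂, a x := by
    rw [I.sum_side h, hkids, ha.seed parent v ht (by simp [hkids]) hs]
    simp
  have hκk := sum_side_le (I := I) (parent := parent) (v := v) hk
  rw [hκ] at hκk ⊢
  rw [seedTableTwo_val]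
  refine (seedTable_reaches k M _ hκk hfi (combineBelowSeed_reaches k _ _ hκk hg₁ hg₂)).mono ?_
  rw [target, I.sum_side h, hkids]
  have := seed_loss_nonpos (B := B) hδ hs
  simp only [List.map_cons, List.map_nil, List.sum_cons, List.sum_nil]
  simp only [target]
  linarith

lemma kid_loss {w : Fin n} {b : Bool} {c : ℝ} (hw : w ∈ I.kids parent v)
    (hb : v ∈ B ↔ b = true)
    (hc : I.ap B (some v) w - δ * I.pathSum B (some v) w ≤ c) :
    I.ap B (some v) w * I.edgeProb B w v - δ * (I.pathSum B (some v) w * I.edgeProb B w v)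
      ≤ c * (I.readProb b w v).val := by
  rw [I.readProb_eq B (I.mem_kids.1 hw).1.symm hb]
  have := mul_le_mul_of_nonneg_right hc (I.edgeProb_nonneg B w v)
  linarith

/-- The table entry to look for is the one belonging to the decision of `B` at `v`, to the `c` that
completeness of the child provides, and to the given `f`. -/
lemma nonseedTableOne_complete (hδ : IsRounding δ M) (ha : I.Allocation B a)
    (hk : ∑ x, a x ≤ k) (ht : I.Toward I.root parent v) {w : Fin n}
    (hkids : I.kids parent v = [w]) (hs : v ∉ I.seeds) {T₁ : Table n}
    (h₁ : I.CompleteTable B a δ M (some v) w T₁) :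
    I.CompleteTable B a δ M parent v
      (I.nonseedTableOne (fun v => I.ap ∅ none v) k δ M parent v w T₁).val := by
  have h := ht.borders
  have hw : w ∈ I.kids parent v := by simp [hkids]
  obtain ⟨ci₁, hci₁, hc₁, hT₁⟩ := h₁
  obtain ⟨b, hbdef⟩ : ∃ b, b = decide (v ∈ B) := ⟨_, rfl⟩
  have hb : v ∈ B ↔ b = true := by simp [hbdef]
  have hκ : ∑ x ∈ I.side parent v, a x = ∑ x ∈ I.side (some v) w, a x + b.toNat := by
    rw [I.sum_side h, hkids, ha.inner parent v ht (by simp [hkids]), ← hbdef, add_comm]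
    simp
  have hκk := sum_side_le (I := I) (parent := parent) (v := v) hk
  rw [hκ] at hκk
  have hp := I.readParentProb_mem_Icc b h
  have hp₁ := readProb_mem_Icc I b (I.mem_kids.1 hw).1.symm
  have hcp := mul_mem_Icc (hδ.rounded_mem_Icc ci₁) hp₁
  have hloss := kid_loss hw hb hc₁
  have hpath : I.pathSum B parent v = 1 + I.pathSum B (some v) w * I.edgeProb B w v := by
    rw [I.pathSum_eq B h, hkids]
    simp
  have hc : I.ap B parent v - δ * I.pathSum B parent v
      ≤ rounded δ M (roundIdx δ M (rounded δ M ci₁ * (I.readProb b w v).val)) := by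
    -- This rounding loses at most `δ`, which is the summand `1` in the recursion of `pathSum`.
    refine le_trans ?_ (hδ.le_rounded_roundIdx hcp.1 hcp.2)
    rw [I.ap_one B h hs hkids, hpath]
    linarith
  -- The index of `c` is fixed before `f` is known. This is possible because `c` depends on the
  -- subtree alone, and necessary because the parent computes the `f` of `v` only after choosing the
  -- `c` of its children.
  refine ⟨_, hδ.roundIdx_le hcp.1, hc, fun fi hfi hf => ?_⟩
  have hfp := mul_mem_Icc (hδ.rounded_mem_Icc fi) hp
  have hup := I.le_mul_readParentProb B h hb hf
  rw [hκ]
  refine (I.nonseedTableOne_reaches _ k δ M parent v w T₁ b rfl rfl hci₁ hfi hκk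
    (hT₁ _ (hδ.roundIdx_le hfp.1) ?_)).mono ?_
  · intro u hu
    obtain rfl := Option.some.inj hu
    refine le_trans ?_ (hδ.le_rounded_roundIdx hfp.1 hfp.2)
    rw [I.ap_one_kid B h hs hkids, I.pathSum_kid B h hw, hkids]
    simp only [ne_eq, not_true_eq_false, decide_false, Bool.false_eq_true,
      not_false_eq_true, List.filter_cons_of_neg, List.filter_nil, List.map_nil, List.sum_nil]
    linarith
  · have := I.le_gain B h hδ.pos.le hfp hc hup
    rw [target, I.sum_side h, hkids]
    simp only [List.map_cons, List.map_nil, List.sum_cons, List.sum_nil]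
    simp only [target]
    linarith

lemma nonseedTableTwo_complete (hδ : IsRounding δ M) (ha : I.Allocation B a)
    (hk : ∑ x, a x ≤ k) (ht : I.Toward I.root parent v) {w₁ w₂ : Fin n}
    (hkids : I.kids parent v = [w₁, w₂]) (hs : v ∉ I.seeds) {T₁ T₂ : Table n}
    (h₁ : I.CompleteTable B a δ M (some v) w₁ T₁) (h₂ : I.CompleteTable B a δ M (some v) w₂ T₂) :
    I.CompleteTable B a δ M parent v
      (I.nonseedTableTwo (fun v => I.ap ∅ none v) k δ M parent v w₁ w₂ T₁ T₂).val := by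
  have h := ht.borders
  have hw₁ : w₁ ∈ I.kids parent v := by simp [hkids]
  have hw₂ : w₂ ∈ I.kids parent v := by simp [hkids]
  have hne := I.ne_of_kids_two hkids
  obtain ⟨ci₁, hci₁, hc₁, hT₁⟩ := h₁
  obtain ⟨ci₂, hci₂, hc₂, hT₂⟩ := h₂
  obtain ⟨b, hbdef⟩ : ∃ b, b = decide (v ∈ B) := ⟨_, rfl⟩
  have hb : v ∈ B ↔ b = true := by simp [hbdef]
  have hκ : ∑ x ∈ I.side parent v, a x
      = ∑ x ∈ I.side (some v) w₁, a x + ∑ x ∈ I.side (some v) w₂, a x + b.toNat := by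
    rw [I.sum_side h, hkids, ha.inner parent v ht (by simp [hkids]), ← hbdef, add_comm]
    simp
  have hκk := sum_side_le (I := I) (parent := parent) (v := v) hk
  rw [hκ] at hκk
  have hp := I.readParentProb_mem_Icc b h
  have hcp₁ := mul_mem_Icc (hδ.rounded_mem_Icc ci₁)
    (readProb_mem_Icc I b (I.mem_kids.1 hw₁).1.symm)
  have hcp₂ := mul_mem_Icc (hδ.rounded_mem_Icc ci₂)
    (readProb_mem_Icc I b (I.mem_kids.1 hw₂).1.symm)
  have hloss₁ := kid_loss hw₁ hb hc₁
  have hloss₂ := kid_loss hw₂ hb hc₂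
  have hap₁ := mul_mem_Icc (I.ap_mem_Icc B (I.borders_kid hw₁))
    ⟨I.edgeProb_nonneg B w₁ v, I.edgeProb_le_one B w₁ v⟩
  have hE₁ := mul_nonneg hδ.pos.le
    (mul_nonneg (I.pathSum_nonneg B (some v) w₁) (I.edgeProb_nonneg B w₁ v))
  have hE₂ := mul_nonneg hδ.pos.le
    (mul_nonneg (I.pathSum_nonneg B (some v) w₂) (I.edgeProb_nonneg B w₂ v))
  have hE := mul_nonneg hδ.pos.le (I.sumParent_nonneg B parent v)
  have hX := one_sub_mul_one_sub_mem_Icc hcp₁ hcp₂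
  have hpath : I.pathSum B parent v = 1 + (I.pathSum B (some v) w₁ * I.edgeProb B w₁ v +
      I.pathSum B (some v) w₂ * I.edgeProb B w₂ v) := by
    rw [I.pathSum_eq B h, hkids]
    simp
  have hc : I.ap B parent v - δ * I.pathSum B parent v
      ≤ rounded δ M (roundIdx δ M (1 - (1 - rounded δ M ci₁ * (I.readProb b w₁ v).val) *
        (1 - rounded δ M ci₂ * (I.readProb b w₂ v).val))) := by
    refine le_trans ?_ (hδ.le_rounded_roundIdx hX.1 hX.2)
    rw [I.ap_two B h hs hkids, hpath]
    -- The losses of the two children add up; rounding contributes one further `δ`.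
    have := one_sub_mul_one_sub_loss hcp₂.1 hcp₂.2 hap₁ hE₁ hE₂ hloss₁ hloss₂
    linarith
  refine ⟨_, hδ.roundIdx_le hX.1, hc, fun fi hfi hf => ?_⟩
  have hfp := mul_mem_Icc (hδ.rounded_mem_Icc fi) hp
  have hup := I.le_mul_readParentProb B h hb hf
  have hup0 := I.fromParent_mem_Icc B h
  have hY₁ := one_sub_mul_one_sub_mem_Icc hfp hcp₂
  have hY₂ := one_sub_mul_one_sub_mem_Icc hfp hcp₁
  rw [hκ]
  refine (I.nonseedTableTwo_reaches _ k δ M parent v w₁ w₂ T₁ T₂ b rfl rfl rfl hci₁ hci₂ hfi hκk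
    (hT₁ _ (hδ.roundIdx_le hY₁.1) ?_) (hT₂ _ (hδ.roundIdx_le hY₂.1) ?_)).mono ?_
  · intro u hu
    obtain rfl := Option.some.inj hu
    refine le_trans ?_ (hδ.le_rounded_roundIdx hY₁.1 hY₁.2)
    -- The loss handed down to `w₁` comes from the rounding at `v`, from the parent and from the
    -- sibling, but not from `w₁` itself.
    have hsum : I.pathSum B (some w₁) v = 1 + (I.sumParent B parent v +
        I.pathSum B (some v) w₂ * I.edgeProb B w₂ v) := by
      rw [I.pathSum_kid B h hw₁, hkids]
      simp [hne.symm]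
    rw [I.ap_two_kid₁ B h hs hkids, hsum]
    have := one_sub_mul_one_sub_loss hcp₂.1 hcp₂.2 hup0 hE hE₂ hup hloss₂
    linarith
  · intro u hu
    obtain rfl := Option.some.inj hu
    refine le_trans ?_ (hδ.le_rounded_roundIdx hY₂.1 hY₂.2)
    have hsum : I.pathSum B (some w₂) v = 1 + (I.sumParent B parent v +
        I.pathSum B (some v) w₁ * I.edgeProb B w₁ v) := by
      rw [I.pathSum_kid B h hw₂, hkids]
      simp [hne]
    rw [I.ap_two_kid₂ B h hs hkids, hsum]
    have := one_sub_mul_one_sub_loss hcp₁.1 hcp₁.2 hup0 hE hE₁ hup hloss₁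
    linarith
  · have := I.le_gain B h hδ.pos.le hfp hc hup
    rw [target, I.sum_side h, hkids]
    simp only [List.map_cons, List.map_nil, List.sum_cons, List.sum_nil]
    simp only [target]
    linarith

lemma dpTable_complete (hI : ∀ v, (I.children v).card ≤ 2) (hδ : IsRounding δ M)
    (ha : I.Allocation B a) (hk : ∑ x, a x ≤ k) (fuel : ℕ)
    (h : I.Toward I.root parent v) (hf : (I.side parent v).card ≤ fuel) :
    I.CompleteTable B a δ M parent v
      (I.dpTable (fun v => I.ap ∅ none v) k δ M fuel parent v).val := by
  refine I.side_induction (P := fun fuel parent v => I.Toward I.root parent v →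
    I.CompleteTable B a δ M parent v
      (I.dpTable (fun v => I.ap ∅ none v) k δ M fuel parent v).val) ?_ fuel parent v h.borders hf h
  intro fuel parent v _ _ ih h
  have hlen := h.length_kids_le hI
  have ih' := fun w hw => ih w hw (h.kid hw)
  rw [dpTable_succ_val]
  match hkids : I.kids parent v, hlen with
  | [], _ => exact leafTable_complete hδ ha hk h hkids
  | [w], _ =>
    rw [hkids] at ih'
    have h₁ := ih' w (by simp)
    by_cases hs : v ∈ I.seeds
    · simpa [tableOf, hs] using seedTableOne_complete hδ ha hk h hkids hs h₁
    · simpa [tableOf, hs] using nonseedTableOne_complete hδ ha hk h hkids hs h₁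
  | [w₁, w₂], _ =>
    rw [hkids] at ih'
    have h₁ := ih' w₁ (by simp)
    have h₂ := ih' w₂ (by simp)
    by_cases hs : v ∈ I.seeds
    · simpa [tableOf, hs] using seedTableTwo_complete hδ ha hk h hkids hs h₁ h₂
    · simpa [tableOf, hs] using nonseedTableTwo_complete hδ ha hk h hkids hs h₁ h₂
  | _ :: _ :: _ :: _, hl => simp at hl

end Complete

/-! ### Distribution of the budget -/

lemma Toward.unique {I : TreeInstance n} {x v : Fin n} {p q : Option (Fin n)}
    (hp : I.Toward x p v) (hq : I.Toward x q v) : p = q := by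
  have key : ∀ a, ¬ (I.Toward x none v ∧ I.Toward x (some a) v) := by
    rintro a ⟨h1, h2⟩
    obtain rfl : v = x := h1
    exact h2.2 (SimpleGraph.Walk.start_mem_support _)
  cases p with
  | none =>
    cases q with
    | none => rfl
    | some b => exact absurd ⟨hp, hq⟩ (key b)
  | some a =>
    cases q with
    | none => exact absurd ⟨hq, hp⟩ (key a)
    | some b => rw [I.eq_of_mem_path hp.1 hq.1 ((I.not_mem_path_iff hp.1).1 hp.2)
        ((I.not_mem_path_iff hq.1).1 hq.2)]

/-- Descending from the root must end. The leaf found absorbs the budget that a solution leaves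
unused. -/
lemma exists_leaf (I : TreeInstance n) :
    ∃ parent v, I.Toward I.root parent v ∧ I.kids parent v = [] := by
  refine I.side_induction (P := fun _ parent v => I.Toward I.root parent v →
    ∃ parent v, I.Toward I.root parent v ∧ I.kids parent v = []) ?_ n none I.root
    (I.borders_none _) (I.card_side_le _ _) rfl
  intro _ parent v _ _ ih h
  rcases hk : I.kids parent v with _ | ⟨w, l⟩
  · exact ⟨parent, v, h, hk⟩
  · exact ih w (by simp [hk]) (h.kid (by simp [hk]))

/-- Every solution can be improved to one that uses the whole budget in the sense of
`Allocation`. -/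
lemma exists_allocation (I : TreeInstance n) {k : ℕ} {B : Finset (Fin n)} (hB : B.card ≤ k) :
    ∃ (B' : Finset (Fin n)) (a : Fin n → ℕ), I.Allocation B' a ∧ ∑ x, a x = k ∧
      B'.card ≤ k ∧ I.boost B ≤ I.boost B' := by
  obtain ⟨p, l, hl, hkl⟩ := I.exists_leaf
  obtain ⟨B₀, hB₀⟩ : ∃ B₀, B₀ = B \ I.seeds := ⟨_, rfl⟩
  have hB₀k : B₀.card ≤ k := (Finset.card_le_card (by simp [hB₀])).trans hB
  have hboost : I.boost B = I.boost B₀ := I.boost_congr fun x hx => by simp [hB₀, hx]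
  have her : (B₀.erase l).card ≤ k := Finset.card_erase_le.trans hB₀k
  -- If nothing remains for `l`, then the other nodes of `B₀` already use up the budget, so `l`
  -- cannot belong to `B₀` as well.
  have hzero : k - (B₀.erase l).card = 0 → l ∉ B₀ := by
    intro h0 hmem
    have := Finset.card_erase_lt_of_mem hmem
    omega
  -- The tables demand that the budgets add up to exactly `k`. Seeds are dropped from `B`, since
  -- tables of inner seeds have no budget of their own, and the leaf `l` receives all that the other
  -- nodes do not use. Boosting `l` in addition can only help.
  refine ⟨if 0 < k - (B₀.erase l).card then insert l B₀ else B₀,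
    fun v => if v = l then k - (B₀.erase l).card else if v ∈ B₀ then 1 else 0, ⟨?_, ?_, ?_⟩,
    ?_, ?_, ?_⟩
  · intro parent v _ _
    by_cases hv : v = l
    · subst hv
      by_cases h0 : 0 < k - (B₀.erase v).card
      · simp [h0]
      · simp only [if_neg h0, if_true]
        exact iff_of_false (hzero (by omega)) h0
    · by_cases h0 : 0 < k - (B₀.erase l).card <;> by_cases hvB : v ∈ B₀ <;> simp [h0, hv, hvB]
  · intro parent v hv hk
    have hvl : v ≠ l := by
      rintro rfl
      rw [hv.unique hl] at hk
      exact hk hkl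
    by_cases h0 : 0 < k - (B₀.erase l).card <;> by_cases hvB : v ∈ B₀ <;> simp [h0, hvl, hvB]
  · intro parent v hv hk hs
    have hvl : v ≠ l := by
      rintro rfl
      rw [hv.unique hl] at hk
      exact hk hkl
    have hvB : v ∉ B₀ := by simp [hB₀, hs]
    simp [hvl, hvB]
  · have e : ∀ v, (if v = l then k - (B₀.erase l).card else if v ∈ B₀ then 1 else 0)
        = (if v = l then k - (B₀.erase l).card else 0) + if v ∈ B₀.erase l then 1 else 0 := by
      intro v
      by_cases hv : v = l <;> simp [hv]
    rw [Finset.sum_congr rfl fun v _ => e v, Finset.sum_add_distrib, Finset.sum_ite_eq',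
      if_pos (Finset.mem_univ l), Finset.sum_boole, Finset.filter_univ_mem]
    push_cast
    omega
  · split_ifs with h0
    · have e : insert l (B₀.erase l) = insert l B₀ := by
        ext x
        by_cases hx : x = l <;> simp [hx]
      have := Finset.card_insert_le l (B₀.erase l)
      rw [← e]
      omega
    · exact hB₀k
  · rw [hboost]
    refine I.boost_mono ?_
    split_ifs
    · exact Finset.subset_insert l B₀
    · exact subset_rfl

end TreeInstance

end Boosting

namespace Boosting

open Prog

variable {n : ℕ}

namespace TreeInstance

/-! ### The whole algorithm -/

/-- The best entry `max_c T (k, c, 0)` of the table of the root. -/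
noncomputable def bestAtRoot (k M : ℕ) (T : Table n) : Prog (Entry n) :=
  loopN (M + 1) (none : Entry n) fun best ci => do
    let e ← read T (k, ci, 0)
    Entry.best best e

lemma bestAtRoot_time_le (k M : ℕ) (T : Table n) : (bestAtRoot k M T).time ≤ (M + 1) * 4 := by
  refine loopN_time_le_mul _ _ _ _ fun e ci _ => ?_
  have := Entry.best_time_le e (T (k, ci, 0))
  simp only [time_bind, time_read, val_read]
  omega

lemma bestAtRoot_reaches (k M : ℕ) (T : Table n) {ci : ℕ} (hci : ci ≤ M) {x : ℝ}
    (h : (T (k, ci, 0)).Reaches x) : Entry.Reaches (bestAtRoot k M T).val x :=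
  loopN_reach (i := ci) (P := fun e : Entry n => e.Reaches x) _ _ _ (by omega)
    (fun _ he _ _ => Entry.best_reaches_left _ he) fun e => Entry.best_reaches_right e h

lemma bestAtRoot_eq_some (k M : ℕ) (T : Table n) {y : ℝ × NodeSet n}
    (h : (bestAtRoot k M T).val = some y) : ∃ ci, T (k, ci, 0) = some y := by
  refine loopN_induction (P := fun e : Entry n => ∀ y, e = some y → ∃ ci, T (k, ci, 0) = some y)
    (M + 1) none _ (by simp) (fun e he ci _ y hy => ?_) y h
  simp only [val_bind, val_read] at hy
  rcases Entry.best_val e (T (k, ci, 0)) with h' | h' <;> rw [h'] at hy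
  · exact he y hy
  · exact ⟨ci, hy⟩

/-- The computation of the array `ap_∅`. -/
noncomputable def activationArray (I : TreeInstance n) : Prog (Fin n → ℝ) := do
  let B₀ ← alloc n false
  let ap ← alloc n (0 : ℝ)
  loop (List.finRange n) ap fun ap v => do
    let a ← call (I.activation B₀ n none v)
    write ap v a

lemma activationArray_val (I : TreeInstance n) :
    (I.activationArray).val = fun v => I.ap ∅ none v := by
  funext v
  have h0 : (fun _ : Fin n => false) = fun v => decide (v ∈ (∅ : Finset (Fin n))) := by simp
  rw [activationArray, val_bind, val_bind, loop_write (h := fun v => I.ap ∅ none v) _ _ _ _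
    (List.mem_finRange v)]
  intro T i
  simp only [val_bind, val_alloc, val_call, val_write, ap, h0]

lemma activationArray_time_le (I : TreeInstance n) (hI : ∀ v, (I.children v).card ≤ 2) :
    (I.activationArray).time ≤ 2 * n + n * (30 * n + 3) := by
  rw [activationArray, time_bind, time_bind, time_alloc, time_alloc, ← add_assoc, two_mul]
  have := loop_time_le (List.finRange n) (fun _ : Fin n => (0 : ℝ)) (fun ap v => do
    let a ← call (I.activation (fun _ => false) n none v)
    write ap v a) (30 * n + 2) (by
      intro s v _
      have := I.activation_time_le hI (fun _ => false) n (I.borders_none v)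
        (I.card_side_le none v)
      simp at this ⊢
      omega)
  rw [List.length_finRange] at this
  exact Nat.add_le_add_left this _

/-- The entry that `roundedDP` writes out. -/
noncomputable def rootEntry (I : TreeInstance n) (k : ℕ) (δ : ℝ) : Entry n :=
  (bestAtRoot k ⌈1 / δ⌉₊
    (I.dpTable (fun v => I.ap ∅ none v) k δ ⌈1 / δ⌉₊ n none I.root).val).val

/-- Write out the node set of an entry. -/
noncomputable def writeOut (e : Entry n) : Prog (List (Fin n)) :=
  match e with
  | none => step []
  | some (_, s) => call (s.flatten [])

/-- Replaces the computed array by the function `ap ∅ none`, so that the results on `dpTable` apply.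
Value and time are stated separately because grouping the first loop as `activationArray` changes
the bracketing of the times. -/
lemma roundedDP_eq (I : TreeInstance n) (k : ℕ) (δ : ℝ) :
    (I.roundedDP k δ).val = (writeOut (I.rootEntry k δ)).val ∧
    (I.roundedDP k δ).time = (I.activationArray).time + 2 +
      ((I.dpTable (fun v => I.ap ∅ none v) k δ ⌈1 / δ⌉₊ n none I.root).time + 1) +
      (bestAtRoot k ⌈1 / δ⌉₊
        (I.dpTable (fun v => I.ap ∅ none v) k δ ⌈1 / δ⌉₊ n none I.root).val).time +
      (writeOut (I.rootEntry k δ)).time := by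
  have e : I.roundedDP k δ = (do
      let B₀ ← alloc n false
      let ap ← alloc n (0 : ℝ)
      let ap₀ ← loop (List.finRange n) ap fun ap v => do
        let a ← call (I.activation B₀ n none v)
        write ap v a
      let r ← 1 / reg δ
      let M ← step ⌈r⌉₊
      let T ← call (I.dpTable ap₀ k δ M n none I.root)
      let best ← bestAtRoot k M T
      writeOut best) := rfl
  have hap := I.activationArray_val
  rw [e, ← hap, rootEntry]
  simp only [activationArray, val_bind, time_bind, val_call, time_call, val_step, time_step,
    val_div, time_div, val_reg, time_reg, val_one, time_one] at hap ⊢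
  rw [hap]
  constructor
  · trivial
  · omega

lemma roundedDP_sound (I : TreeInstance n) (hI : ∀ v, (I.children v).card ≤ 2) (k : ℕ) {δ : ℝ}
    (hδ : 0 < δ) {y : ℝ × NodeSet n} (hy : I.rootEntry k δ = some y) :
    y.2.support.card ≤ k ∧ y.2.size ≤ 3 * n ∧ y.1 ≤ I.boost y.2.support := by
  obtain ⟨ci, hci⟩ := bestAtRoot_eq_some _ _ _ hy
  have hs := dpTable_sound hI (IsRounding.mk hδ rfl) k n (parent := none) (v := I.root) rfl
    (I.card_side_le _ _) _ _ hci
  refine ⟨hs.card_le, ?_, ?_⟩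
  · simpa using hs.size_le
  · rw [boost_eq_sum]
    -- The set is completed by nothing outside the subtree, which is the whole tree; the condition
    -- on `f` is void as the root has no parent.
    exact hs.value_le y.2.support (fun _ _ => Iff.rfl) (by simp)

lemma roundedDP_complete (I : TreeInstance n) (hI : ∀ v, (I.children v).card ≤ 2) {k : ℕ} {δ : ℝ}
    (hδ : 0 < δ) {B : Finset (Fin n)} (hB : B.card ≤ k) :
    Entry.Reaches (I.rootEntry k δ) (I.boost B - δ * I.totalPathProb k) := by
  obtain ⟨B', a, ha, hsum, hB', hboost⟩ := I.exists_allocation hB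
  obtain ⟨ci, hci, -, h⟩ := dpTable_complete hI (IsRounding.mk hδ rfl) ha hsum.le n
    (parent := none) (v := I.root) rfl (I.card_side_le _ _)
  -- At the root every `f` is admissible, in particular the index `0` that the program reads.
  have h := h 0 (Nat.zero_le _) (by simp)
  rw [side_none, hsum] at h
  refine (bestAtRoot_reaches k _ _ hci h).mono ?_
  rw [target, side_none, Finset.sum_sub_distrib, ← Finset.mul_sum]
  -- This is the only place where the loss for one set is compared with the maxima over all sets of
  -- at most `k` nodes that define `δ`.
  have h1 : ∑ x, I.pathSum B' none x ≤ I.totalPathProb k :=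
    Finset.sum_le_sum fun v _ => Finset.sum_le_sum fun x _ => I.pathProb_le_maxPathProb hB' x v
  have h2 : ∑ x, I.nodeBoost B' x = I.boost B' := (I.boost_eq_sum B').symm
  have := mul_le_mul_of_nonneg_left h1 hδ.le
  linarith

lemma roundedDP_val (I : TreeInstance n) (hI : ∀ v, (I.children v).card ≤ 2) (k : ℕ) {δ : ℝ}
    (hδ : 0 < δ) : (I.roundedDP k δ).val.toFinset.card ≤ k ∧
      ∀ B : Finset (Fin n), B.card ≤ k →
        I.boost B - δ * I.totalPathProb k ≤ I.boost (I.roundedDP k δ).val.toFinset := by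
  -- Completeness for the empty set shows that the root entry is not `-∞`.
  obtain ⟨y, hy, -⟩ := I.roundedDP_complete hI hδ (k := k) (B := ∅) (by simp)
  obtain ⟨h1, -, h2⟩ := I.roundedDP_sound hI k hδ hy
  have hval : (I.roundedDP k δ).val.toFinset = y.2.support := by
    rw [(I.roundedDP_eq k δ).1, hy, writeOut, val_call, NodeSet.flatten_val]
    simp
  rw [hval]
  refine ⟨h1, fun B hB => ?_⟩
  obtain ⟨z, hz, hBz⟩ := I.roundedDP_complete hI hδ hB
  obtain rfl : y = z := Option.some.inj (hy.symm.trans hz)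
  exact hBz.trans h2

lemma roundedDP_time_le (I : TreeInstance n) (hI : ∀ v, (I.children v).card ≤ 2) (k : ℕ) {δ : ℝ}
    (hδ : 0 < δ) : (I.roundedDP k δ).time ≤ 2 * n + n * (30 * n + 3) + 9 * n + 4 +
      224 * ((k + 1) ^ 2 * (⌈1 / δ⌉₊ + 1) ^ 3) * n := by
  have hn := I.card_pos
  have h1 := I.activationArray_time_le hI
  have h2 := I.dpTable_time_le hI (fun v => I.ap ∅ none v) k δ ⌈1 / δ⌉₊ n
    (I.borders_none I.root) (I.card_side_le _ _)
  have h3 := bestAtRoot_time_le k ⌈1 / δ⌉₊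
    (I.dpTable (fun v => I.ap ∅ none v) k δ ⌈1 / δ⌉₊ n none I.root).val
  have h4 : (writeOut (I.rootEntry k δ)).time ≤ 9 * n + 1 := by
    rcases hy : I.rootEntry k δ with _ | y
    · simp [writeOut]
    · obtain ⟨-, h, -⟩ := I.roundedDP_sound hI k hδ hy
      have := y.2.flatten_time_le []
      rw [writeOut, time_call]
      omega
  have h5 : ⌈1 / δ⌉₊ + 1 ≤ (k + 1) ^ 2 * (⌈1 / δ⌉₊ + 1) ^ 3 * n := by
    have : (k + 1) ^ 2 * (⌈1 / δ⌉₊ + 1) ^ 3 * n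
      = (⌈1 / δ⌉₊ + 1) * ((k + 1) ^ 2 * (⌈1 / δ⌉₊ + 1) ^ 2 * n) := by ring
    rw [this]
    exact Nat.le_mul_of_pos_right _ (by positivity)
  rw [(I.roundedDP_eq k δ).2]
  rw [side_none, Finset.card_univ, Fintype.card_fin] at h2
  have h6 : 224 * ((k + 1) ^ 2 * (⌈1 / δ⌉₊ + 1) ^ 3) * n
      = 220 * ((k + 1) ^ 2 * (⌈1 / δ⌉₊ + 1) ^ 3) * n
        + 4 * ((k + 1) ^ 2 * (⌈1 / δ⌉₊ + 1) ^ 3 * n) := by ring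
  omega

lemma roundingParameter_pos (I : TreeInstance n) (k : ℕ) {ε : ℝ} (hε : 0 < ε) (LB : ℝ) :
    0 < (I.roundingParameter k ε LB).val := by
  rw [roundingParameter_val]
  have := I.one_le_totalPathProb k
  have : 0 < max LB 1 := lt_max_of_lt_right one_pos
  positivity

lemma dpBoostWith_val (I : TreeInstance n) (k : ℕ) (ε LB : ℝ) :
    (I.dpBoostWith k ε LB).val = (I.roundedDP k (I.roundingParameter k ε LB).val).val := rfl

lemma dpBoost_val (I : TreeInstance n) (k : ℕ) (ε : ℝ) :
    (I.dpBoost k ε).val = (I.dpBoostWith k ε (I.greedyLowerBound k).val).val := rfl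

lemma dpBoost_time (I : TreeInstance n) (k : ℕ) (ε : ℝ) :
    (I.dpBoost k ε).time = (I.greedyLowerBound k).time + 1
      + (I.dpBoostWith k ε (I.greedyLowerBound k).val).time := rfl

lemma dpBoostWith_card_le (I : TreeInstance n) (hI : ∀ v, (I.children v).card ≤ 2) (k : ℕ)
    {ε : ℝ} (hε : 0 < ε) (LB : ℝ) : (I.dpBoostWith k ε LB).val.toFinset.card ≤ k :=
  (I.roundedDP_val hI k (I.roundingParameter_pos k hε LB)).1

lemma dpBoostWith_approx (I : TreeInstance n) (hI : ∀ v, (I.children v).card ≤ 2) (k : ℕ)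
    {ε : ℝ} (hε : 0 < ε) (LB : ℝ) {B : Finset (Fin n)} (hB : B.card ≤ k) (h1 : 1 ≤ I.boost B)
    (hLB : LB ≤ I.boost B) :
    (1 - ε) * I.boost B ≤ I.boost (I.dpBoostWith k ε LB).val.toFinset := by
  have h := (I.roundedDP_val hI k (I.roundingParameter_pos k hε LB)).2 B hB
  have ht := I.one_le_totalPathProb k
  -- By the choice of `δ` the total loss is exactly `ε * max LB 1`.
  rw [← dpBoostWith_val, roundingParameter_val, div_mul_cancel₀ _ (by linarith)] at h
  have := mul_le_mul_of_nonneg_left (max_le hLB h1) hε.le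
  linarith

/-- The dynamic program dominates: the cube of `M`, which is of order `n² / ε`, yields `n⁶`, and the
number of tables contributes one more `n`. -/
lemma dpBoostWith_time_le (I : TreeInstance n) (hI : ∀ v, (I.children v).card ≤ 2) {k : ℕ}
    (hk : 1 ≤ k) {ε : ℝ} (hε : 0 < ε) (LB : ℝ) :
    ((I.dpBoostWith k ε LB).time : ℝ)
      ≤ 25000 * ((k : ℝ) ^ 2 * (n : ℝ) ^ 7 * (max 1 (1 / ε)) ^ 3) := by
  have hn := I.card_pos
  have hδ := I.roundingParameter_pos k hε LB
  have hn1 : (1 : ℝ) ≤ n := by exact_mod_cast hn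
  have hk1 : (1 : ℝ) ≤ k := by exact_mod_cast hk
  have hX : (1 : ℝ) ≤ max 1 (1 / ε) := le_max_left _ _
  -- The ceiling and the extra `1` each cost one more unit, hence the factor `3`. Since `max LB 1 ≥
  -- 1`, the bound does not depend on `LB`.
  have hM : (⌈1 / (I.roundingParameter k ε LB).val⌉₊ : ℝ) + 1
      ≤ 3 * ((n : ℝ) ^ 2 * max 1 (1 / ε)) := by
    have h1 : 1 / (I.roundingParameter k ε LB).val ≤ (n : ℝ) ^ 2 * max 1 (1 / ε) := by
      rw [roundingParameter_val, one_div_div]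
      have hmax : ε ≤ ε * max LB 1 := le_mul_of_one_le_right hε.le (le_max_right _ _)
      calc I.totalPathProb k / (ε * max LB 1) ≤ (n : ℝ) ^ 2 / ε :=
            div_le_div₀ (by positivity) (I.totalPathProb_le k) hε hmax
        _ = (n : ℝ) ^ 2 * (1 / ε) := by ring
        _ ≤ _ := mul_le_mul_of_nonneg_left (le_max_right _ _) (by positivity)
    have h2 := Nat.ceil_lt_add_one (one_div_pos.2 hδ).le
    have h3 : 1 ≤ (n : ℝ) ^ 2 * max 1 (1 / ε) :=
      one_le_mul_of_one_le_of_one_le (one_le_pow₀ hn1) hX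
    linarith
  -- The constant is `2² * 3³`, using `k + 1 ≤ 2 * k`.
  have hW : ((k : ℝ) + 1) ^ 2 * ((⌈1 / (I.roundingParameter k ε LB).val⌉₊ : ℝ) + 1) ^ 3 * n
      ≤ 108 * ((k : ℝ) ^ 2 * (n : ℝ) ^ 7 * (max 1 (1 / ε)) ^ 3) := by
    calc ((k : ℝ) + 1) ^ 2 * ((⌈1 / (I.roundingParameter k ε LB).val⌉₊ : ℝ) + 1) ^ 3 * n
        ≤ (2 * (k : ℝ)) ^ 2 * (3 * ((n : ℝ) ^ 2 * max 1 (1 / ε))) ^ 3 * n := by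
          gcongr
          linarith
      _ = _ := by ring
  have htime : (I.dpBoostWith k ε LB).time ≤ (n * (50 * (k + 1) * n + (k + 1) + 3) + 3) + 1 +
      (2 * n + n * (30 * n + 3) + 9 * n + 4 +
        224 * ((k + 1) ^ 2 * (⌈1 / (I.roundingParameter k ε LB).val⌉₊ + 1) ^ 3) * n + 1) := by
    have h1 := I.roundingParameter_time_le hI k ε LB
    have h2 := I.roundedDP_time_le hI k hδ
    have h3 : (I.dpBoostWith k ε LB).time = (I.roundingParameter k ε LB).time + 1 +
      ((I.roundedDP k (I.roundingParameter k ε LB).val).time + 1) := rfl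
    omega
  have hsmall : n * (50 * (k + 1) * n + (k + 1) + 3) + 3 + 1 +
      (2 * n + n * (30 * n + 3) + 9 * n + 4 + 1) ≤ 300 * (k ^ 2 * n ^ 7) := by
    have m1 : k * n ^ 2 ≤ k ^ 2 * n ^ 7 :=
      Nat.mul_le_mul (Nat.le_self_pow two_ne_zero k) (Nat.pow_le_pow_right hn (by norm_num))
    have m2 : n ^ 2 ≤ k * n ^ 2 := Nat.le_mul_of_pos_left _ hk
    have m3 : n ≤ n ^ 2 := Nat.le_self_pow two_ne_zero n
    have m4 : k * n ≤ k * n ^ 2 := Nat.mul_le_mul_left k m3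
    have e : n * (50 * (k + 1) * n + (k + 1) + 3) + 3 + 1 +
      (2 * n + n * (30 * n + 3) + 9 * n + 4 + 1)
      = 50 * (k * n ^ 2) + 80 * n ^ 2 + k * n + 18 * n + 9 := by ring
    rw [e]
    omega
  have hsmall' : ((300 * (k ^ 2 * n ^ 7) : ℕ) : ℝ)
      ≤ 300 * ((k : ℝ) ^ 2 * (n : ℝ) ^ 7 * (max 1 (1 / ε)) ^ 3) := by
    push_cast
    have : (1 : ℝ) ≤ (max 1 (1 / ε)) ^ 3 := one_le_pow₀ hX
    exact mul_le_mul_of_nonneg_left (le_mul_of_one_le_right (by positivity) this) (by norm_num)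
  have htime' : (I.dpBoostWith k ε LB).time ≤ 300 * (k ^ 2 * n ^ 7) +
      224 * ((k + 1) ^ 2 * (⌈1 / (I.roundingParameter k ε LB).val⌉₊ + 1) ^ 3 * n) := by
    have e : 224 * ((k + 1) ^ 2 * (⌈1 / (I.roundingParameter k ε LB).val⌉₊ + 1) ^ 3) * n
      = 224 * ((k + 1) ^ 2 * (⌈1 / (I.roundingParameter k ε LB).val⌉₊ + 1) ^ 3 * n) := by ring
    omega
  have hcast : ((I.dpBoostWith k ε LB).time : ℝ) ≤ ((300 * (k ^ 2 * n ^ 7) : ℕ) : ℝ) +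
      224 * (((k : ℝ) + 1) ^ 2 *
        ((⌈1 / (I.roundingParameter k ε LB).val⌉₊ : ℝ) + 1) ^ 3 * n) := by
    exact_mod_cast htime'
  linarith

lemma greedyLowerBound_time_le_pow (I : TreeInstance n) (hI : ∀ v, (I.children v).card ≤ 2)
    {k : ℕ} (hk : 1 ≤ k) : (I.greedyLowerBound k).time + 1 ≤ 200 * (k ^ 2 * n ^ 7) := by
  have hn := I.card_pos
  have h := I.greedyLowerBound_time_le hI k
  have m1 : k * n ^ 3 ≤ k ^ 2 * n ^ 7 :=
    Nat.mul_le_mul (Nat.le_self_pow two_ne_zero k) (Nat.pow_le_pow_right hn (by norm_num))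
  have m2 : n ^ 2 ≤ n ^ 3 := Nat.pow_le_pow_right hn (by norm_num)
  have m3 : n ≤ n ^ 3 := Nat.le_self_pow three_ne_zero n
  have m4 : n ^ 3 ≤ k * n ^ 3 := Nat.le_mul_of_pos_left _ hk
  have m5 : k * n ≤ k * n ^ 3 := Nat.mul_le_mul_left k m3
  have m6 : k * n ^ 2 ≤ k * n ^ 3 := Nat.mul_le_mul_left k m2
  have m7 : k ≤ k * n ^ 3 := Nat.le_mul_of_pos_right _ (by positivity)
  have e : 2 * n + k * (n * (n * (30 * n + 3) + 7) + 2) + 2 * (n * (30 * n + 3)) + 4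
      = 8 * n + 30 * (k * n ^ 3) + 3 * (k * n ^ 2) + 7 * (k * n) + 2 * k + 60 * n ^ 2 + 4 := by
    ring
  rw [e] at h
  omega

end TreeInstance

end Boosting

/-! ### The main theorem -/

theorem mainTheorem2 :
    ∃ C : ℝ, ∀ (n : ℕ) (I : Boosting.TreeInstance n), (∀ v, (I.children v).card ≤ 2) →
      ∀ (k : ℕ), 1 ≤ k → ∀ ε : ℝ, 0 < ε →
        -- `DP-Boost` with an arbitrary lower bound of the optimal boost
        (∀ LB : ℝ,
          (I.roundingParameter k ε LB).val =
              ε * max LB 1 / ∑ v, ∑ x, I.maxPathProb k x v ∧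
          (I.dpBoostWith k ε LB).val.toFinset.card ≤ k ∧
          (∀ Bopt, I.IsOptimal k Bopt → 1 ≤ I.boost Bopt → LB ≤ I.boost Bopt →
            (1 - ε) * I.boost Bopt ≤ I.boost (I.dpBoostWith k ε LB).val.toFinset) ∧
          ((I.dpBoostWith k ε LB).time : ℝ) ≤
            C * (k : ℝ) ^ 2 * (n : ℝ) ^ 7 * (max 1 (1 / ε)) ^ 3) ∧
        -- `DP-Boost` with the lower bound computed by `Greedy-Boost`
        (I.dpBoost k ε).val.toFinset.card ≤ k ∧
        (∀ Bopt, I.IsOptimal k Bopt → 1 ≤ I.boost Bopt →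
          (1 - ε) * I.boost Bopt ≤ I.boost (I.dpBoost k ε).val.toFinset) ∧
        ((I.dpBoost k ε).time : ℝ) ≤
          C * (k : ℝ) ^ 2 * (n : ℝ) ^ 7 * (max 1 (1 / ε)) ^ 3 := by
  -- At most `25000` for the algorithm with a given bound and `200` for the greedy phase.
  refine ⟨26000, fun n I hI k hk ε hε => ?_⟩
  have hX : (1 : ℝ) ≤ (max 1 (1 / ε)) ^ 3 := one_le_pow₀ (le_max_left _ _)
  have hpos : (0 : ℝ) ≤ (k : ℝ) ^ 2 * (n : ℝ) ^ 7 * (max 1 (1 / ε)) ^ 3 := by positivity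
  have htime := I.dpBoostWith_time_le hI hk hε
  refine ⟨fun LB => ⟨I.roundingParameter_val k ε LB, I.dpBoostWith_card_le hI k hε LB, ?_, ?_⟩,
    ?_, ?_, ?_⟩
  · exact fun Bopt hopt h1 hLB => I.dpBoostWith_approx hI k hε LB hopt.1 h1 hLB
  · exact (htime LB).trans (by linarith)
  · rw [I.dpBoost_val k ε]
    exact I.dpBoostWith_card_le hI k hε _
  · intro Bopt hopt h1
    rw [I.dpBoost_val k ε]
    obtain ⟨B, hB, hLB⟩ := I.greedyLowerBound_val k
    -- The greedy bound is the boost of a feasible set, so optimality of `Bopt` gives the required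
    -- `LB ≤ I.boost Bopt`.
    exact I.dpBoostWith_approx hI k hε _ hopt.1 h1 (hLB ▸ hopt.2 B hB)
  · have h1 : (((I.greedyLowerBound k).time : ℝ) + 1) ≤ 200 * ((k : ℝ) ^ 2 * (n : ℝ) ^ 7) := by
      exact_mod_cast I.greedyLowerBound_time_le_pow hI hk
    have h2 : (k : ℝ) ^ 2 * (n : ℝ) ^ 7
        ≤ (k : ℝ) ^ 2 * (n : ℝ) ^ 7 * (max 1 (1 / ε)) ^ 3 :=
      le_mul_of_one_le_right (by positivity) hX
    have h3 := htime (I.greedyLowerBound k).val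
    rw [I.dpBoost_time k ε, Nat.cast_add, Nat.cast_add, Nat.cast_one]
    exact (add_le_add h1 h3).trans (by linarith)
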